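/- Fix an integer $n\ge 3$ and, for $\lambda\in\mathbb{C}\setminus\{0\}$, let $f_\lambda(z)=z^n+\lambda z^{-n}$, acting on the Riemann sphere $\widehat{\mathbb{C}}$ (so $f_\lambda(0)=f_\lambda(\infty)=\infty$), with Julia set $J(f_\lambda)$. Angles. Identify $\mathbb{R}/\mathbb{Z}$ with $(0,1]$ and let $\tau(\theta)=n\theta \bmod 1$. Let $\Theta_k=(\frac{k}{2n},\frac{k+1}{2n}]$ for $0\le k\le n$ and $\Theta_{-k}=(\frac{k}{2n}+\frac12,\frac{k+1}{2n}+\frac12]$ for $1\le k\le n-1$. Let $\Theta$ be the set of $\theta\in(0,1]$ whose $\tau$-orbit stays in $\bigcup_{k=1}^{n-1}(\Theta_k\cup\Theta_{-k})$; the itinerary of $\theta\in\Theta$ is the sequence $(s_0,s_1,\dots)$ in $\{\pm1,\dots,\pm(n-1)\}$ with $\tau^k(\theta)\in\Theta_{s_k}$ for all $k\ge0$. Let $\Theta_{per}$ be the set of $\tau$-periodic angles in $\Theta\setminus\{1,\frac12\}$. Sectors. Let $\mathcal{F}_0=\{\lambda\ne0:\ 0\le\arg\lambda<\frac{2\pi}{n-1}\}$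 and $\mathcal{F}=\{\lambda\neq 0:\ 0<\arg\lambda<\frac{2\pi}{n-1}\}$. For $\lambda\in\mathcal{F}_0$ let $c_0=\lambda^{1/(2n)}$ with $\arg c_0=\frac{\arg\lambda}{2n}$, and $c_k=c_0e^{k\pi i/n}$. For $0\le k\le n$ let $S_k^\lambda\subset\widehat{\mathbb{C}}$ be the closed sector (containing $0$ and $\infty$) swept counterclockwise from the ray from $0$ to $\infty$ through $c_k$ to the ray through $c_{k+1}$, and let $S_{-k}^\lambda=-S_k^\lambda$ for $1\le k\le n-1$. Cut rays. For $\theta\in\Theta_{per}$ with itinerary $(s_0,s_1,\dots)$ let $$\Omega_\lambda^\theta=\bigcap_{k\ge0}f_\lambda^{-k}\big(S_{s_k}^\lambda\cup S_{-s_k}^\lambda\big)\ \text{ if }\lambda\in\mathcal{F},\qquad \Omega_\lambda^\theta=\bigcap_{k\ge0}f_\lambda^{-k}\big((S_{s_k}^\lambda\cup S_{-s_k}^\lambda)\setminus\mathbb{R}^*\big)\ \text{ if }\lambda\in(0,+\infty),$$ where $\mathbb{R}^*=\mathbb{R}\setminus\{0\}$. Theorem. For every $\lambda\in(0,+\infty)$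 and every $\theta\in\Theta_{per}$, the set $\Omega_\lambda^\theta$ is a Jordan curve in $\widehat{\mathbb{C}}$ which meets $J(f_\lambda)$ in a Cantor set. Moreover, if $\lambda_j\in\mathcal{F}_0$ and $\lambda_j\to\lambda\in(0,+\infty)$, then $\Omega_{\lambda_j}^\theta\to\Omega_\lambda^\theta$ in the Hausdorff topology on compact subsets of $\widehat{\mathbb{C}}$. -/

import Mathlib

open Filter Topology

noncomputable section

namespace McMullen

/-- The chordal metric on the Riemann sphere `OnePoint ℂ`. -/
def chordal : OnePoint ℂ → OnePoint ℂ → ℝ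
  | OnePoint.some z, OnePoint.some w =>
      2 * ‖z - w‖ / (Real.sqrt (1 + ‖z‖ ^ 2) * Real.sqrt (1 + ‖w‖ ^ 2))
  | OnePoint.some z, OnePoint.infty => 2 / Real.sqrt (1 + ‖z‖ ^ 2)
  | OnePoint.infty, OnePoint.some w => 2 / Real.sqrt (1 + ‖w‖ ^ 2)
  | OnePoint.infty, OnePoint.infty => 0

/-- The McMullen map `z ↦ z ^ n + lam / z ^ n` as a self-map of the Riemann sphere:
both `0` and `∞` are sent to `∞`. -/
def mcMap (n : ℕ) (lam : ℂ) : OnePoint ℂ → OnePoint ℂ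
  | OnePoint.some z => if z = 0 then OnePoint.infty else OnePoint.some (z ^ n + lam / z ^ n)
  | OnePoint.infty => OnePoint.infty

/-- Normality on `U` of the family of iterates of `f`: every sequence of iterates has a
subsequence that converges uniformly on compact subsets of `U` in the chordal metric. -/
def IteratesNormalOn (f : OnePoint ℂ → OnePoint ℂ) (U : Set (OnePoint ℂ)) : Prop :=
  ∀ m : ℕ → ℕ, ∃ a : ℕ → ℕ, StrictMono a ∧ ∃ g : OnePoint ℂ → OnePoint ℂ,
    ∀ K : Set (OnePoint ℂ), IsCompact K → K ⊆ U →
      ∀ ε : ℝ, 0 < ε → ∀ᶠ j in atTop, ∀ z ∈ K, chordal (f^[m (a j)] z) (g z) < ε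

/-- The Fatou set: points with an open neighbourhood on which the iterates form a normal family. -/
def fatouSet (f : OnePoint ℂ → OnePoint ℂ) : Set (OnePoint ℂ) :=
  {z | ∃ U : Set (OnePoint ℂ), IsOpen U ∧ z ∈ U ∧ IteratesNormalOn f U}

/-- The Julia set is the complement of the Fatou set. -/
def juliaSet (f : OnePoint ℂ → OnePoint ℂ) : Set (OnePoint ℂ) :=
  (fatouSet f)ᶜ

/-- A Jordan curve: an injective continuous image of the circle in the Riemann sphere. -/
def IsJordanCurve (C : Set (OnePoint ℂ)) : Prop :=
  ∃ g : Circle → OnePoint ℂ, Continuous g ∧ Function.Injective g ∧ Set.range g = C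

/-- A Cantor set: a set homeomorphic to the middle-thirds Cantor set. -/
def IsCantorSet (K : Set (OnePoint ℂ)) : Prop :=
  Nonempty (K ≃ₜ cantorSet)

/-- Convergence of a sequence of (compact nonempty) subsets of the sphere in the Hausdorff
topology, that is, in the Hausdorff distance of the chordal metric. -/
def HausdorffTendsto (A : ℕ → Set (OnePoint ℂ)) (B : Set (OnePoint ℂ)) : Prop :=
  ∀ ε : ℝ, 0 < ε → ∀ᶠ j in atTop,
    (∀ z ∈ A j, ∃ w ∈ B, chordal z w < ε) ∧ (∀ w ∈ B, ∃ z ∈ A j, chordal z w < ε)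

/-- Multiplication by `n` on `ℝ / ℤ`, where `ℝ / ℤ` is identified with `(0, 1]`. -/
def tau (n : ℕ) (t : ℝ) : ℝ :=
  toIocMod (zero_lt_one' ℝ) 0 (n * t)

/-- The angular interval with index `k`, for `-n < k ≤ n`:
`(k / 2n, (k + 1) / 2n]` if `0 ≤ k`, and `(|k| / 2n + 1 / 2, (|k| + 1) / 2n + 1 / 2]` if `k < 0`. -/
def angArc (n : ℕ) (k : ℤ) : Set ℝ :=
  if 0 ≤ k then Set.Ioc ((k : ℝ) / (2 * n)) (((k : ℝ) + 1) / (2 * n))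
  else Set.Ioc (|(k : ℝ)| / (2 * n) + 1 / 2) ((|(k : ℝ)| + 1) / (2 * n) + 1 / 2)

/-- The symbols `±1, …, ±(n - 1)`. -/
def symbols (n : ℕ) : Set ℤ :=
  {k | 1 ≤ |k| ∧ |k| ≤ (n : ℤ) - 1}

/-- The angles in `(0, 1]` whose whole `tau`-orbit stays in the union of the intervals with
index in `±1, …, ±(n - 1)`. -/
def Theta (n : ℕ) : Set ℝ :=
  {t | t ∈ Set.Ioc (0 : ℝ) 1 ∧ ∀ k : ℕ, ∃ j ∈ symbols n, (tau n)^[k] t ∈ angArc n j}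

/-- The `tau`-periodic angles in `Theta n`, other than `1` and `1 / 2`. -/
def ThetaPer (n : ℕ) : Set ℝ :=
  {t | t ∈ Theta n ∧ t ≠ 1 ∧ t ≠ 1 / 2 ∧ t ∈ Function.periodicPts (tau n)}

/-- `s` is the itinerary of the angle `t`. -/
def IsItinerary (n : ℕ) (t : ℝ) (s : ℕ → ℤ) : Prop :=
  ∀ k : ℕ, s k ∈ symbols n ∧ (tau n)^[k] t ∈ angArc n (s k)

/-- The fundamental domain `0 ≤ arg lam < 2 π / (n - 1)` of the parameter plane. -/
def fundDomain (n : ℕ) : Set ℂ :=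
  {lam | lam ≠ 0 ∧ 0 ≤ lam.arg ∧ lam.arg < 2 * Real.pi / ((n : ℝ) - 1)}

/-- The interior `0 < arg lam < 2 π / (n - 1)` of the fundamental domain. -/
def openFundDomain (n : ℕ) : Set ℂ :=
  {lam | lam ≠ 0 ∧ 0 < lam.arg ∧ lam.arg < 2 * Real.pi / ((n : ℝ) - 1)}

/-- The critical point `c_k = c_0 * exp (k π i / n)`, where `c_0` is the principal branch of the
`2n`-th root of `lam`. On the fundamental domain this branch is positive for positive `lam` and
analytic in the interior. -/
def critPt (n : ℕ) (lam : ℂ) (k : ℕ) : ℂ :=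
  lam ^ ((1 : ℂ) / (2 * (n : ℂ))) * Complex.exp ((k : ℂ) * Real.pi * Complex.I / n)

/-- The finite points of the closed sector with vertex `0` between the rays through `c_k` and
`c_(k+1)`. -/
def planeSector (n : ℕ) (lam : ℂ) (k : ℕ) : Set ℂ :=
  {z | ∃ r φ : ℝ, 0 ≤ r ∧ 0 ≤ φ ∧ φ ≤ Real.pi / n ∧
    z = r * Complex.exp (φ * Complex.I) * critPt n lam k}

/-- The closed sector `S_k` in the Riemann sphere (it contains `0` and `∞`); for negative indices
`S_(-k) = -S_k`. -/
def sector (n : ℕ) (lam : ℂ) (k : ℤ) : Set (OnePoint ℂ) :=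
  insert OnePoint.infty ((fun z : ℂ => (OnePoint.some z : OnePoint ℂ)) ''
    (if 0 ≤ k then planeSector n lam k.natAbs else {z | -z ∈ planeSector n lam k.natAbs}))

/-- The nonzero finite real numbers, as a subset of the Riemann sphere. -/
def realStar : Set (OnePoint ℂ) :=
  (fun x : ℝ => (OnePoint.some (x : ℂ) : OnePoint ℂ)) '' {x | x ≠ 0}

/-- The intersection of the pullbacks of the full closed sectors. -/
def sectorCutRay (n : ℕ) (lam : ℂ) (s : ℕ → ℤ) : Set (OnePoint ℂ) :=
  ⋂ k : ℕ, (mcMap n lam)^[k] ⁻¹' (sector n lam (s k) ∪ sector n lam (-s k))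

/-- The modified intersection, in which the nonzero reals are removed from the sectors. -/
def modifiedCutRay (n : ℕ) (lam : ℂ) (s : ℕ → ℤ) : Set (OnePoint ℂ) :=
  ⋂ k : ℕ, (mcMap n lam)^[k] ⁻¹' ((sector n lam (s k) ∪ sector n lam (-s k)) \ realStar)

open Classical in
/-- The cut ray with itinerary `s` for a parameter in the fundamental domain: the intersection of
the pulled back closed sectors if the parameter lies in the interior of the fundamental domain, and
the modified intersection if it lies on the positive real axis. -/
def cutRay (n : ℕ) (lam : ℂ) (s : ℕ → ℤ) : Set (OnePoint ℂ) :=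
  if lam ∈ openFundDomain n then sectorCutRay n lam s else modifiedCutRay n lam s

end McMullen

end

noncomputable section

namespace McMullen

/-! ### The Riemann sphere -/

/-! Write f for the map and `k i` for the absolute value of `s i`. Since f(-z) = ±f(z), a ray is
governed by the sequence `k` alone: it is `fullRay`, which consists of 0, ∞, a set H(k) in the
sector of index `k 0` (`halfRay`) and -H(k). A nonzero z in that sector lies in H(k) exactly when
f(z) is 0 or lies in H(shift k) or its negative (`mem_halfRay_iff`). The only angles with all
indices ±(n-1) are 1/2 and 1, so periodicity forces `k i ≤ n - 2` infinitely often (`IsAdmissible`).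
For λ > 0 the nonzero reals are forward invariant, and the sectors of index 1, …, n-2 avoid them.
Hence removing the reals changes nothing (`modifiedCutRay_eq_fullRay`), and H(k) lies in an open
sector.

Three facts carry the proof.

Connectedness: on each open sector f is a rotated Joukowski map after a power, with a continuous
inverse branch. Pulling back A ∪ {0} ∪ -A along branches gives connected sets that reach both 0 and
∞, and the intersection of their closures, `rayCore`, is a connected set joining 0 to ∞ inside the
closed half ray. For λ > 0 it is the whole closed half ray (`closedHalfRay_eq_rayCore`).

Contraction: for λ > 0 the inverse branches do not increase the hyperbolic distance of the upper
half plane, by Schwarz-Pick, and they shrink `hypQ` by 5/8 in the sectors of index at most n-2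
(`hypQ_le_hypQ_planeMap`). If two orbits follow the same half planes and stay comparable in modulus
at the times of uniform contraction, then they coincide (`hypQ_nonpos_of_expanding`).

Height: a function on H(k) satisfying h(z) = ±softplus(h(±f(z))), with the sign given by the half
plane of the signed image, is obtained as the limit of a contracting iteration started at the
logarithmic modulus. It stays at bounded distance from that modulus, is continuous, and is injective
by contraction (`injOn_height`).

Together these make the closed half ray an arc from 0 to ∞, and the ray, two opposite such arcs, a
Jordan curve (`isJordanCurve_fullRay`). On it the Julia set is the set of points with bounded orbit:
escaping points are in the Fatou set, whereas contraction makes every bounded point a limit of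
iterated preimages of ∞ (`fullRay_inter_juliaSet`). Recording which half plane the orbit visits at
each time is a homeomorphism of this set onto a product of two-point spaces
(`isCantorSet_boundedRay`).

For Hausdorff convergence, limits of points on nearby rays lie on the limit ray because the sectors
are closed jointly in the parameter. Conversely, nearby half rays contain a continuum from 0 to ∞
that can accumulate only on the limit arc, so it must come close to every point of that arc
(`eventually_closedHalfRay_inter_nonempty`). -/

/-- The McMullen map in the plane (meaningful away from `0`). -/
def planeMap (n : ℕ) (μ z : ℂ) : ℂ := z ^ n + μ / z ^ n

lemma mcMap_coe {n : ℕ} {μ z : ℂ} (hz : z ≠ 0) :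
    mcMap n μ (z : OnePoint ℂ) = (planeMap n μ z : OnePoint ℂ) := by
  change (if z = 0 then OnePoint.infty else OnePoint.some (z ^ n + μ / z ^ n)) = _
  rw [if_neg hz]; rfl

lemma mcMap_zero (n : ℕ) (μ : ℂ) : mcMap n μ ((0 : ℂ) : OnePoint ℂ) = OnePoint.infty := by
  change (if (0 : ℂ) = 0 then OnePoint.infty else _) = _
  rw [if_pos rfl]

lemma mcMap_infty (n : ℕ) (μ : ℂ) : mcMap n μ OnePoint.infty = OnePoint.infty := rfl

lemma mcMap_iterate_infty (n : ℕ) (μ : ℂ) (m : ℕ) :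
    (mcMap n μ)^[m] OnePoint.infty = OnePoint.infty :=
  Function.iterate_fixed (mcMap_infty n μ) m

lemma tendsto_infty_iff {ι : Type*} {l : Filter ι} {x : ι → OnePoint ℂ} :
    Tendsto x l (𝓝 OnePoint.infty) ↔ ∀ R : ℝ, ∀ᶠ j in l, ∀ z : ℂ, x j = z → R < ‖z‖ := by
  constructor
  · intro h R
    have hU : ((fun z : ℂ => (z : OnePoint ℂ)) '' Metric.closedBall 0 R)ᶜ ∈
        𝓝 (OnePoint.infty : OnePoint ℂ) := by
      refine IsOpen.mem_nhds ?_ ?_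
      · exact OnePoint.isOpen_compl_image_coe.2
          ⟨Metric.isClosed_closedBall, isCompact_closedBall _ _⟩
      · rintro ⟨z, -, hz⟩
        exact OnePoint.coe_ne_infty z hz
    filter_upwards [h hU] with j hj z hz
    by_contra hc
    exact hj ⟨z, by simpa using hc, hz.symm⟩
  · intro h
    rw [OnePoint.hasBasis_nhds_infty.tendsto_right_iff]
    rintro s ⟨-, hs⟩
    obtain ⟨R, hR⟩ := hs.isBounded.subset_closedBall (0 : ℂ)
    filter_upwards [h R] with j hj
    induction hx : x j using OnePoint.rec with
    | infty => right; rfl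
    | coe z =>
      left
      refine ⟨z, fun hz => ?_, rfl⟩
      have := hR hz
      have h2 := hj z hx
      simp at this
      linarith

lemma exists_lift_of_tendsto {ι : Type*} {l : Filter ι} {x : ι → OnePoint ℂ} {z : ℂ}
    (h : Tendsto x l (𝓝 (z : OnePoint ℂ))) :
    ∃ y : ι → ℂ, Tendsto y l (𝓝 z) ∧ ∀ᶠ j in l, x j = (y j : OnePoint ℂ) := by
  rw [OnePoint.nhds_coe_eq] at h
  -- The value 0 assigned to ∞ is arbitrary: `x j` is eventually finite.
  refine ⟨fun j => (x j).elim 0 id, fun s hs => ?_, ?_⟩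
  · have : (fun z : ℂ => (z : OnePoint ℂ)) '' s ∈ map ((↑) : ℂ → OnePoint ℂ) (𝓝 z) :=
      image_mem_map hs
    have h' := h this
    rw [mem_map] at h' ⊢
    filter_upwards [h'] with j hj
    obtain ⟨w, hw, hwj⟩ := hj
    change (x j).elim 0 id ∈ s
    rw [← hwj]
    exact hw
  · have : (fun z : ℂ => (z : OnePoint ℂ)) '' Set.univ ∈ map ((↑) : ℂ → OnePoint ℂ) (𝓝 z) :=
      image_mem_map univ_mem
    filter_upwards [h this] with j hj
    obtain ⟨w, hw, hwj⟩ := hj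
    rw [← hwj]
    rfl

lemma tendsto_coe {ι : Type*} {l : Filter ι} {y : ι → ℂ} {z : ℂ} (h : Tendsto y l (𝓝 z)) :
    Tendsto (fun j => (y j : OnePoint ℂ)) l (𝓝 (z : OnePoint ℂ)) :=
  (OnePoint.continuous_coe.tendsto z).comp h

lemma norm_planeMap_ge {n : ℕ} {μ z : ℂ} (hn : 1 ≤ n) (hz : 1 ≤ ‖z‖) :
    ‖z‖ - ‖μ‖ ≤ ‖planeMap n μ z‖ := by
  have h1 : ‖z‖ ≤ ‖z‖ ^ n := le_self_pow₀ hz (by omega)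
  have h2 : ‖μ / z ^ n‖ ≤ ‖μ‖ := by
    rw [norm_div, norm_pow]
    exact div_le_self (norm_nonneg _) (one_le_pow₀ hz)
  have h3 := norm_sub_norm_le (z ^ n) (-(μ / z ^ n))
  rw [norm_neg, sub_neg_eq_add, norm_pow] at h3
  unfold planeMap
  linarith

lemma norm_planeMap_ge_of_le_one {n : ℕ} {μ z : ℂ} (hn : 1 ≤ n) (hz0 : z ≠ 0) (hz : ‖z‖ ≤ 1) :
    ‖μ‖ / ‖z‖ - 1 ≤ ‖planeMap n μ z‖ := by
  have hp : 0 < ‖z‖ := norm_pos_iff.2 hz0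
  have h1 : ‖z‖ ^ n ≤ ‖z‖ := pow_le_of_le_one hp.le hz (by omega)
  have h2 : ‖μ‖ / ‖z‖ ≤ ‖μ / z ^ n‖ := by
    rw [norm_div, norm_pow]
    exact div_le_div_of_nonneg_left (norm_nonneg _) (by positivity) h1
  have h3 := norm_sub_norm_le (μ / z ^ n) (-(z ^ n))
  rw [norm_neg, sub_neg_eq_add, norm_pow, add_comm (μ / z ^ n)] at h3
  unfold planeMap
  linarith

lemma planeMap_tendsto {ι : Type*} {l : Filter ι} {n : ℕ} {μ z : ι → ℂ} {lam w : ℂ}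
    (hμ : Tendsto μ l (𝓝 lam)) (hz : Tendsto z l (𝓝 w)) (hw : w ≠ 0) :
    Tendsto (fun j => planeMap n (μ j) (z j)) l (𝓝 (planeMap n lam w)) :=
  (hz.pow n).add (hμ.div (hz.pow n) (pow_ne_zero _ hw))

/-- Joint continuity of the McMullen family on the sphere. -/
lemma mcMap_tendsto {ι : Type*} {l : Filter ι} {n : ℕ} (hn : 1 ≤ n) {μ : ι → ℂ} {lam : ℂ}
    (hlam : lam ≠ 0) (hμ : Tendsto μ l (𝓝 lam)) {x : ι → OnePoint ℂ} {x₀ : OnePoint ℂ}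
    (hx : Tendsto x l (𝓝 x₀)) :
    Tendsto (fun j => mcMap n (μ j) (x j)) l (𝓝 (mcMap n lam x₀)) := by
  induction x₀ using OnePoint.rec with
  | infty =>
    rw [mcMap_infty, tendsto_infty_iff]
    rw [tendsto_infty_iff] at hx
    intro R
    have hM : ∀ᶠ j in l, ‖μ j‖ < ‖lam‖ + 1 := hμ.norm.eventually_lt_const (by linarith)
    filter_upwards [hM, hx (max 1 (R + ‖lam‖ + 1))] with j h1 h2 v hv
    induction hxj : x j using OnePoint.rec with
    | infty => rw [hxj, mcMap_infty] at hv; exact absurd hv.symm (OnePoint.coe_ne_infty v)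
    | coe z =>
      have h3 := h2 z hxj
      have h4 : 1 ≤ ‖z‖ := (le_max_left _ _).trans h3.le
      have h5 : R + ‖lam‖ + 1 < ‖z‖ := (le_max_right _ _).trans_lt h3
      have hz0 : z ≠ 0 := by rintro rfl; simp at h4; linarith
      rw [hxj, mcMap_coe hz0, OnePoint.coe_eq_coe] at hv
      rw [← hv]
      have := norm_planeMap_ge (μ := μ j) hn h4
      linarith
  | coe z =>
    obtain ⟨y, hy, hxy⟩ := exists_lift_of_tendsto hx
    by_cases hz : z = 0
    · subst hz
      rw [mcMap_zero, tendsto_infty_iff]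
      intro R
      have hL : 0 < ‖lam‖ := norm_pos_iff.2 hlam
      have hM : ∀ᶠ j in l, ‖lam‖ / 2 < ‖μ j‖ := hμ.norm.eventually_const_lt (by linarith)
      have hy' : Tendsto (fun j => ‖y j‖) l (𝓝 0) := by simpa using hy.norm
      have hR : 0 < |R| + 1 := by positivity
      filter_upwards [hM, hxy, hy'.eventually_lt_const one_pos,
        hy'.eventually_lt_const (show 0 < ‖lam‖ / 2 / (|R| + 1) by positivity)]
        with j h1 h2 h3 h4 v hv
      rw [h2] at hv
      by_cases hz0 : y j = 0
      · rw [hz0, mcMap_zero] at hv; exact absurd hv.symm (OnePoint.coe_ne_infty v)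
      rw [mcMap_coe hz0, OnePoint.coe_eq_coe] at hv
      rw [← hv]
      have h5 := norm_planeMap_ge_of_le_one (μ := μ j) hn hz0 h3.le
      have hp : 0 < ‖y j‖ := norm_pos_iff.2 hz0
      have h6 : |R| + 1 < ‖μ j‖ / ‖y j‖ := by
        rw [lt_div_iff₀ hR] at h4
        rw [lt_div_iff₀ hp]
        nlinarith
      have := le_abs_self R
      linarith
    · rw [mcMap_coe hz]
      refine (tendsto_coe (planeMap_tendsto hμ hy hz)).congr' ?_
      filter_upwards [hxy, hy.eventually_ne hz] with j h1 h2
      rw [h1, mcMap_coe h2]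

lemma mcMap_iterate_tendsto {ι : Type*} {l : Filter ι} {n : ℕ} (hn : 1 ≤ n) {μ : ι → ℂ} {lam : ℂ}
    (hlam : lam ≠ 0) (hμ : Tendsto μ l (𝓝 lam)) {x : ι → OnePoint ℂ} {x₀ : OnePoint ℂ}
    (hx : Tendsto x l (𝓝 x₀)) (m : ℕ) :
    Tendsto (fun j => (mcMap n (μ j))^[m] (x j)) l (𝓝 ((mcMap n lam)^[m] x₀)) := by
  induction m with
  | zero => simpa using hx
  | succ m ih =>
    simp only [Function.iterate_succ', Function.comp]
    exact mcMap_tendsto hn hlam hμ ih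

lemma continuous_mcMap {n : ℕ} (hn : 1 ≤ n) {lam : ℂ} (hlam : lam ≠ 0) :
    Continuous (mcMap n lam) :=
  continuous_iff_continuousAt.2 fun _ =>
    mcMap_tendsto (l := 𝓝 _) hn hlam tendsto_const_nhds tendsto_id

/-! ### The chordal metric -/

lemma chordal_coe (z w : ℂ) : chordal (z : OnePoint ℂ) (w : OnePoint ℂ) =
    2 * ‖z - w‖ / (Real.sqrt (1 + ‖z‖ ^ 2) * Real.sqrt (1 + ‖w‖ ^ 2)) := rfl

lemma chordal_coe_infty (z : ℂ) : chordal (z : OnePoint ℂ) OnePoint.infty =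
    2 / Real.sqrt (1 + ‖z‖ ^ 2) := rfl

lemma chordal_infty_coe (z : ℂ) : chordal OnePoint.infty (z : OnePoint ℂ) =
    2 / Real.sqrt (1 + ‖z‖ ^ 2) := rfl

lemma chordal_infty_infty : chordal OnePoint.infty OnePoint.infty = 0 := rfl

lemma chordal_self (x : OnePoint ℂ) : chordal x x = 0 := by
  induction x using OnePoint.rec with
  | infty => rfl
  | coe z => rw [chordal_coe]; simp

lemma chordal_nonneg (x y : OnePoint ℂ) : 0 ≤ chordal x y := by
  induction x using OnePoint.rec with
  | infty =>
    induction y using OnePoint.rec with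
    | infty => exact le_rfl
    | coe z => rw [chordal_infty_coe]; positivity
  | coe w =>
    induction y using OnePoint.rec with
    | infty => rw [chordal_coe_infty]; positivity
    | coe z => rw [chordal_coe]; positivity

lemma norm_le_sqrt_one_add (z : ℂ) : ‖z‖ ≤ Real.sqrt (1 + ‖z‖ ^ 2) :=
  Real.le_sqrt_of_sq_le (by linarith)

/-- Only the triangle inequality through ∞ is needed: it serves limits at ∞, while finite limits are
compared with the Euclidean distance. -/
lemma chordal_le_add (x y : OnePoint ℂ) :
    chordal x y ≤ chordal x OnePoint.infty + chordal y OnePoint.infty := by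
  induction x using OnePoint.rec with
  | infty =>
    induction y using OnePoint.rec with
    | infty => simp [chordal_infty_infty]
    | coe z => simp [chordal_infty_coe, chordal_coe_infty, chordal_infty_infty]
  | coe w =>
    induction y using OnePoint.rec with
    | infty => simp [chordal_infty_infty]
    | coe z =>
      rw [chordal_coe, chordal_coe_infty, chordal_coe_infty]
      have h1 : 0 < Real.sqrt (1 + ‖w‖ ^ 2) := Real.sqrt_pos.2 (by positivity)
      have h2 : 0 < Real.sqrt (1 + ‖z‖ ^ 2) := Real.sqrt_pos.2 (by positivity)
      rw [div_add_div _ _ h1.ne' h2.ne', div_le_div_iff_of_pos_right (by positivity)]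
      have := norm_sub_le w z
      have h3 := norm_le_sqrt_one_add w
      have h4 := norm_le_sqrt_one_add z
      linarith

lemma chordal_coe_infty_lt {z : ℂ} {ε : ℝ} (hε : 0 < ε) (hz : 2 / ε < ‖z‖) :
    chordal (z : OnePoint ℂ) OnePoint.infty < ε := by
  rw [chordal_coe_infty]
  have h := norm_le_sqrt_one_add z
  have hz0 : 0 < ‖z‖ := lt_trans (by positivity) hz
  rw [div_lt_iff₀ hε] at hz
  rw [div_lt_iff₀ (by linarith)]
  nlinarith

lemma chordal_infty_tendsto {ι : Type*} {l : Filter ι} {x : ι → OnePoint ℂ}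
    (hx : Tendsto x l (𝓝 OnePoint.infty)) :
    Tendsto (fun j => chordal (x j) OnePoint.infty) l (𝓝 0) := by
  rw [tendsto_infty_iff] at hx
  refine tendsto_order.2 ⟨fun a ha => Eventually.of_forall fun j =>
    ha.trans_le (chordal_nonneg _ _), fun ε hε => ?_⟩
  filter_upwards [hx (2 / ε)] with j hj
  induction hxj : x j using OnePoint.rec with
  | infty => rwa [chordal_infty_infty]
  | coe z => exact chordal_coe_infty_lt hε (hj z hxj)

lemma chordal_tendsto_zero {ι : Type*} {l : Filter ι} {x y : ι → OnePoint ℂ} {w : OnePoint ℂ}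
    (hx : Tendsto x l (𝓝 w)) (hy : Tendsto y l (𝓝 w)) :
    Tendsto (fun j => chordal (x j) (y j)) l (𝓝 0) := by
  induction w using OnePoint.rec with
  | infty =>
    refine squeeze_zero (fun j => chordal_nonneg _ _) (fun j => chordal_le_add _ _) ?_
    simpa using (chordal_infty_tendsto hx).add (chordal_infty_tendsto hy)
  | coe w =>
    obtain ⟨u, hu, hxu⟩ := exists_lift_of_tendsto hx
    obtain ⟨v, hv, hyv⟩ := exists_lift_of_tendsto hy
    have key : Tendsto (fun j => 2 * ‖u j - v j‖) l (𝓝 0) := by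
      simpa using (hu.sub hv).norm.const_mul 2
    refine squeeze_zero' (Eventually.of_forall fun j => chordal_nonneg _ _) ?_ key
    filter_upwards [hxu, hyv] with j h1 h2
    rw [h1, h2, chordal_coe]
    refine div_le_self (by positivity) ?_
    have h1 : 1 ≤ Real.sqrt (1 + ‖u j‖ ^ 2) := Real.one_le_sqrt.2 (by nlinarith [sq_nonneg ‖u j‖])
    have h2 : 1 ≤ Real.sqrt (1 + ‖v j‖ ^ 2) := Real.one_le_sqrt.2 (by nlinarith [sq_nonneg ‖v j‖])
    nlinarith

lemma eq_infty_of_chordal_lt {y : OnePoint ℂ}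
    (h : ∀ ε : ℝ, 0 < ε → chordal OnePoint.infty y < ε) : y = OnePoint.infty := by
  induction y using OnePoint.rec with
  | infty => rfl
  | coe z =>
    have := h (chordal OnePoint.infty (z : OnePoint ℂ)) (by
      rw [chordal_infty_coe]
      have : 0 < Real.sqrt (1 + ‖z‖ ^ 2) := Real.sqrt_pos.2 (by positivity)
      positivity)
    exact absurd this (lt_irrefl _)

/-! ### Sectors and critical points -/

/-- The argument is discontinuous, but a sector of opening less than π is cut out by two closed half
planes. This form passes to limits, also at the vertex, where `arg` has the value 0. -/
lemma arg_mem_Icc_iff {β : ℝ} (hβ : 0 < β) (hβ' : β < Real.pi) (z : ℂ) :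
    (0 ≤ z.arg ∧ z.arg ≤ β) ↔
      (0 ≤ z.im ∧ (z * Complex.exp (-(β * Complex.I))).im ≤ 0) := by
  have him : (z * Complex.exp (-(β * Complex.I))).im = ‖z‖ * Real.sin (z.arg - β) := by
    conv_lhs => rw [← Complex.norm_mul_exp_arg_mul_I z]
    rw [mul_assoc, ← Complex.exp_add, ← sub_eq_add_neg, ← sub_mul, ← Complex.ofReal_sub,
      Complex.im_ofReal_mul, Complex.exp_ofReal_mul_I_im]
  rw [him, ← Complex.arg_nonneg_iff]
  refine and_congr_right fun h0 => ?_
  rcases eq_or_ne z 0 with rfl | hz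
  · simp [hβ.le]
  have hp : 0 < ‖z‖ := norm_pos_iff.2 hz
  have hpi := Complex.arg_le_pi z
  constructor
  · intro h
    have : Real.sin (z.arg - β) ≤ 0 :=
      Real.sin_nonpos_of_nonpos_of_neg_pi_le (by linarith) (by linarith)
    nlinarith
  · intro h
    by_contra hc
    push Not at hc
    have : 0 < Real.sin (z.arg - β) := Real.sin_pos_of_pos_of_lt_pi (by linarith) (by linarith)
    nlinarith

lemma pi_div_lt_pi {n : ℕ} (hn : 2 ≤ n) : Real.pi / n < Real.pi :=
  div_lt_self Real.pi_pos (by exact_mod_cast hn)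

lemma pi_div_pos {n : ℕ} (hn : 2 ≤ n) : 0 < Real.pi / n :=
  div_pos Real.pi_pos (by positivity)

lemma critPt_ne_zero (n : ℕ) {μ : ℂ} (hμ : μ ≠ 0) (k : ℕ) : critPt n μ k ≠ 0 :=
  mul_ne_zero (by simp [Complex.cpow_eq_zero_iff, hμ]) (Complex.exp_ne_zero _)

lemma critPt_eq (n : ℕ) (μ : ℂ) (k : ℕ) :
    critPt n μ k = critPt n μ 0 * Complex.exp (((k * Real.pi / n : ℝ) : ℂ) * Complex.I) := by
  simp only [critPt, Nat.cast_zero, zero_mul, zero_div, Complex.exp_zero, mul_one]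
  congr 2
  push_cast
  ring

lemma critPt_succ {n : ℕ} (μ : ℂ) (k : ℕ) :
    critPt n μ (k + 1) = critPt n μ k * Complex.exp (((Real.pi / n : ℝ) : ℂ) * Complex.I) := by
  simp only [critPt]
  rw [mul_assoc (μ ^ ((1 : ℂ) / (2 * (n : ℂ)))), ← Complex.exp_add]
  congr 2
  push_cast
  ring

/-- The square root of the parameter for which `± 2 * sqrtParam n μ` are the critical values. -/
def sqrtParam (n : ℕ) (μ : ℂ) : ℂ := critPt n μ 0 ^ n

lemma sqrtParam_ne_zero (n : ℕ) {μ : ℂ} (hμ : μ ≠ 0) : sqrtParam n μ ≠ 0 :=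
  pow_ne_zero _ (critPt_ne_zero n hμ 0)

lemma sqrtParam_sq {n : ℕ} (hn : 1 ≤ n) (μ : ℂ) : sqrtParam n μ ^ 2 = μ := by
  simp only [sqrtParam, critPt, Nat.cast_zero, zero_mul, zero_div, Complex.exp_zero, mul_one]
  rw [← pow_mul, ← Complex.cpow_nat_mul]
  have : (n : ℂ) ≠ 0 := by exact_mod_cast (by omega : n ≠ 0)
  rw [show ((n * 2 : ℕ) : ℂ) * (1 / (2 * (n : ℂ))) = 1 by push_cast; field_simp, Complex.cpow_one]

lemma critPt_pow {n : ℕ} (hn : 1 ≤ n) (μ : ℂ) (k : ℕ) :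
    critPt n μ k ^ n = (-1) ^ k * sqrtParam n μ := by
  rw [critPt_eq, mul_pow, ← Complex.exp_nat_mul, sqrtParam]
  have : (n : ℂ) ≠ 0 := by exact_mod_cast (by omega : n ≠ 0)
  rw [show (n : ℂ) * (((k * Real.pi / n : ℝ) : ℂ) * Complex.I) = k * (Real.pi * Complex.I) by
    push_cast; field_simp, Complex.exp_nat_mul, Complex.exp_pi_mul_I, mul_comm]

/-- Normal form on a sector: the critical points satisfy c_k ^ n = (-1) ^ k √μ, so dividing by c_k
turns the map into the power map followed by w + 1/w, scaled by a square root of the parameter. -/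
lemma planeMap_mul_critPt {n : ℕ} (hn : 1 ≤ n) {μ : ℂ} (hμ : μ ≠ 0) (k : ℕ) {ζ : ℂ} (hζ : ζ ≠ 0) :
    planeMap n μ (critPt n μ k * ζ) = (-1) ^ k * sqrtParam n μ * (ζ ^ n + (ζ ^ n)⁻¹) := by
  have hd := sqrtParam_ne_zero n hμ
  have hw : ζ ^ n ≠ 0 := pow_ne_zero _ hζ
  have h1 : ((-1 : ℂ) ^ k) ^ 2 = 1 := by rw [← pow_mul, mul_comm, pow_mul]; simp
  have h2 : ((-1 : ℂ) ^ k) ≠ 0 := pow_ne_zero _ (by simp)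
  rw [planeMap, mul_pow, critPt_pow hn]
  nth_rewrite 2 [← sqrtParam_sq hn μ]
  field_simp
  rw [h1]
  ring

/-- The open sector between the rays through `c_k` and `c_(k+1)`. -/
def openSector (n : ℕ) (μ : ℂ) (k : ℕ) : Set ℂ :=
  {z | 0 < (z / critPt n μ k).arg ∧ (z / critPt n μ k).arg < Real.pi / n}

lemma ne_zero_of_mem_openSector {n : ℕ} {μ : ℂ} {k : ℕ} {z : ℂ} (hz : z ∈ openSector n μ k) :
    z ≠ 0 := by
  rintro rfl
  simpa using hz.1

lemma mem_planeSector_iff_arg {n : ℕ} (hn : 2 ≤ n) {μ : ℂ} (hμ : μ ≠ 0) (k : ℕ) (z : ℂ) :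
    z ∈ planeSector n μ k ↔
      0 ≤ (z / critPt n μ k).arg ∧ (z / critPt n μ k).arg ≤ Real.pi / n := by
  have hc := critPt_ne_zero n hμ k
  constructor
  · rintro ⟨r, φ, hr, hφ, hφ', rfl⟩
    rw [mul_div_cancel_right₀ _ hc]
    rcases hr.eq_or_lt with rfl | hr
    · simp [(pi_div_pos hn).le]
    · rw [Complex.arg_real_mul _ hr, Complex.arg_exp_mul_I,
        (toIocMod_eq_self _).2 ⟨by linarith [Real.pi_pos], by
          have := pi_div_lt_pi hn; linarith [Real.pi_pos]⟩]
      exact ⟨hφ, hφ'⟩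
  · rintro ⟨h1, h2⟩
    refine ⟨‖z / critPt n μ k‖, _, norm_nonneg _, h1, h2, ?_⟩
    rw [Complex.norm_mul_exp_arg_mul_I, div_mul_cancel₀ _ hc]

lemma openSector_subset_planeSector {n : ℕ} (hn : 2 ≤ n) {μ : ℂ} (hμ : μ ≠ 0) (k : ℕ) :
    openSector n μ k ⊆ planeSector n μ k := fun z hz =>
  (mem_planeSector_iff_arg hn hμ k z).2 ⟨hz.1.le, hz.2.le⟩

lemma planeSector_zero_mem (n : ℕ) (μ : ℂ) (k : ℕ) : (0 : ℂ) ∈ planeSector n μ k :=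
  ⟨0, 0, le_rfl, le_rfl, by positivity, by simp⟩

/-- Closedness of the closed sectors jointly in the parameter. -/
lemma planeSector_of_tendsto {ι : Type*} {l : Filter ι} [l.NeBot] {n : ℕ} (hn : 2 ≤ n) {k : ℕ}
    {μ z : ι → ℂ} {lam w : ℂ} (hlam : lam ≠ 0) (hμ0 : ∀ᶠ j in l, μ j ≠ 0)
    (hμ : Tendsto (fun j => critPt n (μ j) k) l (𝓝 (critPt n lam k)))
    (hz : Tendsto z l (𝓝 w)) (h : ∀ᶠ j in l, z j ∈ planeSector n (μ j) k) :
    w ∈ planeSector n lam k := by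
  rw [mem_planeSector_iff_arg hn hlam, arg_mem_Icc_iff (pi_div_pos hn) (pi_div_lt_pi hn)]
  have hdiv : Tendsto (fun j => z j / critPt n (μ j) k) l (𝓝 (w / critPt n lam k)) :=
    hz.div hμ (critPt_ne_zero n hlam k)
  have h' : ∀ᶠ j in l, 0 ≤ (z j / critPt n (μ j) k).im ∧
      (z j / critPt n (μ j) k * Complex.exp (-(((Real.pi / n : ℝ) : ℂ) * Complex.I))).im ≤ 0 := by
    filter_upwards [h, hμ0] with j h1 h2
    rwa [mem_planeSector_iff_arg hn h2, arg_mem_Icc_iff (pi_div_pos hn) (pi_div_lt_pi hn)] at h1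
  refine ⟨ge_of_tendsto ((Complex.continuous_im.tendsto _).comp hdiv) (h'.mono fun j hj => hj.1),
    le_of_tendsto ((Complex.continuous_im.tendsto _).comp (hdiv.mul_const _))
      (h'.mono fun j hj => hj.2)⟩

lemma critPt_tendsto {ι : Type*} {l : Filter ι} {n : ℕ} {μ : ι → ℂ} {lam : ℂ}
    (hlam : lam ∈ Complex.slitPlane) (hμ : Tendsto μ l (𝓝 lam)) (k : ℕ) :
    Tendsto (fun j => critPt n (μ j) k) l (𝓝 (critPt n lam k)) :=
  ((continuousAt_cpow_const hlam).tendsto.comp hμ).mul_const _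

lemma im_div_pos_of_arg {z c : ℂ} {α : ℝ} (hz : z ≠ 0) {r : ℝ} (hr : 0 < r)
    (hc : c = r * Complex.exp (α * Complex.I)) (h1 : 0 < z.arg + α) (h2 : z.arg + α < Real.pi) :
    0 < (z * c).im := by
  rw [← Complex.norm_mul_exp_arg_mul_I z, hc, mul_mul_mul_comm, ← Complex.exp_add, ← add_mul,
    ← Complex.ofReal_add, ← Complex.ofReal_mul, Complex.im_ofReal_mul, Complex.exp_ofReal_mul_I_im]
  exact mul_pos (mul_pos (norm_pos_iff.2 hz) hr) (Real.sin_pos_of_pos_of_lt_pi h1 h2)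

lemma critPt_zero_polar (n : ℕ) {μ : ℂ} (hμ : μ ≠ 0) :
    critPt n μ 0 = ‖critPt n μ 0‖ * Complex.exp (((μ.arg / (2 * n) : ℝ) : ℂ) * Complex.I) := by
  have h : critPt n μ 0 = ((Real.exp (Real.log ‖μ‖ / (2 * n)) : ℝ) : ℂ) *
      Complex.exp (((μ.arg / (2 * n) : ℝ) : ℂ) * Complex.I) := by
    simp only [critPt, Nat.cast_zero, zero_mul, zero_div, Complex.exp_zero, mul_one]
    rw [Complex.cpow_def_of_ne_zero hμ, Complex.ofReal_exp, ← Complex.exp_add, Complex.log]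
    congr 1
    push_cast
    ring
  have h2 : ‖critPt n μ 0‖ = Real.exp (Real.log ‖μ‖ / (2 * n)) := by
    rw [h, norm_mul, Complex.norm_exp_ofReal_mul_I, mul_one, Complex.norm_real,
      Real.norm_of_nonneg (Real.exp_pos _).le]
  rw [h2, h]

/-- For parameters in the fundamental domain, the sectors with index in `1, …, n - 1` lie on one
side of the line through the critical values. -/
lemma im_div_sqrtParam_pos {n : ℕ} (hn : 2 ≤ n) {μ : ℂ} (hμ : μ ∈ fundDomain n) {k : ℕ}
    (hk1 : 1 ≤ k) (hkn : k + 1 ≤ n) {z : ℂ} (hz : z ∈ openSector n μ k) :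
    0 < (z / sqrtParam n μ).im := by
  obtain ⟨hμ0, harg0, harg1⟩ := hμ
  have hc0 := critPt_ne_zero n hμ0 0
  have hck := critPt_ne_zero n hμ0 k
  have hn0 : (0 : ℝ) < n := by positivity
  have hn1 : (0 : ℝ) < (n : ℝ) - 1 := by
    have : (2 : ℝ) ≤ n := by exact_mod_cast hn
    linarith
  have hρ : 0 < ‖critPt n μ 0‖ := norm_pos_iff.2 hc0
  have hsplit : z / sqrtParam n μ = z / critPt n μ k * (critPt n μ k / sqrtParam n μ) := by
    field_simp
  rw [hsplit]
  -- Here α is the argument of c_k divided by that of the square root of μ; the two goals below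
  -- confine the argument of z / √μ to (0, π).
  refine im_div_pos_of_arg (α := μ.arg / (2 * n) + k * Real.pi / n - n * (μ.arg / (2 * n)))
    (r := ‖critPt n μ 0‖ / ‖critPt n μ 0‖ ^ n)
    (div_ne_zero (ne_zero_of_mem_openSector hz) hck) (by positivity) ?_ ?_ ?_
  · rw [critPt_eq, sqrtParam, critPt_zero_polar n hμ0, mul_pow, ← Complex.exp_nat_mul]
    simp only [norm_mul, Complex.norm_exp_ofReal_mul_I, Complex.norm_real, norm_norm, mul_one]
    rw [Complex.ofReal_sub, Complex.ofReal_add, sub_mul, add_mul, Complex.exp_sub, Complex.exp_add]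
    push_cast
    have e1 := Complex.exp_ne_zero (↑n * (↑μ.arg / (2 * ↑n) * Complex.I))
    have e2 : (‖critPt n μ 0‖ : ℂ) ≠ 0 := by exact_mod_cast hρ.ne'
    rw [mul_assoc (n : ℂ)]
    field_simp
  · have h1 := hz.1
    have hk : Real.pi / n ≤ k * Real.pi / n := by
      rw [div_le_div_iff_of_pos_right hn0]
      have : (1 : ℝ) ≤ k := by exact_mod_cast hk1
      nlinarith [Real.pi_pos]
    -- This is where the aperture 2π/(n-1) of the fundamental domain enters: the relative rotation
    -- of c_0 and √μ is at most one sector, which `k ≥ 1` compensates.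
    have hδ : n * (μ.arg / (2 * n)) - μ.arg / (2 * n) ≤ Real.pi / n := by
      rw [lt_div_iff₀ hn1] at harg1
      rw [le_div_iff₀ hn0]
      have : (n * (μ.arg / (2 * n)) - μ.arg / (2 * n)) * n = μ.arg * (n - 1) / 2 := by
        field_simp
      rw [this]
      linarith
    linarith
  · have h2 := hz.2
    have hk : Real.pi / n + k * Real.pi / n ≤ Real.pi := by
      rw [← add_div, div_le_iff₀ hn0]
      have : (k : ℝ) + 1 ≤ n := by exact_mod_cast hkn
      nlinarith [Real.pi_pos]
    have hδ : 0 ≤ n * (μ.arg / (2 * n)) - μ.arg / (2 * n) := by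
      have : n * (μ.arg / (2 * n)) - μ.arg / (2 * n) = (n - 1) * (μ.arg / (2 * n)) := by ring
      rw [this]; positivity
    linarith

/-! ### Positive real parameters -/

lemma ofReal_mem_fundDomain {n : ℕ} (hn : 2 ≤ n) {lam : ℝ} (hlam : 0 < lam) :
    (lam : ℂ) ∈ fundDomain n := by
  have hn1 : (0 : ℝ) < (n : ℝ) - 1 := by
    have : (2 : ℝ) ≤ n := by exact_mod_cast hn
    linarith
  refine ⟨by exact_mod_cast hlam.ne', ?_⟩
  rw [Complex.arg_ofReal_of_nonneg hlam.le]
  exact ⟨le_rfl, by have := Real.pi_pos; positivity⟩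

lemma critPt_zero_ofReal {n : ℕ} {lam : ℝ} (hlam : 0 < lam) :
    critPt n lam 0 = ((‖critPt n lam 0‖ : ℝ) : ℂ) := by
  have h := critPt_zero_polar n (show (lam : ℂ) ≠ 0 by exact_mod_cast hlam.ne')
  rwa [Complex.arg_ofReal_of_nonneg hlam.le, zero_div, Complex.ofReal_zero, zero_mul,
    Complex.exp_zero, mul_one] at h

lemma sqrtParam_ofReal {n : ℕ} {lam : ℝ} (hlam : 0 < lam) :
    sqrtParam n lam = ((‖critPt n lam 0‖ ^ n : ℝ) : ℂ) := by
  rw [sqrtParam, critPt_zero_ofReal hlam]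
  simp

lemma im_pos_of_mem_openSector {n : ℕ} (hn : 2 ≤ n) {lam : ℝ} (hlam : 0 < lam) {k : ℕ}
    (hk1 : 1 ≤ k) (hkn : k + 1 ≤ n) {z : ℂ} (hz : z ∈ openSector n lam k) : 0 < z.im := by
  have h := im_div_sqrtParam_pos hn (ofReal_mem_fundDomain hn hlam) hk1 hkn hz
  have h0 : 0 < ‖critPt n (lam : ℂ) 0‖ := norm_pos_iff.2 (critPt_ne_zero n
    (by exact_mod_cast hlam.ne') 0)
  rw [sqrtParam_ofReal hlam, Complex.div_ofReal_im] at h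
  rwa [lt_div_iff₀ (by positivity), zero_mul] at h

lemma arg_eq_of_mem_planeSector {n : ℕ} (hn : 2 ≤ n) {lam : ℝ} (hlam : 0 < lam) {k : ℕ}
    {z : ℂ} (hz0 : z ≠ 0) (hkn : k + 1 ≤ n) (hz : z ∈ planeSector n lam k) :
    z.arg = (z / critPt n lam k).arg + k * Real.pi / n := by
  have hl0 : (lam : ℂ) ≠ 0 := by exact_mod_cast hlam.ne'
  have hck := critPt_ne_zero n hl0 k
  have h0 : 0 < ‖critPt n (lam : ℂ) 0‖ := norm_pos_iff.2 (critPt_ne_zero n hl0 0)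
  rw [mem_planeSector_iff_arg hn hl0] at hz
  set ζ := z / critPt n lam k with hζ
  have hζ0 : ζ ≠ 0 := div_ne_zero hz0 hck
  have hzz : z = ((‖critPt n (lam : ℂ) 0‖ * ‖ζ‖ : ℝ) : ℂ) *
      Complex.exp (((ζ.arg + k * Real.pi / n : ℝ) : ℂ) * Complex.I) := by
    have : z = critPt n lam k * ζ := by rw [hζ]; field_simp
    rw [this, critPt_eq, critPt_zero_ofReal hlam]
    conv_lhs => rw [← Complex.norm_mul_exp_arg_mul_I ζ]
    rw [Complex.ofReal_add, add_mul, Complex.exp_add]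
    simp only [Complex.norm_real, norm_norm]
    push_cast
    ring
  have hn0 : (0 : ℝ) < n := by positivity
  have hk : Real.pi / n + k * Real.pi / n ≤ Real.pi := by
    rw [← add_div, div_le_iff₀ hn0]
    have : (k : ℝ) + 1 ≤ n := by exact_mod_cast hkn
    nlinarith [Real.pi_pos]
  have hk0 : 0 ≤ k * Real.pi / n := by have := Real.pi_pos; positivity
  rw [hzz, Complex.arg_real_mul _ (by have := norm_pos_iff.2 hζ0; positivity),
    Complex.arg_exp_mul_I,
    (toIocMod_eq_self _).2 ⟨by linarith [Real.pi_pos], by linarith [Real.pi_pos]⟩]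

lemma im_pos_of_mem_planeSector {n : ℕ} (hn : 2 ≤ n) {lam : ℝ} (hlam : 0 < lam) {k : ℕ}
    (hk1 : 1 ≤ k) (hkn : k + 2 ≤ n) {z : ℂ} (hz0 : z ≠ 0) (hz : z ∈ planeSector n lam k) :
    0 < z.im := by
  have h := arg_eq_of_mem_planeSector hn hlam hz0 (by omega) hz
  rw [mem_planeSector_iff_arg hn (by exact_mod_cast hlam.ne')] at hz
  have hn0 : (0 : ℝ) < n := by positivity
  have hk : 0 < k * Real.pi / n := by
    have := Real.pi_pos
    have : (0 : ℝ) < k := by exact_mod_cast hk1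
    positivity
  have hk' : Real.pi / n + k * Real.pi / n < Real.pi := by
    rw [← add_div, div_lt_iff₀ hn0]
    have : (k : ℝ) + 2 ≤ n := by exact_mod_cast hkn
    nlinarith [Real.pi_pos]
  have h1 : 0 < Real.sin z.arg := Real.sin_pos_of_pos_of_lt_pi (by linarith) (by linarith)
  rw [Complex.sin_arg] at h1
  exact (div_pos_iff_of_pos_right (norm_pos_iff.2 hz0)).1 h1

/-! ### Itineraries up to sign -/

/-- The sequence of absolute indices of sectors met by a cut ray: all indices lie in
`1, …, n - 1` and infinitely many of them differ from `n - 1`. -/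
structure IsAdmissible (n : ℕ) (k : ℕ → ℕ) : Prop where
  one_le : ∀ i, 1 ≤ k i
  succ_le : ∀ i, k i + 1 ≤ n
  frequently : ∀ N, ∃ i, N ≤ i ∧ k i + 2 ≤ n

/-- The shift of a sequence. -/
def shift (k : ℕ → ℕ) : ℕ → ℕ := fun i => k (i + 1)

lemma IsAdmissible.shift {n : ℕ} {k : ℕ → ℕ} (h : IsAdmissible n k) :
    IsAdmissible n (shift k) where
  one_le i := h.one_le (i + 1)
  succ_le i := h.succ_le (i + 1)
  frequently N := by
    obtain ⟨i, hi, hk⟩ := h.frequently (N + 1)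
    refine ⟨i - 1, by omega, ?_⟩
    change k (i - 1 + 1) + 2 ≤ n
    rwa [Nat.sub_add_cancel (by omega)]

lemma tau_spec (n : ℕ) (t : ℝ) : ∃ N : ℤ, tau n t = n * t - N := by
  refine ⟨toIocDiv (zero_lt_one' ℝ) 0 (n * t), ?_⟩
  rw [tau, toIocMod]
  simp

/-- An angle whose orbit visits only the intervals with index `± (n - 1)` is `1 / 2` or `1`. -/
lemma eq_one_or_half_of_extreme {n : ℕ} (hn : 2 ≤ n) {t : ℝ}
    (h : ∀ i : ℕ, ∃ j : ℤ, |j| = (n : ℤ) - 1 ∧ (tau n)^[i] t ∈ angArc n j) :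
    t = 1 ∨ t = 1 / 2 := by
  have hn0 : (0 : ℝ) < n := by positivity
  have hn2 : (2 : ℝ) ≤ n := by exact_mod_cast hn
  -- The defect x is twice the distance from the angle to the right endpoint 1/2 or 1 of its
  -- interval. Below, `tau` multiplies it exactly by n, so it can stay below 1/n forever only if it
  -- is 0.
  have key : ∀ i : ℕ, ∃ (m : ℤ) (x : ℝ), (m = 1 ∨ m = 2) ∧ 0 ≤ x ∧ x < 1 / n ∧
      2 * (tau n)^[i] t = m - x := by
    intro i
    obtain ⟨j, hj, hmem⟩ := h i
    have hjr : |(j : ℝ)| = n - 1 := by exact_mod_cast hj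
    rw [angArc] at hmem
    have e : (((n : ℝ) - 1) / (2 * n)) = 1 / 2 - 1 / n / 2 := by field_simp
    have e2 : (((n : ℝ) - 1 + 1) / (2 * n)) = 1 / 2 := by field_simp; ring
    split_ifs at hmem with hj0
    · rw [abs_of_nonneg (by exact_mod_cast hj0)] at hjr
      rw [hjr, e, e2] at hmem
      refine ⟨1, 1 - 2 * (tau n)^[i] t, Or.inl rfl, ?_, ?_, ?_⟩
      · linarith [hmem.2]
      · linarith [hmem.1]
      · push_cast; ring
    · rw [hjr, e, e2] at hmem
      refine ⟨2, 2 - 2 * (tau n)^[i] t, Or.inr rfl, ?_, ?_, ?_⟩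
      · linarith [hmem.2]
      · linarith [hmem.1]
      · push_cast; ring
  choose m x hm hx0 hx1 hx using key
  have step : ∀ i, x (i + 1) = n * x i := by
    intro i
    obtain ⟨N, hN⟩ := tau_spec n ((tau n)^[i] t)
    have h1 := hx (i + 1)
    rw [Function.iterate_succ', Function.comp, hN] at h1
    have h2 : x (i + 1) - n * x i = ((m (i + 1) - n * m i + 2 * N : ℤ) : ℝ) := by
      push_cast
      linear_combination h1 - (n : ℝ) * hx i
    have h3 : n * x i < 1 := by
      have := hx1 i
      rw [lt_div_iff₀ hn0] at this
      linarith
    have h4 : 0 ≤ n * x i := mul_nonneg hn0.le (hx0 i)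
    have h5 : x (i + 1) < 1 := (hx1 _).trans_le (by rw [div_le_one hn0]; linarith)
    have h6 := hx0 (i + 1)
    -- An integer equal to the difference of two numbers in [0, 1) vanishes.
    have h7 : m (i + 1) - n * m i + 2 * N = 0 := by
      have a : ((m (i + 1) - n * m i + 2 * N : ℤ) : ℝ) < (1 : ℤ) := by
        rw [← h2]; push_cast; linarith
      have b : ((-1 : ℤ) : ℝ) < ((m (i + 1) - n * m i + 2 * N : ℤ) : ℝ) := by
        rw [← h2]; push_cast; linarith
      have a' := Int.cast_lt.1 a
      have b' := Int.cast_lt.1 b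
      omega
    rw [h7] at h2
    push_cast at h2
    linarith
  have hpow : ∀ i, x i = n ^ i * x 0 := by
    intro i
    induction i with
    | zero => simp
    | succ i ih => rw [step, ih, pow_succ]; ring
  have hx00 : x 0 = 0 := by
    by_contra hne
    have hpos : 0 < x 0 := lt_of_le_of_ne (hx0 0) (Ne.symm hne)
    obtain ⟨i, hi⟩ := pow_unbounded_of_one_lt (1 / x 0) (show (1 : ℝ) < n by linarith)
    rw [div_lt_iff₀ hpos, ← hpow] at hi
    have : x i < 1 := (hx1 _).trans_le (by rw [div_le_one hn0]; linarith)
    linarith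
  have h0 := hx 0
  rw [hx00] at h0
  simp only [Function.iterate_zero, id] at h0
  rcases hm 0 with h1 | h1 <;> rw [h1] at h0 <;> push_cast at h0
  · right; linarith
  · left; linarith

lemma isAdmissible_of_isItinerary {n : ℕ} (hn : 2 ≤ n) {t : ℝ} (ht : t ∈ ThetaPer n) {s : ℕ → ℤ}
    (hs : IsItinerary n t s) : IsAdmissible n (fun i => (s i).natAbs) where
  one_le i := by
    have := (hs i).1.1
    rw [Int.abs_eq_natAbs] at this
    omega
  succ_le i := by
    have := (hs i).1.2
    rw [Int.abs_eq_natAbs] at this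
    omega
  frequently N := by
    by_contra hc
    push Not at hc
    obtain ⟨-, h1, h2, p, hp, hper⟩ := ht
    -- The time p * N is a multiple of the period and at least N. If only extreme indices occurred
    -- from time N on, they would therefore occur along the whole orbit of t.
    have hper' : (tau n)^[p * N] t = t := (hper.mul_const N).eq
    refine (eq_one_or_half_of_extreme hn (t := t) fun i => ⟨s (i + p * N), ?_, ?_⟩).elim h1 h2
    · have a := hc (i + p * N) (by nlinarith)
      have b := (hs (i + p * N)).1.2
      rw [Int.abs_eq_natAbs] at b ⊢
      omega
    · have := (hs (i + p * N)).2
      rwa [Function.iterate_add_apply, hper'] at this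

/-! ### Full rays and half rays -/

/-- The union of two opposite closed sectors. -/
def doubleSector (n : ℕ) (μ : ℂ) (k : ℕ) : Set (OnePoint ℂ) :=
  insert OnePoint.infty ((fun z : ℂ => (z : OnePoint ℂ)) ''
    {z | z ∈ planeSector n μ k ∨ -z ∈ planeSector n μ k})

lemma sector_union_sector_neg {n : ℕ} {μ : ℂ} {j : ℤ} (hj : j ≠ 0) :
    sector n μ j ∪ sector n μ (-j) = doubleSector n μ j.natAbs := by
  rw [sector, sector, doubleSector, Int.natAbs_neg]
  ext x
  rcases lt_or_gt_of_ne hj with h | h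
  · rw [if_neg (by omega), if_pos (by omega)]
    simp only [Set.mem_union, Set.mem_insert_iff, Set.mem_image, Set.mem_ofPred_eq]
    constructor
    · rintro ((h | ⟨z, hz, rfl⟩) | (h | ⟨z, hz, rfl⟩))
      exacts [Or.inl h, Or.inr ⟨z, Or.inr hz, rfl⟩, Or.inl h, Or.inr ⟨z, Or.inl hz, rfl⟩]
    · rintro (h | ⟨z, hz | hz, rfl⟩)
      exacts [Or.inl (Or.inl h), Or.inr (Or.inr ⟨z, hz, rfl⟩), Or.inl (Or.inr ⟨z, hz, rfl⟩)]
  · rw [if_pos (by omega), if_neg (by omega)]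
    simp only [Set.mem_union, Set.mem_insert_iff, Set.mem_image, Set.mem_ofPred_eq]
    constructor
    · rintro ((h | ⟨z, hz, rfl⟩) | (h | ⟨z, hz, rfl⟩))
      exacts [Or.inl h, Or.inr ⟨z, Or.inl hz, rfl⟩, Or.inl h, Or.inr ⟨z, Or.inr hz, rfl⟩]
    · rintro (h | ⟨z, hz | hz, rfl⟩)
      exacts [Or.inl (Or.inl h), Or.inl (Or.inr ⟨z, hz, rfl⟩), Or.inr (Or.inr ⟨z, hz, rfl⟩)]

lemma coe_mem_doubleSector {n : ℕ} {μ : ℂ} {k : ℕ} {z : ℂ} :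
    (z : OnePoint ℂ) ∈ doubleSector n μ k ↔ z ∈ planeSector n μ k ∨ -z ∈ planeSector n μ k := by
  simp only [doubleSector, Set.mem_insert_iff, Set.mem_image, Set.mem_ofPred_eq,
    OnePoint.coe_ne_infty, false_or, OnePoint.coe_eq_coe]
  exact ⟨fun ⟨w, hw, h⟩ => h ▸ hw, fun h => ⟨z, h, rfl⟩⟩

lemma infty_mem_doubleSector (n : ℕ) (μ : ℂ) (k : ℕ) :
    OnePoint.infty ∈ doubleSector n μ k := Set.mem_insert _ _

/-- The points whose orbit follows a sequence of double sectors. -/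
def fullRay (n : ℕ) (μ : ℂ) (k : ℕ → ℕ) : Set (OnePoint ℂ) :=
  {x | ∀ i, (mcMap n μ)^[i] x ∈ doubleSector n μ (k i)}

lemma sectorCutRay_eq_fullRay {n : ℕ} {μ : ℂ} {s : ℕ → ℤ} (hs : ∀ i, s i ≠ 0) :
    sectorCutRay n μ s = fullRay n μ (fun i => (s i).natAbs) := by
  ext x
  simp only [sectorCutRay, fullRay, Set.mem_iInter, Set.mem_preimage, Set.mem_ofPred_eq,
    sector_union_sector_neg (hs _)]

lemma mem_fullRay_iff {n : ℕ} {μ : ℂ} {k : ℕ → ℕ} {x : OnePoint ℂ} :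
    x ∈ fullRay n μ k ↔ x ∈ doubleSector n μ (k 0) ∧ mcMap n μ x ∈ fullRay n μ (shift k) := by
  constructor
  · intro h
    exact ⟨h 0, fun i => h (i + 1)⟩
  · rintro ⟨h0, h1⟩ (_ | i)
    exacts [h0, h1 i]

lemma infty_mem_fullRay (n : ℕ) (μ : ℂ) (k : ℕ → ℕ) : OnePoint.infty ∈ fullRay n μ k := fun i => by
  rw [mcMap_iterate_infty]
  exact infty_mem_doubleSector n μ _

lemma zero_mem_fullRay (n : ℕ) (μ : ℂ) (k : ℕ → ℕ) : ((0 : ℂ) : OnePoint ℂ) ∈ fullRay n μ k := by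
  rw [mem_fullRay_iff, mcMap_zero]
  exact ⟨coe_mem_doubleSector.2 (Or.inl (planeSector_zero_mem n μ _)), infty_mem_fullRay n μ _⟩

lemma planeMap_neg (n : ℕ) (μ z : ℂ) : planeMap n μ (-z) = (-1) ^ n * planeMap n μ z := by
  rcases neg_one_pow_eq_or ℂ n with h | h <;> simp only [planeMap, neg_pow z n, h]
  · simp
  · rw [neg_one_mul, div_neg]; ring

/-- The orbits of z and -z agree up to sign, and double sectors are symmetric. If n is even the
images coincide; if n is odd the induction continues with the negated image. -/
lemma neg_mem_fullRay {n : ℕ} {μ : ℂ} {k : ℕ → ℕ} {z : ℂ} (hz : (z : OnePoint ℂ) ∈ fullRay n μ k) :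
    ((-z : ℂ) : OnePoint ℂ) ∈ fullRay n μ k := by
  intro i
  induction i generalizing k z with
  | zero =>
    have := hz 0
    simp only [Function.iterate_zero, id, coe_mem_doubleSector, neg_neg] at this ⊢
    exact this.symm
  | succ i ih =>
    rw [Function.iterate_succ, Function.comp]
    change _ ∈ doubleSector n μ (shift k i)
    have h1 := (mem_fullRay_iff.1 hz).2
    by_cases h0 : z = 0
    · rw [h0, neg_zero, mcMap_zero]
      exact infty_mem_fullRay n μ _ i
    · rw [mcMap_coe (neg_ne_zero.2 h0), planeMap_neg]
      rw [mcMap_coe h0] at h1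
      rcases neg_one_pow_eq_or ℂ n with h | h <;> rw [h]
      · rw [one_mul]; exact h1 i
      · rw [neg_one_mul]; exact ih h1

/-- The nonzero finite points of a full ray that lie in the sector with index `k 0`. -/
def halfRay (n : ℕ) (μ : ℂ) (k : ℕ → ℕ) : Set ℂ :=
  {z | z ≠ 0 ∧ z ∈ planeSector n μ (k 0) ∧ (z : OnePoint ℂ) ∈ fullRay n μ k}

lemma coe_mem_fullRay_iff {n : ℕ} {μ : ℂ} {k : ℕ → ℕ} {z : ℂ} :
    (z : OnePoint ℂ) ∈ fullRay n μ k ↔ z ∈ halfRay n μ k ∨ z = 0 ∨ -z ∈ halfRay n μ k := by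
  constructor
  · intro h
    by_cases h0 : z = 0
    · exact Or.inr (Or.inl h0)
    · rcases coe_mem_doubleSector.1 (h 0) with h1 | h1
      · exact Or.inl ⟨h0, h1, h⟩
      · exact Or.inr (Or.inr ⟨neg_ne_zero.2 h0, h1, neg_mem_fullRay h⟩)
  · rintro (h | rfl | h)
    · exact h.2.2
    · exact zero_mem_fullRay n μ k
    · have := neg_mem_fullRay h.2.2
      rwa [neg_neg] at this

/-- This recursion drives the later inductions. The middle case is the one in which the next
iterates are 0 and then ∞, where they impose no condition. -/
lemma mem_halfRay_iff {n : ℕ} {μ : ℂ} {k : ℕ → ℕ} {z : ℂ} :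
    z ∈ halfRay n μ k ↔ z ≠ 0 ∧ z ∈ planeSector n μ (k 0) ∧
      (planeMap n μ z ∈ halfRay n μ (shift k) ∨ planeMap n μ z = 0 ∨
        -planeMap n μ z ∈ halfRay n μ (shift k)) := by
  constructor
  · rintro ⟨h0, h1, h2⟩
    refine ⟨h0, h1, ?_⟩
    have := (mem_fullRay_iff.1 h2).2
    rwa [mcMap_coe h0, coe_mem_fullRay_iff] at this
  · rintro ⟨h0, h1, h2⟩
    refine ⟨h0, h1, mem_fullRay_iff.2 ⟨coe_mem_doubleSector.2 (Or.inl h1), ?_⟩⟩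
    rwa [mcMap_coe h0, coe_mem_fullRay_iff]

/-! ### Real parameters: the real axis is avoided -/

/-- For positive λ and real x the summands x ^ n and λ / x ^ n have the same sign and cannot cancel.
-/
lemma planeMap_ofReal_ne_zero {n : ℕ} {lam : ℝ} (hlam : 0 < lam) {x : ℝ} (hx : x ≠ 0) :
    ∃ y : ℝ, y ≠ 0 ∧ planeMap n lam x = y := by
  refine ⟨x ^ n + lam / x ^ n, ?_, by simp [planeMap]⟩
  have h1 : x ^ n ≠ 0 := pow_ne_zero _ hx
  intro h
  have h2 : x ^ n * x ^ n + lam = 0 := by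
    field_simp at h
    linarith
  nlinarith [mul_self_nonneg (x ^ n)]

/-- The orbit of a nonzero real stays real and nonzero, whereas at a time with index at most n-2 the
double sector meets the real axis only at 0 and ∞. -/
lemma ofReal_notMem_fullRay {n : ℕ} (hn : 2 ≤ n) {lam : ℝ} (hlam : 0 < lam) {k : ℕ → ℕ}
    (hk : IsAdmissible n k) {x : ℝ} (hx : x ≠ 0) :
    ((x : ℂ) : OnePoint ℂ) ∉ fullRay n lam k := by
  intro h
  have key : ∀ i, ∃ y : ℝ, y ≠ 0 ∧ (mcMap n lam)^[i] ((x : ℂ) : OnePoint ℂ) = ((y : ℂ) : OnePoint ℂ) := by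
    intro i
    induction i with
    | zero => exact ⟨x, hx, rfl⟩
    | succ i ih =>
      obtain ⟨y, hy, hxy⟩ := ih
      obtain ⟨w, hw, hyw⟩ := planeMap_ofReal_ne_zero (n := n) hlam hy
      refine ⟨w, hw, ?_⟩
      rw [Function.iterate_succ', Function.comp, hxy, mcMap_coe (by exact_mod_cast hy), hyw]
  obtain ⟨i, -, hi⟩ := hk.frequently 0
  obtain ⟨y, hy, hxy⟩ := key i
  have hy' : (y : ℂ) ≠ 0 := by exact_mod_cast hy
  have h1 := h i
  rw [hxy, coe_mem_doubleSector] at h1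
  rcases h1 with h1 | h1
  · have := im_pos_of_mem_planeSector hn hlam (hk.one_le i) hi hy' h1
    simp at this
  · have := im_pos_of_mem_planeSector hn hlam (hk.one_le i) hi (neg_ne_zero.2 hy') h1
    simp at this

lemma iterate_mem_fullRay {n : ℕ} {μ : ℂ} {k : ℕ → ℕ} {x : OnePoint ℂ} (hx : x ∈ fullRay n μ k)
    (i : ℕ) : (mcMap n μ)^[i] x ∈ fullRay n μ (shift^[i] k) := by
  induction i with
  | zero => exact hx
  | succ i ih =>
    rw [Function.iterate_succ', Function.comp, Function.iterate_succ', Function.comp]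
    exact (mem_fullRay_iff.1 ih).2

lemma IsAdmissible.iterate_shift {n : ℕ} {k : ℕ → ℕ} (h : IsAdmissible n k) (i : ℕ) :
    IsAdmissible n (McMullen.shift^[i] k) := by
  induction i with
  | zero => exact h
  | succ i ih => rw [Function.iterate_succ', Function.comp]; exact ih.shift

lemma modifiedCutRay_eq_fullRay {n : ℕ} (hn : 2 ≤ n) {lam : ℝ} (hlam : 0 < lam) {s : ℕ → ℤ}
    (hs : ∀ i, s i ≠ 0) (hk : IsAdmissible n (fun i => (s i).natAbs)) :
    modifiedCutRay n lam s = fullRay n lam (fun i => (s i).natAbs) := by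
  ext x
  simp only [modifiedCutRay, Set.mem_iInter, Set.mem_preimage, sector_union_sector_neg (hs _)]
  constructor
  · intro h i
    exact (h i).1
  · intro h i
    refine ⟨h i, ?_⟩
    rintro ⟨y, hy, hxy⟩
    have := iterate_mem_fullRay h i
    rw [← hxy] at this
    exact ofReal_notMem_fullRay hn hlam (hk.iterate_shift i) hy this

/-- A parameter of the fundamental domain outside its open version is positive, so both cases of the
definition yield the same kind of set and convergence can be treated uniformly. -/
lemma cutRay_eq_fullRay {n : ℕ} (hn : 2 ≤ n) {μ : ℂ} (hμ : μ ∈ fundDomain n) {s : ℕ → ℤ}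
    (hs : ∀ i, s i ≠ 0) (hk : IsAdmissible n (fun i => (s i).natAbs)) :
    cutRay n μ s = fullRay n μ (fun i => (s i).natAbs) := by
  rw [cutRay]
  split_ifs with h
  · exact sectorCutRay_eq_fullRay hs
  · have harg : μ.arg = 0 := by
      by_contra hne
      exact h ⟨hμ.1, lt_of_le_of_ne hμ.2.1 (Ne.symm hne), hμ.2.2⟩
    have hμr : μ = ((‖μ‖ : ℝ) : ℂ) := by
      conv_lhs => rw [← Complex.norm_mul_exp_arg_mul_I μ, harg]
      simp
    rw [hμr]
    exact modifiedCutRay_eq_fullRay hn (norm_pos_iff.2 hμ.1) hs hk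

/-- On the two boundary rays of a sector the n-th power of z / c_k is real, so the image is a
nonzero real, and such points are excluded from every full ray with admissible index sequence. -/
lemma halfRay_subset_openSector {n : ℕ} (hn : 2 ≤ n) {lam : ℝ} (hlam : 0 < lam) {k : ℕ → ℕ}
    (hk : IsAdmissible n k) : halfRay n lam k ⊆ openSector n lam (k 0) := by
  intro z hz
  have hl0 : (lam : ℂ) ≠ 0 := by exact_mod_cast hlam.ne'
  obtain ⟨h0, h1, h2⟩ := hz
  have hck := critPt_ne_zero n hl0 (k 0)
  have hn0 : (n : ℝ) ≠ 0 := by positivity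
  have h3 := (mem_fullRay_iff.1 h2).2
  rw [mcMap_coe h0] at h3
  rw [mem_planeSector_iff_arg hn hl0] at h1
  set ζ := z / critPt n lam (k 0) with hζ
  have hζ0 : ζ ≠ 0 := div_ne_zero h0 hck
  -- on the boundary rays the `n`-th power is real
  have key : ∀ x : ℝ, x ≠ 0 → ζ ^ n ≠ x := by
    intro x hx hzx
    have hz' : z = critPt n lam (k 0) * ζ := by rw [hζ]; field_simp
    have hval : planeMap n lam z =
        (((-1) ^ k 0 * ‖critPt n (lam : ℂ) 0‖ ^ n * (x + x⁻¹) : ℝ) : ℂ) := by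
      rw [hz', planeMap_mul_critPt (by omega) hl0 _ hζ0, hzx, sqrtParam_ofReal hlam]
      push_cast
      ring
    rw [hval] at h3
    refine ofReal_notMem_fullRay hn hlam hk.shift ?_ h3
    have hp : ‖critPt n (lam : ℂ) 0‖ ≠ 0 := norm_ne_zero_iff.2 (critPt_ne_zero n hl0 0)
    refine mul_ne_zero (mul_ne_zero (pow_ne_zero _ (by simp)) (pow_ne_zero _ hp)) ?_
    intro h
    have : x * x + 1 = 0 := by field_simp at h; nlinarith
    nlinarith [mul_self_nonneg x]
  have hpolar : ζ ^ n = ((‖ζ‖ ^ n : ℝ) : ℂ) * Complex.exp (((n * ζ.arg : ℝ) : ℂ) * Complex.I) := by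
    conv_lhs => rw [← Complex.norm_mul_exp_arg_mul_I ζ]
    rw [mul_pow, ← Complex.exp_nat_mul]
    push_cast
    rw [mul_assoc (n : ℂ)]
  have hpz : ‖ζ‖ ^ n ≠ 0 := pow_ne_zero _ (norm_ne_zero_iff.2 hζ0)
  refine ⟨lt_of_le_of_ne h1.1 fun h => ?_, lt_of_le_of_ne h1.2 fun h => ?_⟩
  · refine key (‖ζ‖ ^ n) hpz ?_
    rw [hpolar, ← h]
    simp
  · refine key (-‖ζ‖ ^ n) (neg_ne_zero.2 hpz) ?_
    rw [hpolar, h, mul_div_cancel₀ _ hn0, Complex.exp_pi_mul_I]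
    push_cast
    ring

/-! ### Inverse branches -/

/-- The inverse of `w ↦ w + w⁻¹` with values in the upper half plane. -/
def joukInv (v : ℂ) : ℂ := v / 2 + Complex.I * (1 - v ^ 2 / 4) ^ ((1 / 2 : ℝ) : ℂ)

/-- The value 1 - v²/4 meets the closed negative axis only for real v with |v| ≥ 2, that is, on the
two cuts ending at the critical values ±2 of w + 1/w. -/
lemma one_sub_sq_mem_slitPlane {v : ℂ} (hv : v = 0 ∨ v.im ≠ 0) :
    1 - v ^ 2 / 4 ∈ Complex.slitPlane := by
  rcases hv with rfl | hv
  · simp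
  · rw [Complex.mem_slitPlane_iff]
    by_contra hc
    push Not at hc
    obtain ⟨h1, h2⟩ := hc
    have e : (1 - v ^ 2 / 4).re = 1 - (v.re ^ 2 - v.im ^ 2) / 4 := by
      simp [sq, Complex.mul_re]
    have e2 : (1 - v ^ 2 / 4).im = - (v.re * v.im) / 2 := by
      simp [sq, Complex.mul_im]; ring
    rw [e] at h1
    rw [e2] at h2
    have h3 : v.re = 0 := by
      have : v.re * v.im = 0 := by linarith
      exact (mul_eq_zero.1 this).resolve_right hv
    rw [h3] at h1
    nlinarith [sq_nonneg v.im]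

/-- The roots of w + 1/w = v are v/2 ± i s with s the principal square root of 1 - v²/4. Their
product is 1, and Re s > 0 selects the root in the upper half plane, since the imaginary part of w -
1/w is a positive multiple of that of w. -/
lemma joukInv_spec {v : ℂ} (hv : v = 0 ∨ v.im ≠ 0) :
    joukInv v ≠ 0 ∧ joukInv v + (joukInv v)⁻¹ = v ∧ 0 < (joukInv v).im := by
  have hs := one_sub_sq_mem_slitPlane hv
  set x := 1 - v ^ 2 / 4 with hx
  set s := x ^ ((1 / 2 : ℝ) : ℂ) with hsdef
  have hs2 : s ^ 2 = x := by
    rw [hsdef, ← Complex.cpow_nat_mul]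
    push_cast
    norm_num
  have hre : 0 < s.re := by
    rw [hsdef, Complex.cpow_ofReal_re]
    have h1 := Complex.neg_pi_lt_arg x
    have h2 := Complex.arg_le_pi x
    have h3 : x.arg ≠ Real.pi := (Complex.mem_slitPlane_iff_arg.1 hs).1
    have h4 : x.arg < Real.pi := lt_of_le_of_ne h2 h3
    have h5 : 0 < ‖x‖ := norm_pos_iff.2 (Complex.slitPlane_ne_zero hs)
    exact mul_pos (Real.rpow_pos_of_pos h5 _)
      (Real.cos_pos_of_mem_Ioo ⟨by linarith, by linarith⟩)
  have hw : joukInv v = v / 2 + Complex.I * s := rfl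
  have hmul : joukInv v * (v / 2 - Complex.I * s) = 1 := by
    rw [hw]
    linear_combination hs2 + hx - s ^ 2 * Complex.I_sq
  have h0 : joukInv v ≠ 0 := left_ne_zero_of_mul_eq_one hmul
  have hinv : (joukInv v)⁻¹ = v / 2 - Complex.I * s := inv_eq_of_mul_eq_one_right hmul
  refine ⟨h0, by rw [hinv, hw]; ring, ?_⟩
  have h1 : (joukInv v - (joukInv v)⁻¹).im = 2 * s.re := by
    rw [hinv, hw]
    simp
    ring
  rw [Complex.sub_im, Complex.inv_im] at h1
  have h2 : 0 < Complex.normSq (joukInv v) := Complex.normSq_pos.2 h0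
  have h3 : (joukInv v).im * (1 + 1 / Complex.normSq (joukInv v)) = 2 * s.re := by
    rw [← h1]; ring
  by_contra hc
  push Not at hc
  have h4 : 0 < 1 + 1 / Complex.normSq (joukInv v) := by positivity
  nlinarith

lemma continuousAt_joukInv {v : ℂ} (hv : v = 0 ∨ v.im ≠ 0) : ContinuousAt joukInv v := by
  have hs := one_sub_sq_mem_slitPlane hv
  refine ContinuousAt.add (by fun_prop) (ContinuousAt.mul continuousAt_const ?_)
  exact ContinuousAt.comp (f := fun v : ℂ => 1 - v ^ 2 / 4) (continuousAt_cpow_const hs)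
    (by fun_prop)

/-- The fibre of w + 1/w consists of w and 1/w, and inversion exchanges the half planes. -/
lemma add_inv_injOn_upper {w w' : ℂ} (hw : 0 < w.im) (hw' : 0 < w'.im)
    (h : w + w⁻¹ = w' + w'⁻¹) : w = w' := by
  have h0 : w ≠ 0 := by rintro rfl; simp at hw
  have h0' : w' ≠ 0 := by rintro rfl; simp at hw'
  have h1 : (w - w') * (w * w' - 1) = 0 := by
    field_simp at h
    linear_combination h
  rcases mul_eq_zero.1 h1 with h2 | h2
  · exact sub_eq_zero.1 h2
  · exfalso
    have h3 : w' = w⁻¹ := eq_inv_of_mul_eq_one_right (sub_eq_zero.1 h2)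
    rw [h3, Complex.inv_im] at hw'
    have := div_neg_of_neg_of_pos (neg_neg_of_pos hw) (Complex.normSq_pos.2 h0)
    linarith

lemma pow_polar (ζ : ℂ) (n : ℕ) :
    ζ ^ n = ((‖ζ‖ ^ n : ℝ) : ℂ) * Complex.exp (((n * ζ.arg : ℝ) : ℂ) * Complex.I) := by
  conv_lhs => rw [← Complex.norm_mul_exp_arg_mul_I ζ]
  rw [mul_pow, ← Complex.exp_nat_mul]
  push_cast
  rw [mul_assoc (n : ℂ)]

lemma im_pow_pos {n : ℕ} (hn : 1 ≤ n) {ζ : ℂ} (h0 : 0 < ζ.arg) (h1 : ζ.arg < Real.pi / n) :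
    0 < (ζ ^ n).im := by
  have hζ : ζ ≠ 0 := by rintro rfl; simp at h0
  have hn0 : (0 : ℝ) < n := by exact_mod_cast hn
  rw [pow_polar, Complex.im_ofReal_mul, Complex.exp_ofReal_mul_I_im]
  rw [lt_div_iff₀ hn0] at h1
  exact mul_pos (pow_pos (norm_pos_iff.2 hζ) _)
    (Real.sin_pos_of_pos_of_lt_pi (by positivity) (by linarith))

lemma im_pow_div_critPt_pos {n : ℕ} (hn : 1 ≤ n) {μ : ℂ} {k : ℕ} {z : ℂ}
    (hz : z ∈ openSector n μ k) : 0 < ((z / critPt n μ k) ^ n).im :=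
  im_pow_pos hn hz.1 hz.2

lemma planeMap_eq_of_ne_zero {n : ℕ} (hn : 1 ≤ n) {μ : ℂ} (hμ : μ ≠ 0) (k : ℕ) {z : ℂ}
    (hz : z ≠ 0) :
    planeMap n μ z = (-1) ^ k * sqrtParam n μ *
      ((z / critPt n μ k) ^ n + ((z / critPt n μ k) ^ n)⁻¹) := by
  have hck := critPt_ne_zero n hμ k
  rw [← planeMap_mul_critPt hn hμ k (div_ne_zero hz hck), mul_div_cancel₀ _ hck]

lemma planeMap_injOn_openSector {n : ℕ} (hn : 1 ≤ n) {μ : ℂ} (hμ : μ ≠ 0) (k : ℕ) :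
    Set.InjOn (planeMap n μ) (openSector n μ k) := by
  intro z hz z' hz' h
  have hck := critPt_ne_zero n hμ k
  rw [planeMap_eq_of_ne_zero hn hμ k (ne_zero_of_mem_openSector hz),
    planeMap_eq_of_ne_zero hn hμ k (ne_zero_of_mem_openSector hz')] at h
  have h1 := mul_left_cancel₀ (mul_ne_zero (pow_ne_zero _ (by simp)) (sqrtParam_ne_zero n hμ)) h
  have h2 := add_inv_injOn_upper (im_pow_div_critPt_pos hn hz) (im_pow_div_critPt_pos hn hz') h1
  have h3 : ∀ z ∈ openSector n μ k,
      ((z / critPt n μ k) ^ n) ^ ((n : ℂ)⁻¹) = z / critPt n μ k := fun z hz =>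
    Complex.pow_cpow_nat_inv (by omega) (by
      have h1 := hz.1
      have : 0 < Real.pi / n := h1.trans hz.2
      linarith) hz.2.le
  have h4 := h3 z hz
  rw [h2, h3 z' hz'] at h4
  exact ((div_left_inj' hck).1 h4).symm

/-- The inverse branch of the McMullen map with values in the sector of index `k`. -/
def branch (n : ℕ) (μ : ℂ) (k : ℕ) (z : ℂ) : ℂ :=
  critPt n μ k * joukInv ((-1) ^ k * (z / sqrtParam n μ)) ^ ((n : ℂ)⁻¹)

lemma neg_one_pow_mul_im {k : ℕ} {v : ℂ} (hv : v = 0 ∨ v.im ≠ 0) :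
    (-1) ^ k * v = 0 ∨ ((-1) ^ k * v).im ≠ 0 := by
  rcases neg_one_pow_eq_or ℂ k with h | h <;> rw [h] <;> simpa using hv

lemma arg_cpow_nat_inv {n : ℕ} (hn : 1 ≤ n) {w : ℂ} (hw : w ≠ 0) :
    (w ^ ((n : ℂ)⁻¹)).arg = w.arg / n := by
  have hn1 : (1 : ℝ) ≤ n := by exact_mod_cast hn
  have e : ((n : ℂ)⁻¹) = (((n : ℝ)⁻¹ : ℝ) : ℂ) := by push_cast; rfl
  rw [e, Complex.cpow_ofReal]
  have h1 := Complex.neg_pi_lt_arg w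
  have h2 := Complex.arg_le_pi w
  have h3 : w.arg * (n : ℝ)⁻¹ ∈ Set.Ioc (-Real.pi) Real.pi := by
    rw [← div_eq_mul_inv]
    constructor
    · rw [lt_div_iff₀ (by linarith)]
      nlinarith [Real.pi_pos]
    · rw [div_le_iff₀ (by linarith)]
      nlinarith [Real.pi_pos]
  have := Complex.arg_mul_cos_add_sin_mul_I
    (Real.rpow_pos_of_pos (norm_pos_iff.2 hw) ((n : ℝ)⁻¹)) h3
  rw [← Complex.ofReal_cos, ← Complex.ofReal_sin] at this
  rw [this, div_eq_mul_inv]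

lemma branch_spec {n : ℕ} (hn : 1 ≤ n) {μ : ℂ} (hμ : μ ≠ 0) (k : ℕ) {z : ℂ}
    (hz : z / sqrtParam n μ = 0 ∨ (z / sqrtParam n μ).im ≠ 0) :
    branch n μ k z ∈ openSector n μ k ∧ planeMap n μ (branch n μ k z) = z := by
  have hck := critPt_ne_zero n hμ k
  have hd := sqrtParam_ne_zero n hμ
  have hn0 : (0 : ℝ) < n := by exact_mod_cast hn
  obtain ⟨h0, h1, h2⟩ := joukInv_spec (neg_one_pow_mul_im (k := k) hz)
  set w := joukInv ((-1) ^ k * (z / sqrtParam n μ)) with hw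
  have hb : branch n μ k z = critPt n μ k * w ^ ((n : ℂ)⁻¹) := rfl
  have hr0 : w ^ ((n : ℂ)⁻¹) ≠ 0 := by simp [Complex.cpow_eq_zero_iff, h0]
  constructor
  · rw [openSector, Set.mem_ofPred_eq, hb, mul_div_cancel_left₀ _ hck, arg_cpow_nat_inv hn h0]
    have ha : 0 < w.arg := by
      refine lt_of_le_of_ne (Complex.arg_nonneg_iff.2 h2.le) fun h => ?_
      exact h2.ne' (Complex.arg_eq_zero_iff.1 h.symm).2
    have ha' : w.arg < Real.pi := by
      refine lt_of_le_of_ne (Complex.arg_le_pi w) fun h => ?_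
      exact h2.ne' (Complex.arg_eq_pi_iff.1 h).2
    exact ⟨by positivity, (div_lt_div_iff_of_pos_right hn0).2 ha'⟩
  · rw [hb, planeMap_mul_critPt hn hμ k hr0, Complex.cpow_nat_inv_pow _ (by omega), h1]
    have : ((-1 : ℂ) ^ k) * (-1) ^ k = 1 := by rw [← mul_pow]; simp
    field_simp
    linear_combination z * this

lemma continuousAt_branch {n : ℕ} {μ : ℂ} (k : ℕ) {z : ℂ}
    (hz : z / sqrtParam n μ = 0 ∨ (z / sqrtParam n μ).im ≠ 0) :
    ContinuousAt (branch n μ k) z := by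
  have hv := neg_one_pow_mul_im (k := k) hz
  obtain ⟨h0, h1, h2⟩ := joukInv_spec hv
  refine ContinuousAt.mul continuousAt_const ?_
  have h3 : ContinuousAt (fun z => joukInv ((-1) ^ k * (z / sqrtParam n μ))) z :=
    ContinuousAt.comp (f := fun z => (-1) ^ k * (z / sqrtParam n μ)) (continuousAt_joukInv hv)
      (by fun_prop)
  exact ContinuousAt.comp (g := fun w : ℂ => w ^ ((n : ℂ)⁻¹))
    (f := fun z => joukInv ((-1) ^ k * (z / sqrtParam n μ)))
    (continuousAt_cpow_const (Complex.mem_slitPlane_iff.2 (Or.inr h2.ne'))) h3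

lemma branch_planeMap {n : ℕ} (hn : 1 ≤ n) {μ : ℂ} (hμ : μ ≠ 0) {k : ℕ} {z : ℂ}
    (hz : z ∈ openSector n μ k)
    (h : planeMap n μ z / sqrtParam n μ = 0 ∨ (planeMap n μ z / sqrtParam n μ).im ≠ 0) :
    branch n μ k (planeMap n μ z) = z :=
  planeMap_injOn_openSector hn hμ k (branch_spec hn hμ k h).1 hz (branch_spec hn hμ k h).2

/-- The involution of a sector that changes the sign of the map. -/
lemma involution_spec {n : ℕ} (hn : 2 ≤ n) {μ : ℂ} (hμ : μ ≠ 0) {k : ℕ} {z : ℂ}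
    (hz : z ∈ openSector n μ k) :
    critPt n μ k * critPt n μ (k + 1) / z ∈ openSector n μ k ∧
      planeMap n μ (critPt n μ k * critPt n μ (k + 1) / z) = -planeMap n μ z := by
  have hz0 := ne_zero_of_mem_openSector hz
  have hck := critPt_ne_zero n hμ k
  have hck' := critPt_ne_zero n hμ (k + 1)
  have hn0 : (n : ℝ) ≠ 0 := by positivity
  have hζ0 : z / critPt n μ k ≠ 0 := div_ne_zero hz0 hck
  have e : critPt n μ k * critPt n μ (k + 1) / z / critPt n μ k =
      Complex.exp (((Real.pi / n : ℝ) : ℂ) * Complex.I) / (z / critPt n μ k) := by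
    rw [critPt_succ]
    field_simp
  constructor
  · rw [openSector, Set.mem_ofPred_eq, e]
    have h1 := hz.1
    have h2 := hz.2
    set ζ := z / critPt n μ k
    have : Complex.exp (((Real.pi / n : ℝ) : ℂ) * Complex.I) / ζ =
        ((‖ζ‖⁻¹ : ℝ) : ℂ) * Complex.exp (((Real.pi / n - ζ.arg : ℝ) : ℂ) * Complex.I) := by
      conv_lhs => rw [← Complex.norm_mul_exp_arg_mul_I ζ]
      rw [Complex.ofReal_sub, sub_mul, Complex.exp_sub]
      push_cast
      field_simp
    have hpi := pi_div_lt_pi hn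
    rw [this, Complex.arg_real_mul _ (inv_pos.2 (norm_pos_iff.2 hζ0)), Complex.arg_exp_mul_I,
      (toIocMod_eq_self _).2 ⟨by linarith [Real.pi_pos], by linarith [Real.pi_pos]⟩]
    constructor <;> linarith
  · rw [planeMap_eq_of_ne_zero (by omega) hμ k (div_ne_zero (mul_ne_zero hck hck') hz0), e,
      planeMap_eq_of_ne_zero (by omega) hμ k hz0, div_pow, ← Complex.exp_nat_mul]
    have : (n : ℂ) * (((Real.pi / n : ℝ) : ℂ) * Complex.I) = Real.pi * Complex.I := by
      have : (n : ℂ) ≠ 0 := by exact_mod_cast hn0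
      push_cast
      field_simp
    rw [this, Complex.exp_pi_mul_I, inv_div, div_neg, div_one, neg_div, one_div]
    ring

/-! ### Connected approximations -/

/-- The points of the open sector of index `k 0` whose orbit, as long as it stays finite and
nonzero, follows `m` further open sectors up to sign. -/
def approx (n : ℕ) (μ : ℂ) : ℕ → (ℕ → ℕ) → Set ℂ
  | 0, k => openSector n μ (k 0)
  | m + 1, k => {z | z ∈ openSector n μ (k 0) ∧ (planeMap n μ z ∈ approx n μ m (shift k) ∨
      planeMap n μ z = 0 ∨ -planeMap n μ z ∈ approx n μ m (shift k))}

lemma approx_subset_openSector {n : ℕ} {μ : ℂ} {m : ℕ} {k : ℕ → ℕ} :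
    approx n μ m k ⊆ openSector n μ (k 0) := by
  cases m with
  | zero => exact subset_rfl
  | succ m => exact fun z hz => hz.1

lemma approx_succ_subset {n : ℕ} {μ : ℂ} (m : ℕ) (k : ℕ → ℕ) :
    approx n μ (m + 1) k ⊆ approx n μ m k := by
  induction m generalizing k with
  | zero => exact fun z hz => hz.1
  | succ m ih =>
    rintro z ⟨h0, h1⟩
    exact ⟨h0, h1.imp (fun h => ih _ h) (Or.imp_right fun h => ih _ h)⟩

lemma isPreconnected_openSector {n : ℕ} (hn : 2 ≤ n) {μ : ℂ} (hμ : μ ≠ 0) (k : ℕ) :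
    IsPreconnected (openSector n μ k) := by
  have hck := critPt_ne_zero n hμ k
  have : openSector n μ k = (fun p : ℝ × ℝ =>
      critPt n μ k * ((p.1 : ℂ) * Complex.exp ((p.2 : ℂ) * Complex.I))) ''
      (Set.Ioi 0 ×ˢ Set.Ioo 0 (Real.pi / n)) := by
    ext z
    constructor
    · intro hz
      refine ⟨(‖z / critPt n μ k‖, (z / critPt n μ k).arg),
        ⟨norm_pos_iff.2 (div_ne_zero (ne_zero_of_mem_openSector hz) hck), hz⟩, ?_⟩
      simp only
      rw [Complex.norm_mul_exp_arg_mul_I, mul_div_cancel₀ _ hck]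
    · rintro ⟨⟨r, φ⟩, ⟨hr, hφ⟩, rfl⟩
      have hpi := pi_div_lt_pi hn
      simp only [Set.mem_Ioi, Set.mem_Ioo] at hr hφ
      rw [openSector, Set.mem_ofPred_eq, mul_div_cancel_left₀ _ hck, Complex.arg_real_mul _ hr,
        Complex.arg_exp_mul_I,
        (toIocMod_eq_self _).2 ⟨by linarith [Real.pi_pos], by linarith [Real.pi_pos]⟩]
      exact hφ
  rw [this]
  exact (isPreconnected_Ioi.prod isPreconnected_Ioo).image _ (by fun_prop)

lemma exists_mem_openSector_norm {n : ℕ} (hn : 2 ≤ n) {μ : ℂ} (hμ : μ ≠ 0) (k : ℕ) {r : ℝ}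
    (hr : 0 < r) : ∃ z ∈ openSector n μ k, ‖z‖ = r := by
  have hck := critPt_ne_zero n hμ k
  have hp := norm_pos_iff.2 hck
  have hpi := pi_div_lt_pi hn
  have hpi0 := pi_div_pos hn
  refine ⟨critPt n μ k * (((r / ‖critPt n μ k‖ : ℝ) : ℂ) *
    Complex.exp (((Real.pi / n / 2 : ℝ) : ℂ) * Complex.I)), ?_, ?_⟩
  · rw [openSector, Set.mem_ofPred_eq, mul_div_cancel_left₀ _ hck,
      Complex.arg_real_mul _ (by positivity), Complex.arg_exp_mul_I,
      (toIocMod_eq_self _).2 ⟨by linarith [Real.pi_pos], by linarith [Real.pi_pos]⟩]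
    constructor <;> linarith
  · rw [norm_mul, norm_mul, Complex.norm_exp_ofReal_mul_I, Complex.norm_real, mul_one,
      Real.norm_of_nonneg (by positivity)]
    field_simp

lemma im_approx_pos {n : ℕ} (hn : 2 ≤ n) {μ : ℂ} (hμ : μ ∈ fundDomain n) {m : ℕ} {k : ℕ → ℕ}
    (hk1 : ∀ i, 1 ≤ k i) (hkn : ∀ i, k i + 1 ≤ n) {z : ℂ} (hz : z ∈ approx n μ m k) :
    0 < (z / sqrtParam n μ).im :=
  im_div_sqrtParam_pos hn hμ (hk1 0) (hkn 0) (approx_subset_openSector hz)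

/-- The pulled-back set A ∪ {0} ∪ -A meets the line through the critical values only at 0, so it
avoids both cuts of the inverse branch. -/
lemma branch_domain {n : ℕ} (hn : 2 ≤ n) {μ : ℂ} (hμ : μ ∈ fundDomain n) {m : ℕ} {k : ℕ → ℕ}
    (hk1 : ∀ i, 1 ≤ k i) (hkn : ∀ i, k i + 1 ≤ n) {z : ℂ}
    (hz : z ∈ approx n μ m k ∨ z = 0 ∨ -z ∈ approx n μ m k) :
    z / sqrtParam n μ = 0 ∨ (z / sqrtParam n μ).im ≠ 0 := by
  rcases hz with h | rfl | h
  · exact Or.inr (im_approx_pos hn hμ hk1 hkn h).ne'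
  · simp
  · have := im_approx_pos hn hμ hk1 hkn h
    rw [neg_div, Complex.neg_im] at this
    exact Or.inr (by linarith)

lemma approx_succ_eq_image {n : ℕ} (hn : 2 ≤ n) {μ : ℂ} (hμ : μ ∈ fundDomain n) {m : ℕ}
    {k : ℕ → ℕ} (hk1 : ∀ i, 1 ≤ k i) (hkn : ∀ i, k i + 1 ≤ n) :
    approx n μ (m + 1) k = branch n μ (k 0) ''
      {z | z ∈ approx n μ m (shift k) ∨ z = 0 ∨ -z ∈ approx n μ m (shift k)} := by
  ext z
  constructor
  · rintro ⟨h0, h1⟩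
    exact ⟨planeMap n μ z, h1, branch_planeMap (by omega) hμ.1 h0
      (branch_domain hn hμ (fun i => hk1 (i + 1)) (fun i => hkn (i + 1)) h1)⟩
  · rintro ⟨v, hv, rfl⟩
    have hd := branch_domain hn hμ (fun i => hk1 (i + 1)) (fun i => hkn (i + 1)) hv
    obtain ⟨h1, h2⟩ := branch_spec (by omega : 1 ≤ n) hμ.1 (k 0) hd
    refine ⟨h1, ?_⟩
    rw [h2]
    exact hv

lemma norm_planeMap_le {n : ℕ} {μ z : ℂ} {M : ℝ} (hM : 1 ≤ M) (h1 : ‖z‖ ≤ M) (h2 : M⁻¹ ≤ ‖z‖) :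
    ‖planeMap n μ z‖ ≤ M ^ n + ‖μ‖ * M ^ n := by
  have hM0 : 0 < M := by linarith
  have a : ‖z ^ n‖ ≤ M ^ n := by
    rw [norm_pow]; exact pow_le_pow_left₀ (norm_nonneg _) h1 n
  have b : ‖μ / z ^ n‖ ≤ ‖μ‖ * M ^ n := by
    rw [norm_div, norm_pow, div_eq_mul_inv, ← inv_pow]
    refine mul_le_mul_of_nonneg_left (pow_le_pow_left₀ (by positivity) ?_ n) (norm_nonneg _)
    exact inv_le_of_inv_le₀ hM0 h2
  exact (norm_add_le _ _).trans (add_le_add a b)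

/-- The three claims must be proved together. As A accumulates at 0, the set A ∪ {0} ∪ -A is
connected, and so is its image under the branch. The image is unbounded or accumulates at 0 because
A is unbounded, and the involution of the sector exchanges these two ends. -/
lemma approx_spec {n : ℕ} (hn : 2 ≤ n) {μ : ℂ} (hμ : μ ∈ fundDomain n) (m : ℕ)
    {k : ℕ → ℕ} (hk1 : ∀ i, 1 ≤ k i) (hkn : ∀ i, k i + 1 ≤ n) :
    IsPreconnected (approx n μ m k) ∧ (∀ ε : ℝ, 0 < ε → ∃ z ∈ approx n μ m k, ‖z‖ < ε) ∧
      ∀ R : ℝ, ∃ z ∈ approx n μ m k, R < ‖z‖ := by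
  induction m generalizing k with
  | zero =>
    refine ⟨isPreconnected_openSector hn hμ.1 _, fun ε hε => ?_, fun R => ?_⟩
    · obtain ⟨z, hz, h⟩ := exists_mem_openSector_norm hn hμ.1 (k 0) (half_pos hε)
      exact ⟨z, hz, by rw [h]; linarith⟩
    · obtain ⟨z, hz, h⟩ := exists_mem_openSector_norm hn hμ.1 (k 0)
        (show 0 < |R| + 1 by positivity)
      exact ⟨z, hz, by rw [h]; linarith [le_abs_self R]⟩
  | succ m ih =>
    obtain ⟨hconn, hsmall, hlarge⟩ := ih (k := shift k) (fun i => hk1 (i + 1))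
      (fun i => hkn (i + 1))
    have hck := critPt_ne_zero n hμ.1 (k 0)
    have hck' := critPt_ne_zero n hμ.1 (k 0 + 1)
    set p := critPt n μ (k 0) * critPt n μ (k 0 + 1) with hp
    have hp0 : 0 < ‖p‖ := norm_pos_iff.2 (mul_ne_zero hck hck')
    have hinvol : ∀ z ∈ approx n μ (m + 1) k, p / z ∈ approx n μ (m + 1) k := by
      rintro z ⟨h0, h1⟩
      obtain ⟨h2, h3⟩ := involution_spec hn hμ.1 h0
      refine ⟨h2, ?_⟩
      rw [h3, neg_neg, neg_eq_zero]
      tauto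
    -- The map is bounded on the annulus M⁻¹ ≤ |z| ≤ M, so the preimage of a sufficiently large
    -- point of A lies outside this annulus.
    have hex : ∀ M : ℝ, 1 ≤ M → ∃ z ∈ approx n μ (m + 1) k, M < ‖z‖ ∨ ‖z‖ < M⁻¹ := by
      intro M hM
      obtain ⟨v, hv, hvM⟩ := hlarge (M ^ n + ‖μ‖ * M ^ n)
      have hd := branch_domain hn hμ (fun i => hk1 (i + 1)) (fun i => hkn (i + 1)) (Or.inl hv)
      obtain ⟨h1, h2⟩ := branch_spec (by omega : 1 ≤ n) hμ.1 (k 0) hd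
      refine ⟨_, ⟨h1, by rw [h2]; exact Or.inl hv⟩, ?_⟩
      by_contra hc
      push Not at hc
      have := norm_planeMap_le (n := n) (μ := μ) hM hc.1 hc.2
      rw [h2] at this
      linarith
    have hsmall' : ∀ ε : ℝ, 0 < ε → ∃ z ∈ approx n μ (m + 1) k, ‖z‖ < ε := by
      intro ε hε
      obtain ⟨z, hz, h⟩ := hex (max 1 (max (‖p‖ / ε) (1 / ε))) (le_max_left _ _)
      have hM0 : 0 < max 1 (max (‖p‖ / ε) (1 / ε)) := lt_of_lt_of_le one_pos (le_max_left _ _)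
      rcases h with h | h
      · refine ⟨p / z, hinvol z hz, ?_⟩
        have h1 : ‖p‖ / ε < ‖z‖ := lt_of_le_of_lt ((le_max_left _ _).trans (le_max_right _ _)) h
        rw [norm_div, div_lt_iff₀ (hM0.trans h)]
        rw [div_lt_iff₀ hε] at h1
        linarith
      · refine ⟨z, hz, h.trans_le ?_⟩
        have h1 : 1 / ε ≤ max 1 (max (‖p‖ / ε) (1 / ε)) :=
          (le_max_right _ _).trans (le_max_right _ _)
        exact inv_le_of_inv_le₀ hε (one_div ε ▸ h1)
    refine ⟨?_, hsmall', fun R => ?_⟩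
    · rw [approx_succ_eq_image hn hμ hk1 hkn]
      set A := approx n μ m (shift k)
      have hA0 : (0 : ℂ) ∈ closure A := by
        rw [Metric.mem_closure_iff]
        intro ε hε
        obtain ⟨z, hz, h⟩ := hsmall ε hε
        exact ⟨z, hz, by rwa [dist_zero_left]⟩
      have h1 : IsPreconnected (insert 0 A) :=
        hconn.subset_closure (Set.subset_insert _ _) (Set.insert_subset hA0 subset_closure)
      have h2 : IsPreconnected ((fun z : ℂ => -z) '' insert 0 A) :=
        h1.image _ continuous_neg.continuousOn
      have h3 : {z | z ∈ A ∨ z = 0 ∨ -z ∈ A} = insert 0 A ∪ (fun z : ℂ => -z) '' insert 0 A := by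
        ext z
        simp only [Set.mem_ofPred_eq, Set.mem_union, Set.mem_insert_iff, Set.mem_image]
        constructor
        · rintro (h | h | h)
          exacts [Or.inl (Or.inr h), Or.inl (Or.inl h), Or.inr ⟨-z, Or.inr h, neg_neg z⟩]
        · rintro ((h | h) | ⟨w, h | h, rfl⟩)
          · exact Or.inr (Or.inl h)
          · exact Or.inl h
          · exact Or.inr (Or.inl (by rw [h, neg_zero]))
          · exact Or.inr (Or.inr (by rwa [neg_neg]))
      refine IsPreconnected.image ?_ _ ?_
      · rw [h3]
        exact IsPreconnected.union 0 (Set.mem_insert _ _) ⟨0, Set.mem_insert _ _, neg_zero⟩ h1 h2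
      · intro z hz
        exact (continuousAt_branch _ (branch_domain hn hμ (fun i => hk1 (i + 1))
          (fun i => hkn (i + 1)) hz)).continuousWithinAt
    · obtain ⟨z, hz, h⟩ := hsmall' (‖p‖ / (|R| + 1)) (by positivity)
      refine ⟨p / z, hinvol z hz, ?_⟩
      have hz0 : 0 < ‖z‖ := norm_pos_iff.2 (ne_zero_of_mem_openSector hz.1)
      rw [lt_div_iff₀ (by positivity)] at h
      rw [norm_div, lt_div_iff₀ hz0]
      nlinarith [le_abs_self R]

/-! ### Connected half rays -/

/-- A decreasing intersection of closed preconnected subsets of a compact Hausdorff space is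
preconnected. -/
lemma isPreconnected_iInter_of_antitone {X : Type*} [TopologicalSpace X] [CompactSpace X]
    [T2Space X] {K : ℕ → Set X} (hK : Antitone K) (hc : ∀ m, IsClosed (K m))
    (hp : ∀ m, IsPreconnected (K m)) : IsPreconnected (⋂ m, K m) := by
  rw [isPreconnected_iff_subset_of_fully_disjoint_closed (isClosed_iInter hc)]
  intro A B hA hB hAB hdisj
  obtain ⟨U, V, hU, hV, hAU, hBV, hUV⟩ := normal_separation hA hB hdisj
  have hsub : ⋂ m, K m ⊆ U ∪ V := hAB.trans (Set.union_subset_union hAU hBV)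
  obtain ⟨m, hm⟩ : ∃ m, K m ⊆ U ∪ V := by
    refine exists_subset_nhds_of_compactSpace hK.directed_ge hc fun x hx => ?_
    exact (hU.union hV).mem_nhds (hsub hx)
  have hI : ⋂ m, K m ⊆ K m := Set.iInter_subset _ _
  rcases (isPreconnected_iff_subset_of_disjoint.1 (hp m)) U V hU hV hm
    (by rw [hUV.inter_eq, Set.inter_empty]) with h | h
  · left
    intro x hx
    refine (hAB hx).resolve_right fun hxB => ?_
    exact Set.disjoint_left.1 hUV (h (hI hx)) (hBV hxB)
  · right
    intro x hx
    refine (hAB hx).resolve_left fun hxA => ?_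
    exact Set.disjoint_left.1 hUV (hAU hxA) (h (hI hx))

/-- The half ray together with its end points `0` and `∞`. -/
def closedHalfRay (n : ℕ) (μ : ℂ) (k : ℕ → ℕ) : Set (OnePoint ℂ) :=
  insert OnePoint.infty (insert ((0 : ℂ) : OnePoint ℂ) ((↑) '' halfRay n μ k))

/-- Here membership is a conjunction of conditions that are closed in the sphere, which is what
limits and closedness require. -/
lemma mem_closedHalfRay_iff {n : ℕ} {μ : ℂ} {k : ℕ → ℕ} {x : OnePoint ℂ} :
    x ∈ closedHalfRay n μ k ↔
      x ∈ fullRay n μ k ∧ ∀ z : ℂ, x = z → z ∈ planeSector n μ (k 0) := by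
  constructor
  · rintro (rfl | rfl | ⟨z, hz, rfl⟩)
    · exact ⟨infty_mem_fullRay n μ k, fun z hz => absurd hz (OnePoint.infty_ne_coe z)⟩
    · refine ⟨zero_mem_fullRay n μ k, fun z hz => ?_⟩
      rw [← OnePoint.coe_injective hz]
      exact planeSector_zero_mem n μ _
    · refine ⟨hz.2.2, fun w hw => ?_⟩
      rw [← OnePoint.coe_injective hw]
      exact hz.2.1
  · rintro ⟨h1, h2⟩
    induction x using OnePoint.rec with
    | infty => exact Or.inl rfl
    | coe z =>
      by_cases hz : z = 0
      · exact Or.inr (Or.inl (by rw [hz]))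
      · exact Or.inr (Or.inr ⟨z, ⟨hz, h2 z rfl, h1⟩, rfl⟩)

lemma coe_mem_closedHalfRay {n : ℕ} {μ : ℂ} {k : ℕ → ℕ} {z : ℂ} :
    (z : OnePoint ℂ) ∈ closedHalfRay n μ k ↔ z = 0 ∨ z ∈ halfRay n μ k := by
  constructor
  · rintro (h | h | ⟨w, hw, h⟩)
    · exact absurd h (OnePoint.coe_ne_infty z)
    · exact Or.inl (OnePoint.coe_injective h)
    · exact Or.inr (OnePoint.coe_injective h ▸ hw)
  · rintro (rfl | h)
    · exact Or.inr (Or.inl rfl)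
    · exact Or.inr (Or.inr ⟨z, h, rfl⟩)

/-! ### Closedness of the rays jointly in the point and the parameter. -/

section Limits

variable {ι : Type*} {l : Filter ι} [l.NeBot] {n : ℕ} {μ : ι → ℂ} {lam : ℂ}

lemma doubleSector_of_tendsto (hn : 2 ≤ n) (hlam : lam ≠ 0) (hμ : Tendsto μ l (𝓝 lam)) {k : ℕ}
    (hcr : Tendsto (fun j => critPt n (μ j) k) l (𝓝 (critPt n lam k)))
    {x : ι → OnePoint ℂ} {x₀ : OnePoint ℂ} (hx : Tendsto x l (𝓝 x₀))
    (h : ∀ᶠ j in l, x j ∈ doubleSector n (μ j) k) : x₀ ∈ doubleSector n lam k := by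
  induction x₀ using OnePoint.rec with
  | infty => exact infty_mem_doubleSector n lam k
  | coe z =>
    obtain ⟨y, hy, hxy⟩ := exists_lift_of_tendsto hx
    have hμ0 := hμ.eventually_ne hlam
    rw [coe_mem_doubleSector]
    have h' : ∀ᶠ j in l, y j ∈ planeSector n (μ j) k ∨ -y j ∈ planeSector n (μ j) k := by
      filter_upwards [h, hxy] with j h1 h2
      rwa [h2, coe_mem_doubleSector] at h1
    by_cases hf : ∃ᶠ j in l, y j ∈ planeSector n (μ j) k
    · left
      have hne : (l ⊓ 𝓟 {j | y j ∈ planeSector n (μ j) k}).NeBot := frequently_mem_iff_neBot.1 hf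
      exact planeSector_of_tendsto (l := l ⊓ 𝓟 {j | y j ∈ planeSector n (μ j) k}) hn hlam
        (hμ0.filter_mono inf_le_left) (hcr.mono_left inf_le_left) (hy.mono_left inf_le_left)
        (mem_inf_of_right (mem_principal_self _))
    · right
      rw [not_frequently] at hf
      refine planeSector_of_tendsto hn hlam hμ0 hcr hy.neg ?_
      filter_upwards [h', hf] with j h1 h2
      exact h1.resolve_left h2

lemma fullRay_of_tendsto (hn : 2 ≤ n) (hlam : lam ≠ 0) (hμ : Tendsto μ l (𝓝 lam))
    (hcr : ∀ k, Tendsto (fun j => critPt n (μ j) k) l (𝓝 (critPt n lam k))) {k : ℕ → ℕ}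
    {x : ι → OnePoint ℂ} {x₀ : OnePoint ℂ} (hx : Tendsto x l (𝓝 x₀))
    (h : ∀ᶠ j in l, x j ∈ fullRay n (μ j) k) : x₀ ∈ fullRay n lam k := fun i =>
  doubleSector_of_tendsto hn hlam hμ (hcr _)
    (mcMap_iterate_tendsto (by omega) hlam hμ hx i) (h.mono fun _ hj => hj i)

/-- Closedness of the half rays jointly in the parameter. -/
lemma closedHalfRay_of_tendsto (hn : 2 ≤ n) (hlam : lam ≠ 0) (hμ : Tendsto μ l (𝓝 lam))
    (hcr : ∀ k, Tendsto (fun j => critPt n (μ j) k) l (𝓝 (critPt n lam k))) {k : ℕ → ℕ}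
    {x : ι → OnePoint ℂ} {x₀ : OnePoint ℂ} (hx : Tendsto x l (𝓝 x₀))
    (h : ∀ᶠ j in l, x j ∈ closedHalfRay n (μ j) k) : x₀ ∈ closedHalfRay n lam k := by
  rw [mem_closedHalfRay_iff]
  refine ⟨fullRay_of_tendsto hn hlam hμ hcr hx
    (h.mono fun j hj => (mem_closedHalfRay_iff.1 hj).1), ?_⟩
  rintro z rfl
  obtain ⟨y, hy, hxy⟩ := exists_lift_of_tendsto hx
  refine planeSector_of_tendsto hn hlam (hμ.eventually_ne hlam) (hcr _) hy ?_
  filter_upwards [h, hxy] with j h1 h2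
  exact (mem_closedHalfRay_iff.1 h1).2 _ h2

end Limits

/-- This lets the limit lemmas, applied with a constant parameter, double as closedness statements.
-/
lemma isClosed_of_tendsto {X : Type*} [TopologicalSpace X] {s : Set X}
    (h : ∀ (l : Filter X) [l.NeBot] (x : X), Tendsto id l (𝓝 x) → (∀ᶠ y in l, y ∈ s) → x ∈ s) :
    IsClosed s := by
  rw [isClosed_iff_clusterPt]
  intro x hx
  have : (𝓝 x ⊓ 𝓟 s).NeBot := hx
  exact h (𝓝 x ⊓ 𝓟 s) x inf_le_left (mem_inf_of_right (mem_principal_self s))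

lemma isClosed_doubleSector {n : ℕ} (hn : 2 ≤ n) {μ : ℂ} (hμ : μ ≠ 0) (k : ℕ) :
    IsClosed (doubleSector n μ k) :=
  isClosed_of_tendsto fun _ _ _ hx h =>
    doubleSector_of_tendsto hn hμ tendsto_const_nhds tendsto_const_nhds hx h

lemma isClosed_fullRay {n : ℕ} (hn : 2 ≤ n) {μ : ℂ} (hμ : μ ≠ 0) (k : ℕ → ℕ) :
    IsClosed (fullRay n μ k) :=
  isClosed_of_tendsto fun _ _ _ hx h =>
    fullRay_of_tendsto hn hμ tendsto_const_nhds (fun _ => tendsto_const_nhds) hx h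

lemma isClosed_closedHalfRay {n : ℕ} (hn : 2 ≤ n) {μ : ℂ} (hμ : μ ≠ 0) (k : ℕ → ℕ) :
    IsClosed (closedHalfRay n μ k) :=
  isClosed_of_tendsto fun _ _ _ hx h =>
    closedHalfRay_of_tendsto hn hμ tendsto_const_nhds (fun _ => tendsto_const_nhds) hx h

/-- The intersection of the closures of the connected approximations. -/
def rayCore (n : ℕ) (μ : ℂ) (k : ℕ → ℕ) : Set (OnePoint ℂ) :=
  ⋂ m, closure ((↑) '' approx n μ m k)

lemma isPreconnected_rayCore {n : ℕ} (hn : 2 ≤ n) {μ : ℂ} (hμ : μ ∈ fundDomain n)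
    {k : ℕ → ℕ} (hk1 : ∀ i, 1 ≤ k i) (hkn : ∀ i, k i + 1 ≤ n) :
    IsPreconnected (rayCore n μ k) := by
  refine isPreconnected_iInter_of_antitone ?_ (fun _ => isClosed_closure) fun m => ?_
  · exact antitone_nat_of_succ_le fun m =>
      closure_mono (Set.image_mono (approx_succ_subset m k))
  · exact ((approx_spec hn hμ m hk1 hkn).1.image _
      OnePoint.continuous_coe.continuousOn).closure

lemma zero_mem_rayCore {n : ℕ} (hn : 2 ≤ n) {μ : ℂ} (hμ : μ ∈ fundDomain n)
    {k : ℕ → ℕ} (hk1 : ∀ i, 1 ≤ k i) (hkn : ∀ i, k i + 1 ≤ n) :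
    ((0 : ℂ) : OnePoint ℂ) ∈ rayCore n μ k := by
  refine Set.mem_iInter.2 fun m => ?_
  refine image_closure_subset_closure_image OnePoint.continuous_coe ⟨0, ?_, rfl⟩
  rw [Metric.mem_closure_iff]
  intro ε hε
  obtain ⟨z, hz, h⟩ := (approx_spec hn hμ m hk1 hkn).2.1 ε hε
  exact ⟨z, hz, by rwa [dist_zero_left]⟩

lemma infty_mem_rayCore {n : ℕ} (hn : 2 ≤ n) {μ : ℂ} (hμ : μ ∈ fundDomain n)
    {k : ℕ → ℕ} (hk1 : ∀ i, 1 ≤ k i) (hkn : ∀ i, k i + 1 ≤ n) :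
    OnePoint.infty ∈ rayCore n μ k := by
  refine Set.mem_iInter.2 fun m => ?_
  choose z hz h using fun N : ℕ => (approx_spec hn hμ m hk1 hkn).2.2 (N : ℝ)
  refine mem_closure_of_tendsto (f := fun N => (z N : OnePoint ℂ)) (b := atTop) ?_
    (Eventually.of_forall fun N => ⟨z N, hz N, rfl⟩)
  rw [tendsto_infty_iff]
  intro R
  filter_upwards [eventually_ge_atTop ⌈R⌉₊] with N hN w hw
  rw [← OnePoint.coe_injective hw]
  exact (Nat.ceil_le.1 hN).trans_lt (h N)

lemma iterate_mem_doubleSector_of_approx {n : ℕ} (hn : 2 ≤ n) {μ : ℂ} (hμ : μ ≠ 0) {m i : ℕ}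
    (hi : i ≤ m) {k : ℕ → ℕ} {z : ℂ}
    (hz : z ∈ approx n μ m k ∨ z = 0 ∨ -z ∈ approx n μ m k) :
    (mcMap n μ)^[i] (z : OnePoint ℂ) ∈ doubleSector n μ (k i) := by
  induction i generalizing m k z with
  | zero =>
    have hsub : approx n μ m k ⊆ planeSector n μ (k 0) :=
      approx_subset_openSector.trans (openSector_subset_planeSector hn hμ _)
    rw [Function.iterate_zero, id, coe_mem_doubleSector]
    rcases hz with h | rfl | h
    · exact Or.inl (hsub h)
    · exact Or.inl (planeSector_zero_mem n μ _)
    · exact Or.inr (hsub h)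
  | succ i ih =>
    obtain ⟨m, rfl⟩ : ∃ m', m = m' + 1 := ⟨m - 1, by omega⟩
    rw [Function.iterate_succ, Function.comp]
    rcases hz with h | rfl | h
    · rw [mcMap_coe (ne_zero_of_mem_openSector h.1)]
      exact ih (k := shift k) (by omega) h.2
    · rw [mcMap_zero, mcMap_iterate_infty]
      exact infty_mem_doubleSector n μ _
    · have h0 := ne_zero_of_mem_openSector h.1
      rw [mcMap_coe (neg_ne_zero.1 h0)]
      refine ih (m := m) (k := shift k) (by omega) ?_
      have h2 := h.2
      rw [planeMap_neg] at h2
      rcases neg_one_pow_eq_or ℂ n with e | e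
      · rwa [e, one_mul] at h2
      · rw [e, neg_one_mul, neg_neg, neg_eq_zero] at h2
        tauto

lemma isClosed_insert_image_planeSector {n : ℕ} (hn : 2 ≤ n) {μ : ℂ} (hμ : μ ≠ 0) (k : ℕ) :
    IsClosed {x : OnePoint ℂ | ∀ z : ℂ, x = z → z ∈ planeSector n μ k} := by
  refine isClosed_of_tendsto fun l _ x hx h => ?_
  rintro z rfl
  obtain ⟨y, hy, hxy⟩ := exists_lift_of_tendsto hx
  refine planeSector_of_tendsto (μ := fun _ => μ) hn hμ (Eventually.of_forall fun _ => hμ)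
    tendsto_const_nhds hy ?_
  filter_upwards [h, hxy] with j h1 h2
  exact h1 _ h2

/-- A point of the m-th approximation satisfies the sector condition at time m, and this condition
is closed by continuity of the iterates. Passing to closures can add boundary points of sectors,
which the closed half ray permits. -/
lemma rayCore_subset_closedHalfRay {n : ℕ} (hn : 2 ≤ n) {μ : ℂ} (hμ : μ ≠ 0) (k : ℕ → ℕ) :
    rayCore n μ k ⊆ closedHalfRay n μ k := by
  intro x hx
  rw [rayCore, Set.mem_iInter] at hx
  rw [mem_closedHalfRay_iff]
  constructor
  · intro m
    have hcl : IsClosed ((mcMap n μ)^[m] ⁻¹' doubleSector n μ (k m)) :=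
      (isClosed_doubleSector hn hμ _).preimage ((continuous_mcMap (by omega) hμ).iterate m)
    refine closure_minimal ?_ hcl (hx m)
    rintro _ ⟨z, hz, rfl⟩
    exact iterate_mem_doubleSector_of_approx hn hμ le_rfl (Or.inl hz)
  · refine closure_minimal ?_ (isClosed_insert_image_planeSector hn hμ (k 0)) (hx 0)
    rintro _ ⟨z, hz, rfl⟩ w hw
    rw [← OnePoint.coe_injective hw]
    exact openSector_subset_planeSector hn hμ _ hz

/-- For positive parameters the boundaries of the sectors are never met, so the closed conditions of
the half ray imply the open ones. -/
lemma halfRay_subset_approx {n : ℕ} (hn : 2 ≤ n) {lam : ℝ} (hlam : 0 < lam) {k : ℕ → ℕ}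
    (hk : IsAdmissible n k) (m : ℕ) : halfRay n lam k ⊆ approx n lam m k := by
  induction m generalizing k with
  | zero => exact halfRay_subset_openSector hn hlam hk
  | succ m ih =>
    intro z hz
    exact ⟨halfRay_subset_openSector hn hlam hk hz,
      (mem_halfRay_iff.1 hz).2.2.imp (fun h => ih hk.shift h) (Or.imp_right fun h => ih hk.shift h)⟩

lemma closedHalfRay_eq_rayCore {n : ℕ} (hn : 2 ≤ n) {lam : ℝ} (hlam : 0 < lam) {k : ℕ → ℕ}
    (hk : IsAdmissible n k) : closedHalfRay n lam k = rayCore n lam k := by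
  have hl := ofReal_mem_fundDomain hn hlam
  refine Set.Subset.antisymm ?_ (rayCore_subset_closedHalfRay hn hl.1 k)
  rintro x (rfl | rfl | ⟨z, hz, rfl⟩)
  · exact infty_mem_rayCore hn hl hk.one_le hk.succ_le
  · exact zero_mem_rayCore hn hl hk.one_le hk.succ_le
  · exact Set.mem_iInter.2 fun m => subset_closure ⟨z, halfRay_subset_approx hn hlam hk m hz, rfl⟩

lemma isPreconnected_closedHalfRay {n : ℕ} (hn : 2 ≤ n) {lam : ℝ} (hlam : 0 < lam) {k : ℕ → ℕ}
    (hk : IsAdmissible n k) : IsPreconnected (closedHalfRay n lam k) := by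
  rw [closedHalfRay_eq_rayCore hn hlam hk]
  exact isPreconnected_rayCore hn (ofReal_mem_fundDomain hn hlam) hk.one_le hk.succ_le

/-! ### Contraction of the hyperbolic metric -/

/-! ### Trigonometric and hyperbolic inequalities for the power map. -/

lemma abs_sin_nat_mul_le (n : ℕ) (a : ℝ) : |Real.sin (n * a)| ≤ n * |Real.sin a| := by
  induction n with
  | zero => simp
  | succ n ih =>
    have e : ((n + 1 : ℕ) : ℝ) * a = n * a + a := by push_cast; ring
    rw [e, Real.sin_add]
    have h1 : |Real.sin (n * a) * Real.cos a| ≤ |Real.sin (n * a)| := by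
      rw [abs_mul]
      exact mul_le_of_le_one_right (abs_nonneg _) (Real.abs_cos_le_one _)
    have h2 : |Real.cos (n * a) * Real.sin a| ≤ |Real.sin a| := by
      rw [abs_mul]
      exact mul_le_of_le_one_left (abs_nonneg _) (Real.abs_cos_le_one _)
    have h3 := abs_add_le (Real.sin (n * a) * Real.cos a) (Real.cos (n * a) * Real.sin a)
    push_cast
    linarith

lemma nat_mul_sinh_le (n : ℕ) {x : ℝ} (hx : 0 ≤ x) : n * Real.sinh x ≤ Real.sinh (n * x) := by
  induction n with
  | zero => simp
  | succ n ih =>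
    have e : ((n + 1 : ℕ) : ℝ) * x = n * x + x := by push_cast; ring
    rw [e, Real.sinh_add]
    have h0 : 0 ≤ Real.sinh x := Real.sinh_nonneg_iff.2 hx
    have h1 : 0 ≤ Real.sinh (n * x) := Real.sinh_nonneg_iff.2 (by positivity)
    have h2 := Real.one_le_cosh x
    have h3 := Real.one_le_cosh (n * x)
    push_cast
    nlinarith

lemma sq_mul_cosh_sub_one_le (n : ℕ) (x : ℝ) :
    (n : ℝ) ^ 2 * (Real.cosh x - 1) ≤ Real.cosh (n * x) - 1 := by
  have key : ∀ y : ℝ, Real.cosh y - 1 = 2 * Real.sinh (y / 2) ^ 2 := by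
    intro y
    have h1 := Real.cosh_two_mul (y / 2)
    rw [mul_div_cancel₀ y two_ne_zero] at h1
    have h2 := Real.cosh_sq (y / 2)
    linarith
  rw [← Real.cosh_abs x, ← Real.cosh_abs (n * x), abs_mul, Nat.abs_cast, key, key]
  have h1 := nat_mul_sinh_le n (x := |x| / 2) (by positivity)
  have h2 : 0 ≤ Real.sinh (|x| / 2) := Real.sinh_nonneg_iff.2 (by positivity)
  rw [mul_div_assoc]
  have h3 : (n * Real.sinh (|x| / 2)) ^ 2 ≤ Real.sinh (n * (|x| / 2)) ^ 2 :=
    pow_le_pow_left₀ (by positivity) h1 2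
  nlinarith

/-- In quotient form, sin(nx) / sin x is decreasing on the range considered. The induction uses the
addition formula and the monotonicity of the cosine. -/
lemma sin_mul_sin_nat_mul_le (n : ℕ) {a b : ℝ} (ha : 0 ≤ a) (hab : a ≤ b)
    (hb : n * b ≤ Real.pi) (hb' : b ≤ Real.pi) :
    Real.sin a * Real.sin (n * b) ≤ Real.sin (n * a) * Real.sin b := by
  induction n with
  | zero => simp
  | succ n ih =>
    push_cast at hb
    have hb0 : 0 ≤ b := ha.trans hab
    have ih' := ih (by linarith)
    have e1 : ((n + 1 : ℕ) : ℝ) * a = n * a + a := by push_cast; ring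
    have e2 : ((n + 1 : ℕ) : ℝ) * b = n * b + b := by push_cast; ring
    rw [e1, e2, Real.sin_add, Real.sin_add]
    have hna : n * a ≤ n * b := mul_le_mul_of_nonneg_left hab (by positivity)
    have hna0 : 0 ≤ n * a := by positivity
    have s1 : 0 ≤ Real.sin a := Real.sin_nonneg_of_nonneg_of_le_pi ha (hab.trans hb')
    have s2 : 0 ≤ Real.sin b := Real.sin_nonneg_of_nonneg_of_le_pi hb0 hb'
    have s3 : 0 ≤ Real.sin (n * a) :=
      Real.sin_nonneg_of_nonneg_of_le_pi hna0 (by linarith)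
    have s4 : 0 ≤ Real.sin (n * b) :=
      Real.sin_nonneg_of_nonneg_of_le_pi (by positivity) (by linarith)
    have c1 : Real.cos b ≤ Real.cos a := Real.cos_le_cos_of_nonneg_of_le_pi ha hb' hab
    have c2 : Real.cos (n * b) ≤ Real.cos (n * a) :=
      Real.cos_le_cos_of_nonneg_of_le_pi hna0 (by linarith) hna
    have t1 : Real.sin a * Real.sin (n * b) * Real.cos b ≤
        Real.sin (n * a) * Real.sin b * Real.cos a := by
      rcases le_or_gt 0 (Real.cos b) with h | h
      · exact mul_le_mul ih' c1 h (mul_nonneg s3 s2)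
      -- For n ≥ 1 the bound (n + 1) * b ≤ π gives b ≤ π/2, so a negative cosine is impossible.
      · rcases Nat.eq_zero_or_pos n with rfl | hn
        · simp
        · have hn1 : (1 : ℝ) ≤ n := by exact_mod_cast hn
          exfalso
          have : b ≤ Real.pi / 2 := by nlinarith
          exact absurd (Real.cos_nonneg_of_mem_Icc ⟨by linarith [Real.pi_pos], this⟩)
            (not_le.2 h)
    have t2 : Real.sin a * Real.sin b * Real.cos (n * b) ≤
        Real.sin a * Real.sin b * Real.cos (n * a) :=
      mul_le_mul_of_nonneg_left c2 (mul_nonneg s1 s2)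
    nlinarith

lemma one_sub_cos_eq (x : ℝ) : 1 - Real.cos x = 2 * Real.sin (x / 2) ^ 2 := by
  have h1 := Real.cos_two_mul (x / 2)
  rw [mul_div_cancel₀ x two_ne_zero] at h1
  have h2 := Real.sin_sq_add_cos_sq (x / 2)
  linarith

lemma sin_mul_sin_eq (a b : ℝ) :
    Real.sin a * Real.sin b = Real.sin ((a + b) / 2) ^ 2 - Real.sin ((a - b) / 2) ^ 2 := by
  have ha : Real.sin a = Real.sin ((a + b) / 2 + (a - b) / 2) := by congr 1; ring
  have hb : Real.sin b = Real.sin ((a + b) / 2 - (a - b) / 2) := by congr 1; ring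
  rw [ha, hb, Real.sin_add, Real.sin_sub]
  have h1 := Real.sin_sq_add_cos_sq ((a + b) / 2)
  have h2 := Real.sin_sq_add_cos_sq ((a - b) / 2)
  linear_combination Real.sin ((a + b) / 2) ^ 2 * h2 - Real.sin ((a - b) / 2) ^ 2 * h1

/-- The power map of a sector adjacent to the boundary does not expand. -/
lemma cosh_sub_cos_mul_le {n : ℕ} (hn : 1 ≤ n) (x : ℝ) {a b : ℝ} (ha : 0 < a) (hb : 0 < b)
    (ha' : n * a < Real.pi) (hb' : n * b < Real.pi) :
    (Real.cosh x - Real.cos (a - b)) * (Real.sin (n * a) * Real.sin (n * b)) ≤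
      (Real.cosh (n * x) - Real.cos (n * (a - b))) * (Real.sin a * Real.sin b) := by
  wlog hab : b ≤ a generalizing a b
  · have := this hb ha hb' ha' (le_of_not_ge hab)
    rw [← Real.cos_neg (a - b), ← Real.cos_neg (n * (a - b)),
      show -(a - b) = b - a by ring, show -(n * (a - b)) = n * (b - a) by ring,
      mul_comm (Real.sin (n * a)), mul_comm (Real.sin a)]
    exact this
  have hn1 : (1 : ℝ) ≤ n := by exact_mod_cast hn
  have hapi : a < Real.pi := by nlinarith
  have hbpi : b < Real.pi := by nlinarith
  have sa : 0 < Real.sin a := Real.sin_pos_of_pos_of_lt_pi ha hapi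
  have sb : 0 < Real.sin b := Real.sin_pos_of_pos_of_lt_pi hb hbpi
  have sna : 0 < Real.sin (n * a) := Real.sin_pos_of_pos_of_lt_pi (by positivity) ha'
  have snb : 0 < Real.sin (n * b) := Real.sin_pos_of_pos_of_lt_pi (by positivity) hb'
  -- hyperbolic part
  have h1 : (Real.cosh x - 1) * (Real.sin (n * a) * Real.sin (n * b)) ≤
      (Real.cosh (n * x) - 1) * (Real.sin a * Real.sin b) := by
    have e1 : Real.sin (n * a) ≤ n * Real.sin a := by
      have := abs_sin_nat_mul_le n a
      rwa [abs_of_pos sna, abs_of_pos sa] at this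
    have e2 : Real.sin (n * b) ≤ n * Real.sin b := by
      have := abs_sin_nat_mul_le n b
      rwa [abs_of_pos snb, abs_of_pos sb] at this
    have e3 : Real.sin (n * a) * Real.sin (n * b) ≤ (n * Real.sin a) * (n * Real.sin b) :=
      mul_le_mul e1 e2 snb.le (by positivity)
    have e4 := sq_mul_cosh_sub_one_le n x
    have e5 : 0 ≤ Real.cosh x - 1 := by linarith [Real.one_le_cosh x]
    calc (Real.cosh x - 1) * (Real.sin (n * a) * Real.sin (n * b))
        ≤ (Real.cosh x - 1) * ((n * Real.sin a) * (n * Real.sin b)) :=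
          mul_le_mul_of_nonneg_left e3 e5
      _ = ((n : ℝ) ^ 2 * (Real.cosh x - 1)) * (Real.sin a * Real.sin b) := by ring
      _ ≤ _ := mul_le_mul_of_nonneg_right e4 (by positivity)
  -- circular part
  have h2 : (1 - Real.cos (a - b)) * (Real.sin (n * a) * Real.sin (n * b)) ≤
      (1 - Real.cos (n * (a - b))) * (Real.sin a * Real.sin b) := by
    -- Rewriting both products of sines as differences of squares produces the same term
    -- sin²((a-b)/2) sin²(n(a-b)/2) on the two sides; what remains is the square of f.
    have f := sin_mul_sin_nat_mul_le n (a := (a - b) / 2) (b := (a + b) / 2)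
      (by linarith) (by linarith) (by nlinarith) (by linarith)
    have p1 : 0 ≤ Real.sin ((a - b) / 2) :=
      Real.sin_nonneg_of_nonneg_of_le_pi (by linarith) (by linarith)
    have p2 : 0 ≤ Real.sin (n * ((a + b) / 2)) :=
      Real.sin_nonneg_of_nonneg_of_le_pi (by positivity) (by nlinarith)
    have f2 := pow_le_pow_left₀ (mul_nonneg p1 p2) f 2
    have ea : (n * a + n * b) / 2 = n * ((a + b) / 2) := by ring
    have eb : (n * a - n * b) / 2 = n * ((a - b) / 2) := by ring
    have ec : n * (a - b) / 2 = n * ((a - b) / 2) := by ring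
    rw [one_sub_cos_eq, one_sub_cos_eq, sin_mul_sin_eq (n * a), sin_mul_sin_eq a, ea, eb, ec]
    nlinarith
  linarith

lemma two_div_le_sin {n : ℕ} (hn : 2 ≤ n) {γ : ℝ} (h1 : Real.pi / n ≤ γ)
    (h2 : γ ≤ Real.pi - Real.pi / n) : 2 / n ≤ Real.sin γ := by
  have hn2 : (2 : ℝ) ≤ n := by exact_mod_cast hn
  have hn0 : (0 : ℝ) < n := by linarith
  have hpi := Real.pi_pos
  have base : ∀ δ : ℝ, Real.pi / n ≤ δ → δ ≤ Real.pi / 2 → 2 / n ≤ Real.sin δ := by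
    intro δ h1 h2
    have h0 : 0 ≤ δ := le_trans (by positivity) h1
    refine le_trans ?_ (Real.mul_le_sin h0 h2)
    calc 2 / (n : ℝ) = 2 / Real.pi * (Real.pi / n) := by field_simp
      _ ≤ _ := mul_le_mul_of_nonneg_left h1 (by positivity)
  rcases le_or_gt γ (Real.pi / 2) with h | h
  · exact base γ h1 h
  · rw [← Real.sin_pi_sub]
    exact base _ (by linarith) (by linarith)

/-- The power map of a sector away from the boundary contracts uniformly. -/
lemma cosh_sub_cos_mul_le_of_interior {n : ℕ} (hn : 2 ≤ n) (x : ℝ) {a b α β : ℝ}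
    (ha : 0 < a) (hb : 0 < b) (ha' : n * a < Real.pi) (hb' : n * b < Real.pi)
    (hα : Real.pi / n ≤ α) (hα' : α ≤ Real.pi - Real.pi / n)
    (hβ : Real.pi / n ≤ β) (hβ' : β ≤ Real.pi - Real.pi / n) :
    (Real.cosh x - Real.cos (a - b)) * (Real.sin (n * a) * Real.sin (n * b)) ≤
      5 / 8 * ((Real.cosh (n * x) - Real.cos (n * (a - b))) * (Real.sin α * Real.sin β)) := by
  have hn2 : (2 : ℝ) ≤ n := by exact_mod_cast hn
  have hn0 : (0 : ℝ) < n := by linarith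
  have hpi := Real.pi_pos
  have sα := two_div_le_sin hn hα hα'
  have sβ := two_div_le_sin hn hβ hβ'
  have hsn : Real.sin (n * a) * Real.sin (n * b) ≤ 1 := by
    have := Real.sin_le_one (n * a)
    have := Real.sin_le_one (n * b)
    have : 0 ≤ Real.sin (n * a) := Real.sin_nonneg_of_nonneg_of_le_pi (by positivity) ha'.le
    nlinarith
  have hden : (2 / n) * (2 / n) ≤ Real.sin α * Real.sin β :=
    mul_le_mul sα sβ (by positivity) (le_trans (by positivity) sα)
  have h1 := sq_mul_cosh_sub_one_le n x
  have e5 : 0 ≤ Real.cosh x - 1 := by linarith [Real.one_le_cosh x]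
  -- Jordan's inequality gives the factor π²/4, bounded by 5/2. Since both sines of α and β are at
  -- least 2/n, the final ratio is (5/2)/4 = 5/8.
  have hcirc : (n : ℝ) ^ 2 * (1 - Real.cos (a - b)) ≤
      5 / 2 * (1 - Real.cos (n * (a - b))) := by
    rw [← Real.cos_abs (a - b), ← Real.cos_abs (n * (a - b)), abs_mul, Nat.abs_cast,
      one_sub_cos_eq, one_sub_cos_eq]
    set δ := |a - b| with hδ
    have hδ0 : 0 ≤ δ := abs_nonneg _
    have hδ1 : n * δ ≤ Real.pi := by
      have : δ ≤ max a b := by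
        rw [hδ, abs_sub_le_iff]
        constructor
        · linarith [le_max_left a b]
        · linarith [le_max_right a b]
      rcases max_cases a b with ⟨h, -⟩ | ⟨h, -⟩ <;> rw [h] at this <;> nlinarith
    have s1 : 0 ≤ Real.sin (δ / 2) :=
      Real.sin_nonneg_of_nonneg_of_le_pi (by linarith) (by nlinarith)
    have s2 : Real.sin (δ / 2) ≤ δ / 2 := Real.sin_le (by linarith)
    have s3 : 2 / Real.pi * (n * δ / 2) ≤ Real.sin (n * δ / 2) :=
      Real.mul_le_sin (by positivity) (by linarith)
    have s4 : n * Real.sin (δ / 2) ≤ Real.pi / 2 * Real.sin (n * δ / 2) := by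
      calc n * Real.sin (δ / 2) ≤ n * (δ / 2) := mul_le_mul_of_nonneg_left s2 hn0.le
        _ = Real.pi / 2 * (2 / Real.pi * (n * δ / 2)) := by field_simp
        _ ≤ _ := mul_le_mul_of_nonneg_left s3 (by positivity)
    have s5 := pow_le_pow_left₀ (by positivity) s4 2
    have hpi2 : Real.pi ^ 2 ≤ 10 := by
      have := Real.pi_lt_d2
      nlinarith
    nlinarith [sq_nonneg (Real.sin (n * δ / 2))]
  have hc0 : 0 ≤ 1 - Real.cos (n * (a - b)) := by linarith [Real.cos_le_one (n * (a - b))]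
  have hc1 : 0 ≤ Real.cosh (n * x) - 1 := by linarith [Real.one_le_cosh (n * x)]
  have hc2 : 0 ≤ 1 - Real.cos (a - b) := by linarith [Real.cos_le_one (a - b)]
  have hnum : (n : ℝ) ^ 2 * (Real.cosh x - Real.cos (a - b)) ≤
      5 / 2 * (Real.cosh (n * x) - Real.cos (n * (a - b))) := by nlinarith
  have hX : 0 ≤ Real.cosh x - Real.cos (a - b) := by linarith
  have hY : 0 ≤ Real.cosh (n * x) - Real.cos (n * (a - b)) := by linarith
  calc (Real.cosh x - Real.cos (a - b)) * (Real.sin (n * a) * Real.sin (n * b))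
      ≤ (Real.cosh x - Real.cos (a - b)) * 1 := mul_le_mul_of_nonneg_left hsn hX
    _ = ((n : ℝ) ^ 2 * (Real.cosh x - Real.cos (a - b))) * (1 / n ^ 2) := by field_simp
    _ ≤ (5 / 2 * (Real.cosh (n * x) - Real.cos (n * (a - b)))) * (1 / n ^ 2) :=
        mul_le_mul_of_nonneg_right hnum (by positivity)
    _ = 5 / 8 * ((Real.cosh (n * x) - Real.cos (n * (a - b))) * ((2 / n) * (2 / n))) := by
        field_simp; ring
    _ ≤ _ := by
        refine mul_le_mul_of_nonneg_left (mul_le_mul_of_nonneg_left hden hY) (by norm_num)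

/-- On the upper half plane, `4 * sinh (d / 2) ^ 2` for the hyperbolic distance `d`. -/
def hypQ (z w : ℂ) : ℝ := ‖z - w‖ ^ 2 / (z.im * w.im)

lemma norm_sq_eq (z : ℂ) : ‖z‖ ^ 2 = z.re ^ 2 + z.im ^ 2 := by
  rw [Complex.sq_norm, Complex.normSq_apply]; ring

/-- In these coordinates the power map acts by multiplying the logarithmic modulus and the argument
by n. -/
lemma hypQ_eq_polar {z w : ℂ} (hz : 0 < z.im) (hw : 0 < w.im) :
    hypQ z w = 2 * (Real.cosh (Real.log ‖z‖ - Real.log ‖w‖) - Real.cos (z.arg - w.arg)) /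
      (Real.sin z.arg * Real.sin w.arg) := by
  have hz0 : z ≠ 0 := by rintro rfl; simp at hz
  have hw0 : w ≠ 0 := by rintro rfl; simp at hw
  have pz := norm_pos_iff.2 hz0
  have pw := norm_pos_iff.2 hw0
  have e : Real.cosh (Real.log ‖z‖ - Real.log ‖w‖) = (‖z‖ / ‖w‖ + ‖w‖ / ‖z‖) / 2 := by
    rw [Real.cosh_eq, Real.exp_sub, neg_sub, Real.exp_sub, Real.exp_log pz, Real.exp_log pw]
  rw [e, Real.cos_sub, Complex.cos_arg hz0, Complex.cos_arg hw0, Complex.sin_arg, Complex.sin_arg,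
    hypQ, norm_sq_eq, Complex.sub_re, Complex.sub_im]
  have nz := norm_sq_eq z
  have nw := norm_sq_eq w
  field_simp
  rw [nz, nw]
  ring

/-- This is Schwarz-Pick for the inverse of w + 1/w on a half plane. With p and q the moduli of 1/w
and 1/w', it reduces to (1 - p²)(1 - q²) ≤ (1 - pq)² ≤ |1 - 1/(ww')|². The sign hypothesis puts both
images on the same side of the real axis. -/
lemma hypQ_add_inv_le {w w' : ℂ} (hw : 0 < w.im) (hw' : 0 < w'.im)
    (h : 0 < (w + w⁻¹).im * (w' + w'⁻¹).im) : hypQ w w' ≤ hypQ (w + w⁻¹) (w' + w'⁻¹) := by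
  have h0 : w ≠ 0 := by rintro rfl; simp at hw
  have h0' : w' ≠ 0 := by rintro rfl; simp at hw'
  have him : ∀ u : ℂ, (u + u⁻¹).im = u.im * (1 - ‖u⁻¹‖ ^ 2) := by
    intro u
    rw [Complex.add_im, Complex.inv_im, norm_inv, inv_pow, Complex.sq_norm]
    ring
  have hdiff : w + w⁻¹ - (w' + w'⁻¹) = (w - w') * (1 - w⁻¹ * w'⁻¹) := by
    field_simp
    ring
  set p := ‖w⁻¹‖ with hp
  set q := ‖w'⁻¹‖ with hq
  have hT : (1 - p ^ 2) * (1 - q ^ 2) ≤ ‖1 - w⁻¹ * w'⁻¹‖ ^ 2 := by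
    have e1 : |1 - p * q| ≤ ‖1 - w⁻¹ * w'⁻¹‖ := by
      have := abs_norm_sub_norm_le (1 : ℂ) (w⁻¹ * w'⁻¹)
      rwa [norm_one, norm_mul] at this
    have e2 : (1 - p * q) ^ 2 ≤ ‖1 - w⁻¹ * w'⁻¹‖ ^ 2 := by
      rw [← sq_abs]
      exact pow_le_pow_left₀ (abs_nonneg _) e1 2
    nlinarith [sq_nonneg (p - q)]
  rw [him, him] at h
  have hS : 0 < (1 - p ^ 2) * (1 - q ^ 2) := by
    have : 0 < (w.im * w'.im) * ((1 - p ^ 2) * (1 - q ^ 2)) := by linarith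
    exact (mul_pos_iff_of_pos_left (mul_pos hw hw')).1 this
  rw [hypQ, hypQ, him, him, hdiff, norm_mul, mul_pow, div_le_div_iff₀ (mul_pos hw hw') h]
  have := mul_le_mul_of_nonneg_left hT
    (show 0 ≤ ‖w - w'‖ ^ 2 * (w.im * w'.im) by positivity)
  nlinarith

lemma hypQ_real_mul {t : ℝ} (ht : t ≠ 0) (z w : ℂ) : hypQ (t * z) (t * w) = hypQ z w := by
  rw [hypQ, hypQ, ← mul_sub, norm_mul, mul_pow, Complex.im_ofReal_mul, Complex.im_ofReal_mul,
    Complex.norm_real, Real.norm_eq_abs, sq_abs]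
  have : t * z.im * (t * w.im) = t ^ 2 * (z.im * w.im) := by ring
  rw [this, mul_div_mul_left _ _ (pow_ne_zero 2 ht)]

lemma arg_pow_eq {n : ℕ} (hn : 1 ≤ n) {ζ : ℂ} (h0 : 0 < ζ.arg) (h1 : ζ.arg < Real.pi / n) :
    (ζ ^ n).arg = n * ζ.arg := by
  have hζ : ζ ≠ 0 := by rintro rfl; simp at h0
  have hn0 : (0 : ℝ) < n := by exact_mod_cast hn
  rw [lt_div_iff₀ hn0] at h1
  rw [pow_polar, Complex.arg_real_mul _ (pow_pos (norm_pos_iff.2 hζ) n), Complex.arg_exp_mul_I,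
    (toIocMod_eq_self _).2 ⟨by nlinarith [Real.pi_pos], by nlinarith [Real.pi_pos]⟩]

/-- The contraction factor of the inverse branch with values in the sector of index `k`. -/
def contractionFactor (n k : ℕ) : ℝ := if k + 2 ≤ n then 5 / 8 else 1

lemma contractionFactor_pos (n k : ℕ) : 0 < contractionFactor n k := by
  unfold contractionFactor; split_ifs <;> norm_num

lemma contractionFactor_le_one (n k : ℕ) : contractionFactor n k ≤ 1 := by
  unfold contractionFactor; split_ifs <;> norm_num

/-- The power map identifies the sector with the upper half plane, and the sector lies in the upper
half plane, so its own hyperbolic metric is the larger one. The comparison is uniformly strict when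
the sector stays away from the real axis. -/
lemma hypQ_le_hypQ_pow {n : ℕ} (hn : 2 ≤ n) {lam : ℝ} (hlam : 0 < lam) {k : ℕ}
    (hk1 : 1 ≤ k) (hkn : k + 1 ≤ n) {z z' : ℂ} (hz : z ∈ openSector n lam k)
    (hz' : z' ∈ openSector n lam k) :
    hypQ z z' ≤ contractionFactor n k *
      hypQ ((z / critPt n lam k) ^ n) ((z' / critPt n lam k) ^ n) := by
  have hl0 : (lam : ℂ) ≠ 0 := by exact_mod_cast hlam.ne'
  have hck := critPt_ne_zero n hl0 k
  have hsub := openSector_subset_planeSector hn hl0 k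
  have z0 := ne_zero_of_mem_openSector hz
  have z0' := ne_zero_of_mem_openSector hz'
  have iz := im_pos_of_mem_openSector hn hlam hk1 hkn hz
  have iz' := im_pos_of_mem_openSector hn hlam hk1 hkn hz'
  have az := arg_eq_of_mem_planeSector hn hlam z0 hkn (hsub hz)
  have az' := arg_eq_of_mem_planeSector hn hlam z0' hkn (hsub hz')
  have iw := im_pow_div_critPt_pos (by omega) hz
  have iw' := im_pow_div_critPt_pos (by omega) hz'
  have aw := arg_pow_eq (by omega : 1 ≤ n) hz.1 hz.2
  have aw' := arg_pow_eq (by omega : 1 ≤ n) hz'.1 hz'.2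
  have hn0 : (0 : ℝ) < n := by positivity
  have a0 := hz.1
  have b0 := hz'.1
  have a1 : n * (z / critPt n lam k).arg < Real.pi := by
    have := hz.2
    rw [lt_div_iff₀ hn0] at this
    linarith
  have b1 : n * (z' / critPt n lam k).arg < Real.pi := by
    have := hz'.2
    rw [lt_div_iff₀ hn0] at this
    linarith
  have a2 := hz.2
  have b2 := hz'.2
  have hlog : Real.log ‖(z / critPt n lam k) ^ n‖ - Real.log ‖(z' / critPt n lam k) ^ n‖ =
      n * (Real.log ‖z‖ - Real.log ‖z'‖) := by
    rw [norm_pow, norm_pow, Real.log_pow, Real.log_pow, norm_div, norm_div,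
      Real.log_div (norm_ne_zero_iff.2 z0) (norm_ne_zero_iff.2 hck),
      Real.log_div (norm_ne_zero_iff.2 z0') (norm_ne_zero_iff.2 hck)]
    ring
  have sz : 0 < Real.sin z.arg := by rw [Complex.sin_arg]; exact div_pos iz (norm_pos_iff.2 z0)
  have sz' : 0 < Real.sin z'.arg := by
    rw [Complex.sin_arg]; exact div_pos iz' (norm_pos_iff.2 z0')
  rw [hypQ_eq_polar iz iz', hypQ_eq_polar iw iw', hlog, aw, aw', ← mul_sub]
  have hdiff : z.arg - z'.arg = (z / critPt n lam k).arg - (z' / critPt n lam k).arg := by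
    rw [az, az']; ring
  rw [hdiff]
  set a := (z / critPt n lam k).arg
  set b := (z' / critPt n lam k).arg
  set x := Real.log ‖z‖ - Real.log ‖z'‖
  have sna : 0 < Real.sin (n * a) := Real.sin_pos_of_pos_of_lt_pi (by positivity) a1
  have snb : 0 < Real.sin (n * b) := Real.sin_pos_of_pos_of_lt_pi (by positivity) b1
  rw [← mul_div_assoc, div_le_div_iff₀ (mul_pos sz sz') (mul_pos sna snb)]
  have key : (Real.cosh x - Real.cos (a - b)) * (Real.sin (n * a) * Real.sin (n * b)) ≤
      contractionFactor n k * ((Real.cosh (n * x) - Real.cos (n * (a - b))) *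
        (Real.sin z.arg * Real.sin z'.arg)) := by
    unfold contractionFactor
    split_ifs with hk2
    · have hkl : Real.pi / n ≤ k * Real.pi / n := by
        rw [div_le_div_iff_of_pos_right hn0]
        have : (1 : ℝ) ≤ k := by exact_mod_cast hk1
        nlinarith [Real.pi_pos]
      have hku : k * Real.pi / n + Real.pi / n ≤ Real.pi - Real.pi / n := by
        rw [le_sub_iff_add_le, ← add_div, ← add_div, div_le_iff₀ hn0]
        have : (k : ℝ) + 2 ≤ n := by exact_mod_cast hk2
        nlinarith [Real.pi_pos]
      exact cosh_sub_cos_mul_le_of_interior hn x a0 b0 a1 b1 (by rw [az]; linarith)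
        (by rw [az]; linarith) (by rw [az']; linarith) (by rw [az']; linarith)
    -- The last sector borders the negative axis; angles are measured from that axis to bring it
    -- into the position of `cosh_sub_cos_mul_le`.
    · have hk : (k : ℝ) = n - 1 := by
        have : k + 1 = n := by omega
        rw [← this]; push_cast; ring
      have hkk : k * Real.pi / n = Real.pi - Real.pi / n := by
        rw [hk]; field_simp
      have hflip : ∀ y : ℝ, Real.sin (n * (Real.pi / n - y)) = Real.sin (n * y) := by
        intro y
        rw [mul_sub, mul_div_cancel₀ _ hn0.ne', Real.sin_pi_sub]
      have h := cosh_sub_cos_mul_le (by omega : 1 ≤ n) x (a := Real.pi / n - a)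
        (b := Real.pi / n - b) (by linarith) (by linarith)
        (by rw [mul_sub, mul_div_cancel₀ _ hn0.ne']; nlinarith)
        (by rw [mul_sub, mul_div_cancel₀ _ hn0.ne']; nlinarith)
      rw [hflip, hflip, show Real.pi / n - a - (Real.pi / n - b) = -(a - b) by ring,
        Real.cos_neg, mul_neg, Real.cos_neg] at h
      have e1 : Real.sin z.arg = Real.sin (Real.pi / n - a) := by
        rw [az, hkk, ← Real.sin_pi_sub]; congr 1; ring
      have e2 : Real.sin z'.arg = Real.sin (Real.pi / n - b) := by
        rw [az', hkk, ← Real.sin_pi_sub]; congr 1; ring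
      rw [e1, e2, one_mul]
      exact h
  linarith

/-- The inverse branches of the McMullen map contract the hyperbolic metric. -/
lemma hypQ_le_hypQ_planeMap {n : ℕ} (hn : 2 ≤ n) {lam : ℝ} (hlam : 0 < lam) {k : ℕ}
    (hk1 : 1 ≤ k) (hkn : k + 1 ≤ n) {z z' : ℂ} (hz : z ∈ openSector n lam k)
    (hz' : z' ∈ openSector n lam k)
    (h : 0 < (planeMap n lam z).im * (planeMap n lam z').im) :
    hypQ z z' ≤ contractionFactor n k * hypQ (planeMap n lam z) (planeMap n lam z') := by
  have hl0 : (lam : ℂ) ≠ 0 := by exact_mod_cast hlam.ne'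
  refine (hypQ_le_hypQ_pow hn hlam hk1 hkn hz hz').trans
    (mul_le_mul_of_nonneg_left ?_ (contractionFactor_pos n k).le)
  have hp : ‖critPt n (lam : ℂ) 0‖ ^ n ≠ 0 :=
    pow_ne_zero _ (norm_ne_zero_iff.2 (critPt_ne_zero n hl0 0))
  have hd : (-1 : ℂ) ^ k * sqrtParam n lam =
      (((-1) ^ k * ‖critPt n (lam : ℂ) 0‖ ^ n : ℝ) : ℂ) := by
    rw [sqrtParam_ofReal hlam]; push_cast; ring
  have ht : ((-1) ^ k * ‖critPt n (lam : ℂ) 0‖ ^ n : ℝ) ≠ 0 :=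
    mul_ne_zero (pow_ne_zero _ (by norm_num)) hp
  rw [planeMap_eq_of_ne_zero (by omega) hl0 k (ne_zero_of_mem_openSector hz),
    planeMap_eq_of_ne_zero (by omega) hl0 k (ne_zero_of_mem_openSector hz'), hd] at h ⊢
  rw [hypQ_real_mul ht]
  refine hypQ_add_inv_le (im_pow_div_critPt_pos (by omega) hz)
    (im_pow_div_critPt_pos (by omega) hz') ?_
  rw [Complex.im_ofReal_mul, Complex.im_ofReal_mul, mul_mul_mul_comm] at h
  exact (mul_pos_iff_of_pos_left (mul_self_pos.2 ht)).1 h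

/-! ### A height function on the half rays -/

/-- A strictly increasing contraction from the line onto the positive half line. -/
def softplus (n : ℕ) (h : ℝ) : ℝ := Real.log (1 + Real.exp (h / n))

lemma softplus_pos (n : ℕ) (h : ℝ) : 0 < softplus n h :=
  Real.log_pos (by linarith [Real.exp_pos (h / n)])

lemma continuous_softplus (n : ℕ) : Continuous (softplus n) := by
  unfold softplus
  refine Continuous.log (by fun_prop) fun x => ?_
  have := Real.exp_pos (x / n)
  positivity

lemma softplus_strictMono {n : ℕ} (hn : 1 ≤ n) : StrictMono (softplus n) := by
  intro a b hab
  have hn0 : (0 : ℝ) < n := by exact_mod_cast hn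
  refine Real.log_lt_log (by positivity) ?_
  have := Real.exp_lt_exp.2 ((div_lt_div_iff_of_pos_right hn0).2 hab)
  linarith

lemma abs_softplus_sub_le {n : ℕ} (hn : 1 ≤ n) (a b : ℝ) :
    |softplus n a - softplus n b| ≤ |a - b| / n := by
  have hn0 : (0 : ℝ) < n := by exact_mod_cast hn
  wlog hab : b ≤ a generalizing a b
  · rw [abs_sub_comm, abs_sub_comm a]
    exact this b a (le_of_not_ge hab)
  have h1 : softplus n b ≤ softplus n a := (softplus_strictMono hn).monotone hab
  rw [abs_of_nonneg (by linarith), abs_of_nonneg (by linarith), sub_le_iff_le_add, softplus, softplus,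
    ← Real.log_exp ((a - b) / n), ← Real.log_mul (by positivity) (by positivity)]
  refine Real.log_le_log (by positivity) ?_
  have e1 : Real.exp (a / n) = Real.exp ((a - b) / n) * Real.exp (b / n) := by
    rw [← Real.exp_add]; congr 1; ring
  have e2 : 1 ≤ Real.exp ((a - b) / n) :=
    Real.one_le_exp (div_nonneg (by linarith) hn0.le)
  rw [e1]
  nlinarith

lemma le_softplus (n : ℕ) (h : ℝ) : h / n ≤ softplus n h := by
  rw [softplus, Real.le_log_iff_exp_le (by positivity)]
  linarith

lemma softplus_le (n : ℕ) (h : ℝ) : softplus n h ≤ max 0 (h / n) + Real.log 2 := by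
  rw [softplus, ← Real.log_exp (max 0 (h / n)), ← Real.log_mul (by positivity) (by positivity)]
  refine Real.log_le_log (by positivity) ?_
  have h1 : 1 ≤ Real.exp (max 0 (h / n)) := Real.one_le_exp (le_max_left _ _)
  have h2 : Real.exp (h / n) ≤ Real.exp (max 0 (h / n)) := Real.exp_le_exp.2 (le_max_right _ _)
  linarith

lemma softplus_le_exp (n : ℕ) (h : ℝ) : softplus n h ≤ Real.exp (h / n) := by
  have := Real.log_le_sub_one_of_pos (show 0 < 1 + Real.exp (h / n) by positivity)
  rw [softplus]
  linarith

/-- The map, with the sign for which the outer half of the sector of index `k` is mapped to the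
upper half plane. -/
def signedMap (n : ℕ) (lam : ℝ) (k : ℕ) (z : ℂ) : ℂ := (-1) ^ k * planeMap n lam z

/-- The logarithmic modulus, normalized to vanish on the circle through the critical points. -/
def logMod (n : ℕ) (lam : ℝ) (z : ℂ) : ℝ := Real.log ‖z‖ - Real.log ‖critPt n (lam : ℂ) 0‖

/-- The pull back of a height function on the upper half plane under the signed map. -/
def foldHeight (n : ℕ) (lam : ℝ) (k : ℕ) (H : ℂ → ℝ) (z : ℂ) : ℝ :=
  if 0 < (signedMap n lam k z).im then softplus n (H (signedMap n lam k z))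
  else if (signedMap n lam k z).im < 0 then -softplus n (H (-signedMap n lam k z))
  else 0

section Real

variable {n : ℕ} {lam : ℝ}

lemma critPt_zero_norm_pos (n : ℕ) (hlam : 0 < lam) : 0 < ‖critPt n (lam : ℂ) 0‖ :=
  norm_pos_iff.2 (critPt_ne_zero n (by exact_mod_cast hlam.ne') 0)

lemma norm_critPt (n : ℕ) (μ : ℂ) (k : ℕ) : ‖critPt n μ k‖ = ‖critPt n μ 0‖ := by
  rw [critPt_eq, norm_mul, Complex.norm_exp_ofReal_mul_I, mul_one]

lemma signedMap_eq (hn : 1 ≤ n) (hlam : 0 < lam) {k : ℕ} {z : ℂ} (hz : z ≠ 0) :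
    signedMap n lam k z = ((‖critPt n (lam : ℂ) 0‖ ^ n : ℝ) : ℂ) *
      ((z / critPt n lam k) ^ n + ((z / critPt n lam k) ^ n)⁻¹) := by
  have hl0 : (lam : ℂ) ≠ 0 := by exact_mod_cast hlam.ne'
  rw [signedMap, planeMap_eq_of_ne_zero hn hl0 k hz, sqrtParam_ofReal hlam, ← mul_assoc,
    ← mul_assoc, ← mul_pow]
  simp

lemma logMod_eq (hlam : 0 < lam) (k : ℕ) {z : ℂ} (hz : z ≠ 0) :
    n * logMod n lam z = Real.log ‖(z / critPt n lam k) ^ n‖ := by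
  rw [norm_pow, Real.log_pow, norm_div, norm_critPt,
    Real.log_div (norm_ne_zero_iff.2 hz) (critPt_zero_norm_pos n hlam).ne', logMod]

lemma signedMap_im (hn : 1 ≤ n) (hlam : 0 < lam) {k : ℕ} {z : ℂ} (hz : z ≠ 0) :
    (signedMap n lam k z).im = ‖critPt n (lam : ℂ) 0‖ ^ n * (((z / critPt n lam k) ^ n).im *
      (1 - (‖(z / critPt n lam k) ^ n‖ ^ 2)⁻¹)) := by
  rw [signedMap_eq hn hlam hz, Complex.im_ofReal_mul, Complex.add_im, Complex.inv_im,
    Complex.sq_norm]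
  ring

/-- For w in the upper half plane, the imaginary part of w + 1/w has the sign of |w| - 1. Hence the
cases of `foldHeight` separate the outer and inner parts of the sector at the critical circle. -/
lemma signedMap_im_pos_iff (hn : 1 ≤ n) (hlam : 0 < lam) {k : ℕ} {z : ℂ}
    (hz : z ∈ openSector n lam k) :
    (0 < (signedMap n lam k z).im ↔ 0 < logMod n lam z) ∧
      ((signedMap n lam k z).im < 0 ↔ logMod n lam z < 0) := by
  have hz0 := ne_zero_of_mem_openSector hz
  have hl0 : (lam : ℂ) ≠ 0 := by exact_mod_cast hlam.ne'
  have hn0 : (0 : ℝ) < n := by exact_mod_cast hn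
  have hc := critPt_zero_norm_pos n hlam
  have hw := im_pow_div_critPt_pos hn hz
  have hw0 : (z / critPt n lam k) ^ n ≠ 0 :=
    pow_ne_zero _ (div_ne_zero hz0 (critPt_ne_zero n hl0 k))
  have e := logMod_eq (n := n) hlam k hz0
  rw [signedMap_im hn hlam hz0]
  set w := (z / critPt n lam k) ^ n
  have hp : 0 < ‖w‖ := norm_pos_iff.2 hw0
  have hcn : 0 < ‖critPt n (lam : ℂ) 0‖ ^ n := pow_pos hc n
  have hinv : 0 < (‖w‖ ^ 2)⁻¹ := by positivity
  constructor
  · rw [mul_pos_iff_of_pos_left hcn, mul_pos_iff_of_pos_left hw, sub_pos,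
      inv_lt_one₀ (by positivity), one_lt_sq_iff₀ hp.le, ← Real.log_pos_iff hp.le, ← e,
      mul_pos_iff_of_pos_left hn0]
  · have mneg : ∀ {a b : ℝ}, 0 < a → (a * b < 0 ↔ b < 0) := fun ha => by
      rw [← neg_pos, ← mul_neg, mul_pos_iff_of_pos_left ha, neg_pos]
    rw [mneg hcn, mneg hw, sub_neg,
      one_lt_inv₀ (by positivity), sq_lt_one_iff₀ hp.le, ← Real.log_neg_iff hp, ← e,
      mneg hn0]

/-- By the symmetry w ↔ 1/w one may take |w| ≥ 1, where the second term has modulus at most 1. The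
lower bound needs |w| ≥ 2, since near the unit circle the terms may cancel. -/
lemma abs_log_norm_add_inv_le {w : ℂ} (hw : w ≠ 0) (hv : w + w⁻¹ ≠ 0) :
    Real.log ‖w + w⁻¹‖ ≤ |Real.log ‖w‖| + Real.log 2 ∧
      (Real.log 2 ≤ |Real.log ‖w‖| → |Real.log ‖w‖| - Real.log 2 ≤ Real.log ‖w + w⁻¹‖) := by
  have key : ∀ w : ℂ, w ≠ 0 → w + w⁻¹ ≠ 0 → 1 ≤ ‖w‖ →
      Real.log ‖w + w⁻¹‖ ≤ Real.log ‖w‖ + Real.log 2 ∧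
      (Real.log 2 ≤ Real.log ‖w‖ → Real.log ‖w‖ - Real.log 2 ≤ Real.log ‖w + w⁻¹‖) := by
    intro w hw hv h1
    have hp : 0 < ‖w‖ := norm_pos_iff.2 hw
    have hi : ‖w⁻¹‖ ≤ 1 := by rw [norm_inv]; exact inv_le_one_of_one_le₀ h1
    constructor
    · rw [← Real.log_mul hp.ne' two_ne_zero]
      refine Real.log_le_log (norm_pos_iff.2 hv) ?_
      have := norm_add_le w w⁻¹
      linarith
    · intro h
      have h2 : 2 ≤ ‖w‖ := (Real.log_le_log_iff two_pos hp).1 h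
      rw [← Real.log_div hp.ne' two_ne_zero]
      refine Real.log_le_log (by positivity) ?_
      have := norm_sub_norm_le w (-w⁻¹)
      rw [norm_neg, sub_neg_eq_add] at this
      linarith
  have hp : 0 < ‖w‖ := norm_pos_iff.2 hw
  rcases le_or_gt 1 ‖w‖ with h | h
  · rw [abs_of_nonneg (Real.log_nonneg h)]
    exact key w hw hv h
  · have := key w⁻¹ (inv_ne_zero hw) (by rwa [inv_inv, add_comm])
      (by rw [norm_inv]; exact (one_le_inv₀ hp).2 h.le)
    rw [inv_inv, add_comm w⁻¹, norm_inv, Real.log_inv] at this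
    rwa [abs_of_neg (Real.log_neg hp h)]

/-- The pull back of the logarithmic modulus is at bounded distance from the logarithmic
modulus. -/
lemma exists_foldHeight_logMod_bound (hn : 1 ≤ n) (hlam : 0 < lam) :
    ∃ C : ℝ, 0 ≤ C ∧ ∀ k, ∀ z ∈ openSector n lam k,
      |foldHeight n lam k (logMod n lam) z - logMod n lam z| ≤ C := by
  set c := ‖critPt n (lam : ℂ) 0‖ with hc
  have hc0 : 0 < c := critPt_zero_norm_pos n hlam
  have hn1 : (1 : ℝ) ≤ n := by exact_mod_cast hn
  -- The first term comes from normalizing the modulus of the image; one log 2 comes from w + 1/w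
  -- and the other from softplus.
  set K := |Real.log (c ^ n) - Real.log c| + 2 * Real.log 2 with hK
  have hl2 : 0 < Real.log 2 := Real.log_pos one_lt_two
  have hK0 : 0 ≤ K := by positivity
  have key : ∀ k, ∀ z ∈ openSector n lam k, signedMap n lam k z ≠ 0 →
      |softplus n (logMod n lam (signedMap n lam k z)) - (|logMod n lam z|)| ≤ K := by
    intro k z hz hv
    have hl0 : (lam : ℂ) ≠ 0 := by exact_mod_cast hlam.ne'
    have hz0 := ne_zero_of_mem_openSector hz
    have hw0 : (z / critPt n lam k) ^ n ≠ 0 :=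
      pow_ne_zero _ (div_ne_zero hz0 (critPt_ne_zero n hl0 k))
    have e := logMod_eq (n := n) hlam k hz0
    have hG := signedMap_eq (n := n) hn hlam (k := k) hz0
    set w := (z / critPt n lam k) ^ n
    have hv' : w + w⁻¹ ≠ 0 := by
      intro h0; rw [hG, h0, mul_zero] at hv; exact hv rfl
    obtain ⟨h1, h2⟩ := abs_log_norm_add_inv_le hw0 hv'
    have hlog : logMod n lam (signedMap n lam k z) =
        (Real.log (c ^ n) - Real.log c) + Real.log ‖w + w⁻¹‖ := by
      rw [logMod, hG, norm_mul, Complex.norm_real, Real.norm_of_nonneg (by positivity),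
        Real.log_mul (by positivity) (norm_ne_zero_iff.2 hv')]
      ring
    rw [← e, abs_mul, Nat.abs_cast] at h1 h2
    set L := |logMod n lam z| with hL
    have hL0 : 0 ≤ L := abs_nonneg _
    rw [hlog]
    set a := Real.log (c ^ n) - Real.log c
    set b := Real.log ‖w + w⁻¹‖
    have ha1 := le_abs_self a
    have ha2 := neg_abs_le a
    have ha0 := abs_nonneg a
    have hdiv : ∀ y : ℝ, 0 ≤ y → y / n ≤ y := fun y hy => div_le_self hy hn1
    rw [abs_le]
    constructor
    · rcases le_or_gt (Real.log 2) (n * L) with h | h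
      · have h3 := h2 h
        have h4 := le_softplus n (a + b)
        have h5 : (n * L - (|a| + Real.log 2)) / n ≤ (a + b) / n :=
          (div_le_div_iff_of_pos_right (by linarith)).2 (by linarith)
        rw [sub_div, mul_div_cancel_left₀ _ (by linarith : (n : ℝ) ≠ 0)] at h5
        have h6 := hdiv (|a| + Real.log 2) (by positivity)
        linarith
      · have h3 := softplus_pos n (a + b)
        have h4 : L ≤ n * L := le_mul_of_one_le_left hL0 hn1
        linarith
    · have h4 := softplus_le n (a + b)
      have h5 : (a + b) / n ≤ (n * L + (|a| + Real.log 2)) / n :=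
        (div_le_div_iff_of_pos_right (by linarith)).2 (by linarith)
      rw [add_div (n * L), mul_div_cancel_left₀ _ (by linarith : (n : ℝ) ≠ 0)] at h5
      have h6 := hdiv (|a| + Real.log 2) (by positivity)
      have h7 : max 0 ((a + b) / n) ≤ L + (|a| + Real.log 2) :=
        max_le (by positivity) (by linarith)
      linarith
  refine ⟨K, hK0, fun k z hz => ?_⟩
  obtain ⟨hpos, hneg⟩ := signedMap_im_pos_iff hn hlam hz
  rw [foldHeight]
  split_ifs with h1 h2
  · have := key k z hz (by intro h; rw [h] at h1; simp at h1)
    rwa [abs_of_pos (hpos.1 h1)] at this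
  · have := key k z hz (by intro h; rw [h] at h2; simp at h2)
    have e : logMod n lam (-signedMap n lam k z) = logMod n lam (signedMap n lam k z) := by
      rw [logMod, logMod, norm_neg]
    rw [abs_of_neg (hneg.1 h2)] at this
    rw [e, ← abs_neg]
    convert this using 2
    ring
  · have e : logMod n lam z = 0 := by
      have a1 := mt hpos.2 h1
      have a2 := mt hneg.2 h2
      linarith
    rw [e]
    simpa using hK0

/-- The half rays lie in the open upper half plane, so the half plane of the signed image decides
which alternative of the recursion holds. -/
lemma signedMap_mem {k : ℕ → ℕ} (hn : 2 ≤ n) (hlam : 0 < lam) (hk : IsAdmissible n k) {z : ℂ}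
    (hz : z ∈ halfRay n lam k) :
    (0 < (signedMap n lam (k 0) z).im ∧ signedMap n lam (k 0) z ∈ halfRay n lam (shift k)) ∨
      signedMap n lam (k 0) z = 0 ∨
      ((signedMap n lam (k 0) z).im < 0 ∧ -signedMap n lam (k 0) z ∈ halfRay n lam (shift k)) := by
  have him : ∀ v ∈ halfRay n lam (shift k), 0 < v.im := fun v hv =>
    im_pos_of_mem_openSector hn hlam (hk.shift.one_le 0) (hk.shift.succ_le 0)
      (halfRay_subset_openSector hn hlam hk.shift hv)
  have h : signedMap n lam (k 0) z ∈ halfRay n lam (shift k) ∨ signedMap n lam (k 0) z = 0 ∨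
      -signedMap n lam (k 0) z ∈ halfRay n lam (shift k) := by
    have h1 := (mem_halfRay_iff.1 hz).2.2
    rw [signedMap]
    rcases neg_one_pow_eq_or ℂ (k 0) with e | e
    · rwa [e, one_mul]
    · rw [e, neg_one_mul, neg_neg, neg_eq_zero]
      tauto
  rcases h with h | h | h
  · exact Or.inl ⟨him _ h, h⟩
  · exact Or.inr (Or.inl h)
  · have := him _ h
    rw [Complex.neg_im] at this
    exact Or.inr (Or.inr ⟨by linarith, h⟩)

/-- Both heights are folded along the same case, and softplus has Lipschitz constant 1/n ≤ 1/2. This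
halving makes the height iteration converge uniformly. -/
lemma abs_foldHeight_sub_le {k : ℕ → ℕ} (hn : 2 ≤ n) (hlam : 0 < lam) (hk : IsAdmissible n k)
    {H₁ H₂ : ℂ → ℝ} {δ : ℝ} (hδ : 0 ≤ δ)
    (h : ∀ v ∈ halfRay n lam (shift k), |H₁ v - H₂ v| ≤ δ) {z : ℂ} (hz : z ∈ halfRay n lam k) :
    |foldHeight n lam (k 0) H₁ z - foldHeight n lam (k 0) H₂ z| ≤ δ / 2 := by
  have hn2 : (2 : ℝ) ≤ n := by exact_mod_cast hn
  have hle : ∀ v ∈ halfRay n lam (shift k), |softplus n (H₁ v) - softplus n (H₂ v)| ≤ δ / 2 :=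
    fun v hv => (abs_softplus_sub_le (by omega) _ _).trans
      (div_le_div₀ hδ (h v hv) two_pos hn2)
  rw [foldHeight, foldHeight]
  rcases signedMap_mem hn hlam hk hz with ⟨h1, h2⟩ | h1 | ⟨h1, h2⟩
  · rw [if_pos h1, if_pos h1]
    exact hle _ h2
  · simp [h1]
    positivity
  · rw [if_neg h1.not_gt, if_pos h1, if_neg h1.not_gt, if_pos h1, ← abs_neg]
    convert hle _ h2 using 2
    ring

/-- Successive approximations of the height. -/
def approxHeight (n : ℕ) (lam : ℝ) : ℕ → (ℕ → ℕ) → ℂ → ℝ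
  | 0, _ => logMod n lam
  | m + 1, k => foldHeight n lam (k 0) (approxHeight n lam m (shift k))

/-- The bound 2 * C is preserved because half of it plus the initial error C is again 2 * C. -/
lemma abs_approxHeight_sub_logMod_le (hn : 2 ≤ n) (hlam : 0 < lam) {C : ℝ} (hC : 0 ≤ C)
    (hb : ∀ k, ∀ z ∈ openSector n lam k,
      |foldHeight n lam k (logMod n lam) z - logMod n lam z| ≤ C)
    (m : ℕ) {k : ℕ → ℕ} (hk : IsAdmissible n k) {z : ℂ} (hz : z ∈ halfRay n lam k) :
    |approxHeight n lam m k z - logMod n lam z| ≤ 2 * C := by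
  induction m generalizing k z with
  | zero => simp [approxHeight, hC]
  | succ m ih =>
    have h1 := abs_foldHeight_sub_le hn hlam hk (by positivity)
      (fun v hv => ih hk.shift hv) hz
    have h2 := hb (k 0) z (halfRay_subset_openSector hn hlam hk hz)
    have h3 := abs_sub_le (foldHeight n lam (k 0) (approxHeight n lam m (shift k)) z)
      (foldHeight n lam (k 0) (logMod n lam) z) (logMod n lam z)
    rw [approxHeight]
    linarith

lemma abs_approxHeight_succ_sub_le (hn : 2 ≤ n) (hlam : 0 < lam) {C : ℝ} (hC : 0 ≤ C)
    (hb : ∀ k, ∀ z ∈ openSector n lam k,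
      |foldHeight n lam k (logMod n lam) z - logMod n lam z| ≤ C)
    (m : ℕ) {k : ℕ → ℕ} (hk : IsAdmissible n k) {z : ℂ} (hz : z ∈ halfRay n lam k) :
    |approxHeight n lam (m + 1) k z - approxHeight n lam m k z| ≤ C * (1 / 2) ^ m := by
  induction m generalizing k z with
  | zero =>
    rw [pow_zero, mul_one]
    exact hb (k 0) z (halfRay_subset_openSector hn hlam hk hz)
  | succ m ih =>
    have h1 := abs_foldHeight_sub_le hn hlam hk (by positivity)
      (fun v hv => ih hk.shift hv) hz
    refine h1.trans (le_of_eq ?_)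
    rw [pow_succ]
    ring

/-- The height on the half ray: the limit of the successive approximations. -/
def height (n : ℕ) (lam : ℝ) (k : ℕ → ℕ) (z : ℂ) : ℝ :=
  limUnder atTop fun m => approxHeight n lam m k z

/-- The properties of the height that are used below. -/
lemma exists_height_bound (hn : 2 ≤ n) (hlam : 0 < lam) :
    ∃ C : ℝ, 0 ≤ C ∧ ∀ k, IsAdmissible n k → ∀ z ∈ halfRay n lam k,
      (∀ m, |approxHeight n lam m k z - logMod n lam z| ≤ C) ∧
      (∀ m, |approxHeight n lam m k z - height n lam k z| ≤ C * (1 / 2) ^ m) ∧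
      |height n lam k z - logMod n lam z| ≤ C := by
  obtain ⟨C, hC, hb⟩ := exists_foldHeight_logMod_bound (n := n) (by omega) hlam
  refine ⟨2 * C, by positivity, fun k hk z hz => ?_⟩
  have hd : ∀ m, dist (approxHeight n lam m k z) (approxHeight n lam (m + 1) k z) ≤
      C * (1 / 2) ^ m := fun m => by
    rw [Real.dist_eq, abs_sub_comm]
    exact abs_approxHeight_succ_sub_le hn hlam hC hb m hk hz
  have ht : Tendsto (fun m => approxHeight n lam m k z) atTop (𝓝 (height n lam k z)) :=
    (cauchySeq_of_le_geometric _ _ (by norm_num) hd).tendsto_limUnder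
  refine ⟨fun m => abs_approxHeight_sub_logMod_le hn hlam hC hb m hk hz, fun m => ?_, ?_⟩
  · have := dist_le_of_le_geometric_of_tendsto (1 / 2) C (by norm_num) hd ht m
    rw [Real.dist_eq] at this
    refine this.trans (le_of_eq ?_)
    ring
  · refine le_of_tendsto ((ht.sub_const (logMod n lam z)).abs) (Eventually.of_forall fun m => ?_)
    exact abs_approxHeight_sub_logMod_le hn hlam hC hb m hk hz

lemma tendsto_const_mul_half_pow (C : ℝ) : Tendsto (fun m : ℕ => C * (1 / 2 : ℝ) ^ m) atTop (𝓝 0) := by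
  simpa using (tendsto_pow_atTop_nhds_zero_of_lt_one (r := (1 / 2 : ℝ)) (by norm_num)
    (by norm_num)).const_mul C

lemma height_eq_foldHeight (hn : 2 ≤ n) (hlam : 0 < lam) {k : ℕ → ℕ} (hk : IsAdmissible n k)
    {z : ℂ} (hz : z ∈ halfRay n lam k) :
    height n lam k z = foldHeight n lam (k 0) (height n lam (shift k)) z := by
  obtain ⟨C, hC, hb⟩ := exists_height_bound hn hlam
  have h1 : ∀ m : ℕ, |height n lam k z - foldHeight n lam (k 0) (height n lam (shift k)) z| ≤
      (C + C) * (1 / 2) ^ m := by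
    intro m
    have a1 := (hb k hk z hz).2.1 (m + 1)
    have a2 := abs_foldHeight_sub_le hn hlam hk (by positivity)
      (fun v hv => (hb _ hk.shift v hv).2.1 m) hz
    have a3 := abs_sub_le (height n lam k z) (approxHeight n lam (m + 1) k z)
      (foldHeight n lam (k 0) (height n lam (shift k)) z)
    rw [abs_sub_comm] at a1
    rw [approxHeight] at a1 a3
    rw [pow_succ] at a1
    have a4 : 0 ≤ C * (1 / 2) ^ m := by positivity
    linarith
  have h2 : |height n lam k z - foldHeight n lam (k 0) (height n lam (shift k)) z| ≤ 0 :=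
    ge_of_tendsto' (tendsto_const_mul_half_pow (C + C)) h1
  exact sub_eq_zero.1 (abs_eq_zero.1 (le_antisymm h2 (abs_nonneg _)))

lemma continuousAt_signedMap {k : ℕ} {z : ℂ} (hz : z ≠ 0) : ContinuousAt (signedMap n lam k) z := by
  unfold signedMap planeMap
  have := pow_ne_zero n hz
  fun_prop (disch := assumption)

/-- The only delicate points are those mapped to 0: there the height of the image tends to -∞ with
its logarithmic modulus, so softplus tends to 0 and the two signed cases match. A power of the
modulus dominates both. -/
lemma continuousOn_foldHeight (hn : 2 ≤ n) (hlam : 0 < lam) {k : ℕ → ℕ} (hk : IsAdmissible n k)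
    {H : ℂ → ℝ} {C : ℝ} (hH : ContinuousOn H (halfRay n lam (shift k)))
    (hb : ∀ v ∈ halfRay n lam (shift k), |H v - logMod n lam v| ≤ C) :
    ContinuousOn (foldHeight n lam (k 0) H) (halfRay n lam k) := by
  intro z hz
  have hn0 : (0 : ℝ) < n := by positivity
  have hG : Tendsto (signedMap n lam (k 0)) (𝓝[halfRay n lam k] z)
      (𝓝 (signedMap n lam (k 0) z)) := (continuousAt_signedMap hz.1).continuousWithinAt
  have him : Tendsto (fun y => (signedMap n lam (k 0) y).im) (𝓝[halfRay n lam k] z)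
      (𝓝 (signedMap n lam (k 0) z).im) := (Complex.continuous_im.tendsto _).comp hG
  rw [ContinuousWithinAt]
  rcases signedMap_mem hn hlam hk hz with ⟨h1, h2⟩ | h1 | ⟨h1, h2⟩
  · have hval : foldHeight n lam (k 0) H z = softplus n (H (signedMap n lam (k 0) z)) := if_pos h1
    rw [hval]
    have hev := him.eventually_const_lt h1
    have hG' : Tendsto (signedMap n lam (k 0)) (𝓝[halfRay n lam k] z)
        (𝓝[halfRay n lam (shift k)] (signedMap n lam (k 0) z)) := by
      refine tendsto_nhdsWithin_iff.2 ⟨hG, ?_⟩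
      filter_upwards [hev, self_mem_nhdsWithin] with y hy hyE
      rcases signedMap_mem hn hlam hk hyE with ⟨-, h⟩ | h | ⟨h, -⟩
      · exact h
      · rw [h] at hy; simp at hy
      · linarith
    refine Tendsto.congr' ?_ (((continuous_softplus n).tendsto _).comp ((hH _ h2).tendsto.comp hG'))
    filter_upwards [hev] with y hy
    exact (if_pos hy).symm
  · have hval : foldHeight n lam (k 0) H z = 0 := by simp [foldHeight, h1]
    rw [hval]
    have hsmall : ∀ v : ℂ, v ∈ halfRay n lam (shift k) →
        softplus n (H v) ≤ Real.exp ((logMod n lam v + C) / n) := fun v hv => by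
      refine (softplus_le_exp n _).trans (Real.exp_le_exp.2 ?_)
      have := (abs_le.1 (hb v hv)).2
      exact (div_le_div_iff_of_pos_right hn0).2 (by linarith)
    have hc := critPt_zero_norm_pos n hlam
    have hexp : ∀ v : ℂ, v ≠ 0 → Real.exp ((logMod n lam v + C) / n) =
        (‖v‖ / ‖critPt n (lam : ℂ) 0‖ * Real.exp C) ^ (1 / n : ℝ) := by
      intro v hv
      have hv' := norm_pos_iff.2 hv
      rw [Real.rpow_def_of_pos (by positivity), Real.log_mul (by positivity) (by positivity),
        Real.log_exp, Real.log_div hv'.ne' hc.ne', logMod, mul_one_div]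
    have hlim : Tendsto (fun y => (‖signedMap n lam (k 0) y‖ / ‖critPt n (lam : ℂ) 0‖ *
        Real.exp C) ^ (1 / n : ℝ)) (𝓝[halfRay n lam k] z) (𝓝 0) := by
      have h3 : Tendsto (fun y => ‖signedMap n lam (k 0) y‖ / ‖critPt n (lam : ℂ) 0‖ *
          Real.exp C) (𝓝[halfRay n lam k] z) (𝓝 0) := by
        have := ((hG.norm).div_const ‖critPt n (lam : ℂ) 0‖).mul_const (Real.exp C)
        rwa [h1, norm_zero, zero_div, zero_mul] at this
      have h4 := h3.rpow_const (p := (1 / n : ℝ)) (Or.inr (by positivity))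
      rwa [Real.zero_rpow (by positivity)] at h4
    refine squeeze_zero_norm' ?_ hlim
    filter_upwards [self_mem_nhdsWithin] with y hyE
    have hne : ∀ v ∈ halfRay n lam (shift k), v ≠ 0 := fun v hv => hv.1
    rw [foldHeight, Real.norm_eq_abs]
    rcases signedMap_mem hn hlam hk hyE with ⟨a1, a2⟩ | a1 | ⟨a1, a2⟩
    · rw [if_pos a1, abs_of_pos (softplus_pos _ _), ← hexp _ (hne _ a2)]
      exact hsmall _ a2
    · simp only [a1, Complex.zero_im, lt_irrefl, if_false, abs_zero]
      positivity
    · rw [if_neg a1.not_gt, if_pos a1, abs_neg, abs_of_pos (softplus_pos _ _),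
        ← norm_neg (signedMap n lam (k 0) y), ← hexp _ (hne _ a2)]
      exact hsmall _ a2
  · have hval : foldHeight n lam (k 0) H z = -softplus n (H (-signedMap n lam (k 0) z)) := by
      rw [foldHeight, if_neg h1.not_gt, if_pos h1]
    rw [hval]
    have hev := him.eventually_lt_const h1
    have hG' : Tendsto (fun y => -signedMap n lam (k 0) y) (𝓝[halfRay n lam k] z)
        (𝓝[halfRay n lam (shift k)] (-signedMap n lam (k 0) z)) := by
      refine tendsto_nhdsWithin_iff.2 ⟨hG.neg, ?_⟩
      filter_upwards [hev, self_mem_nhdsWithin] with y hy hyE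
      rcases signedMap_mem hn hlam hk hyE with ⟨h, -⟩ | h | ⟨-, h⟩
      · linarith
      · rw [h] at hy; simp at hy
      · exact h
    refine Tendsto.congr' ?_
      (((continuous_softplus n).tendsto _).comp ((hH _ h2).tendsto.comp hG')).neg
    filter_upwards [hev] with y hy
    rw [foldHeight, if_neg hy.not_gt, if_pos hy]
    rfl

lemma continuousOn_approxHeight (hn : 2 ≤ n) (hlam : 0 < lam) (m : ℕ) {k : ℕ → ℕ}
    (hk : IsAdmissible n k) : ContinuousOn (approxHeight n lam m k) (halfRay n lam k) := by
  obtain ⟨C, hC, hb⟩ := exists_height_bound hn hlam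
  induction m generalizing k with
  | zero =>
    intro z hz
    have : ‖z‖ ≠ 0 := norm_ne_zero_iff.2 hz.1
    exact ((continuous_norm.continuousAt.log this).sub continuousAt_const).continuousWithinAt
  | succ m ih =>
    exact continuousOn_foldHeight hn hlam hk (ih hk.shift)
      (fun v hv => (hb _ hk.shift v hv).1 m)

lemma continuousOn_height (hn : 2 ≤ n) (hlam : 0 < lam) {k : ℕ → ℕ} (hk : IsAdmissible n k) :
    ContinuousOn (height n lam k) (halfRay n lam k) := by
  obtain ⟨C, hC, hb⟩ := exists_height_bound hn hlam
  have hu : TendstoUniformlyOn (fun m => approxHeight n lam m k) (height n lam k) atTop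
      (halfRay n lam k) := by
    rw [Metric.tendstoUniformlyOn_iff]
    intro ε hε
    filter_upwards [(tendsto_const_mul_half_pow C).eventually_lt_const hε] with m hm z hz
    rw [Real.dist_eq, abs_sub_comm]
    exact ((hb k hk z hz).2.1 m).trans_lt hm
  exact hu.continuousOn (Frequently.of_forall fun m => continuousOn_approxHeight hn hlam m hk)

end Real

/-! ### Half rays are arcs -/

section Real

variable {n : ℕ} {lam : ℝ}

lemma im_pos_of_mem_halfRay (hn : 2 ≤ n) (hlam : 0 < lam) {k : ℕ → ℕ} (hk : IsAdmissible n k)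
    {z : ℂ} (hz : z ∈ halfRay n lam k) : 0 < z.im :=
  im_pos_of_mem_openSector hn hlam (hk.one_le 0) (hk.succ_le 0)
    (halfRay_subset_openSector hn hlam hk hz)

lemma eq_of_hypQ_nonpos {z w : ℂ} (hz : 0 < z.im) (hw : 0 < w.im) (h : hypQ z w ≤ 0) : z = w := by
  rw [hypQ] at h
  have h1 : 0 < z.im * w.im := mul_pos hz hw
  rw [div_nonpos_iff] at h
  have h2 : ‖z - w‖ ^ 2 ≤ 0 := by
    rcases h with h | h
    · linarith [h.2]
    · exact h.1
  have h3 : ‖z - w‖ = 0 := by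
    have := sq_nonneg ‖z - w‖
    exact pow_eq_zero_iff (two_ne_zero) |>.1 (le_antisymm h2 this)
  exact sub_eq_zero.1 (norm_eq_zero.1 h3)

/-- If a property of pairs of points, which propagates forward, bounds the distance at the times
when the inverse branches contract uniformly, then it holds only on the diagonal. -/
lemma hypQ_nonpos_of_expanding {P : (ℕ → ℕ) → ℂ → ℂ → Prop} {B : ℝ}
    (hadm : ∀ k z w, P k z w → IsAdmissible n k)
    (step : ∀ k z w, P k z w → ∃ z' w', P (shift k) z' w' ∧
      hypQ z w ≤ contractionFactor n (k 0) * hypQ z' w')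
    (bound : ∀ k z w, P k z w → k 0 + 2 ≤ n → hypQ z w ≤ B) (hB : 0 ≤ B)
    {k : ℕ → ℕ} {z w : ℂ} (h : P k z w) : hypQ z w ≤ 0 := by
  -- A bound at times of uniform contraction carries back to every earlier time, because all factors
  -- are at most 1. Such a time exists by admissibility, and each further one gains a factor 5/8.
  have advance : ∀ b : ℝ, 0 ≤ b →
      (∀ k z w, P k z w → k 0 + 2 ≤ n → hypQ z w ≤ b) →
      ∀ k z w, P k z w → hypQ z w ≤ b := by
    intro b hb hbd k z w hP
    obtain ⟨i, -, hi⟩ := (hadm k z w hP).frequently 0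
    induction i generalizing k z w with
    | zero => exact hbd k z w hP hi
    | succ i ih =>
      obtain ⟨z', w', h1, h2⟩ := step k z w hP
      have h3 := ih (shift k) z' w' h1 hi
      have h4 := contractionFactor_pos n (k 0)
      have h5 := contractionFactor_le_one n (k 0)
      nlinarith
  have key : ∀ N : ℕ, ∀ k z w, P k z w → hypQ z w ≤ (5 / 8) ^ N * B := by
    intro N
    induction N with
    | zero => rw [pow_zero, one_mul]; exact advance B hB bound
    | succ N ih =>
      refine advance _ (by positivity) fun k z w hP hk => ?_
      obtain ⟨z', w', h1, h2⟩ := step k z w hP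
      have h3 := ih (shift k) z' w' h1
      rw [contractionFactor, if_pos hk] at h2
      rw [pow_succ]
      linarith
  have hlim : Tendsto (fun N : ℕ => (5 / 8 : ℝ) ^ N * B) atTop (𝓝 0) := by
    simpa using (tendsto_pow_atTop_nhds_zero_of_lt_one (r := (5 / 8 : ℝ)) (by norm_num)
      (by norm_num)).mul_const B
  exact ge_of_tendsto' hlim fun N => key N k z w h

lemma two_div_le_sin_arg (hn : 2 ≤ n) (hlam : 0 < lam) {k : ℕ} (hk1 : 1 ≤ k) (hkn : k + 2 ≤ n)
    {z : ℂ} (hz : z ∈ openSector n lam k) : 2 / n ≤ Real.sin z.arg := by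
  have hl0 : (lam : ℂ) ≠ 0 := by exact_mod_cast hlam.ne'
  have hn0 : (0 : ℝ) < n := by positivity
  have az := arg_eq_of_mem_planeSector hn hlam (ne_zero_of_mem_openSector hz) (by omega)
    (openSector_subset_planeSector hn hl0 k hz)
  have hkl : Real.pi / n ≤ k * Real.pi / n := by
    rw [div_le_div_iff_of_pos_right hn0]
    have : (1 : ℝ) ≤ k := by exact_mod_cast hk1
    nlinarith [Real.pi_pos]
  have hku : k * Real.pi / n + Real.pi / n ≤ Real.pi - Real.pi / n := by
    rw [le_sub_iff_add_le, ← add_div, ← add_div, div_le_iff₀ hn0]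
    have : (k : ℝ) + 2 ≤ n := by exact_mod_cast hkn
    nlinarith [Real.pi_pos]
  have h1 := hz.1
  have h2 := hz.2
  exact two_div_le_sin hn (by rw [az]; linarith) (by rw [az]; linarith)

/-- In a sector away from the real axis, the hyperbolic distance is controlled by the moduli. -/
lemma hypQ_le_of_log_norm (hn : 2 ≤ n) (hlam : 0 < lam) {k : ℕ} (hk1 : 1 ≤ k) (hkn : k + 2 ≤ n)
    {z w : ℂ} (hz : z ∈ openSector n lam k) (hw : w ∈ openSector n lam k) {M : ℝ}
    (h : |Real.log ‖z‖ - Real.log ‖w‖| ≤ M) :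
    hypQ z w ≤ 2 * (Real.cosh M + 1) / ((2 / n) * (2 / n)) := by
  have hn0 : (0 : ℝ) < n := by positivity
  have s1 := two_div_le_sin_arg hn hlam hk1 hkn hz
  have s2 := two_div_le_sin_arg hn hlam hk1 hkn hw
  rw [hypQ_eq_polar (im_pos_of_mem_openSector hn hlam hk1 (by omega) hz)
    (im_pos_of_mem_openSector hn hlam hk1 (by omega) hw)]
  have hc : Real.cosh (Real.log ‖z‖ - Real.log ‖w‖) ≤ Real.cosh M := by
    rw [Real.cosh_le_cosh]
    exact h.trans (le_abs_self M)
  have hcos := Real.neg_one_le_cos (z.arg - w.arg)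
  have h1 := Real.one_le_cosh M
  exact div_le_div₀ (by linarith) (by linarith) (by positivity)
    (mul_le_mul s1 s2 (by positivity) (le_trans (by positivity) s1))

lemma signedMap_im_mul (k : ℕ) (z w : ℂ) :
    (signedMap n lam k z).im * (signedMap n lam k w).im =
      (planeMap n lam z).im * (planeMap n lam w).im := by
  rw [signedMap, signedMap]
  rcases neg_one_pow_eq_or ℂ k with e | e <;> rw [e] <;> simp

lemma hypQ_neg (z w : ℂ) : hypQ (-z) (-w) = hypQ z w := by
  have := hypQ_real_mul (t := -1) (by norm_num) z w
  simpa using this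

lemma hypQ_signedMap (k : ℕ) (z w : ℂ) :
    hypQ (signedMap n lam k z) (signedMap n lam k w) =
      hypQ (planeMap n lam z) (planeMap n lam w) := by
  rw [signedMap, signedMap]
  rcases neg_one_pow_eq_or ℂ k with e | e <;> rw [e]
  · rw [one_mul, one_mul]
  · rw [neg_one_mul, neg_one_mul, hypQ_neg]

lemma hypQ_le_hypQ_signedMap (hn : 2 ≤ n) (hlam : 0 < lam) {k : ℕ} (hk1 : 1 ≤ k) (hkn : k + 1 ≤ n)
    {z w : ℂ} (hz : z ∈ openSector n lam k) (hw : w ∈ openSector n lam k)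
    (h : 0 < (signedMap n lam k z).im * (signedMap n lam k w).im) :
    hypQ z w ≤ contractionFactor n k * hypQ (signedMap n lam k z) (signedMap n lam k w) := by
  rw [hypQ_signedMap]
  exact hypQ_le_hypQ_planeMap hn hlam hk1 hkn hz hw (by rwa [signedMap_im_mul] at h)

lemma signedMap_injOn (hn : 2 ≤ n) (hlam : 0 < lam) (k : ℕ) :
    Set.InjOn (signedMap n lam k) (openSector n lam k) := by
  intro z hz w hw h
  exact planeMap_injOn_openSector (by omega) (by exact_mod_cast hlam.ne') k hz hw
    (mul_left_cancel₀ (pow_ne_zero k (by norm_num : (-1 : ℂ) ≠ 0)) h)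

/-- Softplus is positive and strictly increasing, so equal heights force the images into the same
half plane with equal heights again. Heights determine logarithmic moduli up to 2 * C, which bounds
`hypQ` in sectors away from the real axis, and expansion then forces the points to coincide. -/
lemma injOn_height (hn : 2 ≤ n) (hlam : 0 < lam) {k : ℕ → ℕ} (hk : IsAdmissible n k) :
    Set.InjOn (height n lam k) (halfRay n lam k) := by
  obtain ⟨C, hC, hb⟩ := exists_height_bound hn hlam
  intro z hz w hw hzw
  by_contra hne
  refine hne (eq_of_hypQ_nonpos (im_pos_of_mem_halfRay hn hlam hk hz)
    (im_pos_of_mem_halfRay hn hlam hk hw) ?_)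
  refine hypQ_nonpos_of_expanding (n := n) (B := 2 * (Real.cosh (2 * C) + 1) / ((2 / n) * (2 / n)))
    (P := fun k z w => IsAdmissible n k ∧ z ∈ halfRay n lam k ∧ w ∈ halfRay n lam k ∧
      z ≠ w ∧ height n lam k z = height n lam k w) (fun _ _ _ h => h.1) ?_ ?_ ?_
    ⟨hk, hz, hw, hne, hzw⟩
  · rintro k z w ⟨hk, hz, hw, hne, heq⟩
    have hzs := halfRay_subset_openSector hn hlam hk hz
    have hws := halfRay_subset_openSector hn hlam hk hw
    have hle := hypQ_le_hypQ_signedMap hn hlam (hk.one_le 0) (hk.succ_le 0) hzs hws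
    have hinj : signedMap n lam (k 0) z ≠ signedMap n lam (k 0) w := fun h =>
      hne (signedMap_injOn hn hlam _ hzs hws h)
    have hsp : StrictMono (softplus n) := softplus_strictMono (by omega)
    rw [height_eq_foldHeight hn hlam hk hz, height_eq_foldHeight hn hlam hk hw, foldHeight,
      foldHeight] at heq
    rcases signedMap_mem hn hlam hk hz with ⟨a1, a2⟩ | a1 | ⟨a1, a2⟩ <;>
    rcases signedMap_mem hn hlam hk hw with ⟨b1, b2⟩ | b1 | ⟨b1, b2⟩
    · rw [if_pos a1, if_pos b1] at heq
      exact ⟨_, _, ⟨hk.shift, a2, b2, hinj, hsp.injective heq⟩, hle (mul_pos a1 b1)⟩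
    · exfalso
      rw [if_pos a1] at heq
      simp only [b1, Complex.zero_im, lt_irrefl, if_false] at heq
      exact (softplus_pos n _).ne' heq
    · exfalso
      rw [if_pos a1, if_neg b1.not_gt, if_pos b1] at heq
      have := softplus_pos n (height n lam (shift k) (signedMap n lam (k 0) z))
      have := softplus_pos n (height n lam (shift k) (-signedMap n lam (k 0) w))
      linarith
    · exfalso
      rw [if_pos b1] at heq
      simp only [a1, Complex.zero_im, lt_irrefl, if_false] at heq
      exact (softplus_pos n _).ne heq
    · exact absurd (a1.trans b1.symm) hinj
    · exfalso
      rw [if_neg b1.not_gt, if_pos b1] at heq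
      simp only [a1, Complex.zero_im, lt_irrefl, if_false] at heq
      have := softplus_pos n (height n lam (shift k) (-signedMap n lam (k 0) w))
      linarith
    · exfalso
      rw [if_neg a1.not_gt, if_pos a1, if_pos b1] at heq
      have := softplus_pos n (height n lam (shift k) (signedMap n lam (k 0) w))
      have := softplus_pos n (height n lam (shift k) (-signedMap n lam (k 0) z))
      linarith
    · exfalso
      rw [if_neg a1.not_gt, if_pos a1] at heq
      simp only [b1, Complex.zero_im, lt_irrefl, if_false] at heq
      have := softplus_pos n (height n lam (shift k) (-signedMap n lam (k 0) z))
      linarith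
    · rw [if_neg a1.not_gt, if_pos a1, if_neg b1.not_gt, if_pos b1, neg_inj] at heq
      refine ⟨_, _, ⟨hk.shift, a2, b2, fun h => hinj (neg_injective h), hsp.injective heq⟩, ?_⟩
      rw [hypQ_neg]
      exact hle (mul_pos_of_neg_of_neg a1 b1)
  · rintro k z w ⟨hk, hz, hw, -, heq⟩ hgood
    refine hypQ_le_of_log_norm hn hlam (hk.one_le 0) hgood
      (halfRay_subset_openSector hn hlam hk hz) (halfRay_subset_openSector hn hlam hk hw) ?_
    have h1 := abs_le.1 (hb k hk z hz).2.2
    have h2 := abs_le.1 (hb k hk w hw).2.2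
    rw [heq] at h1
    simp only [logMod] at h1 h2
    rw [abs_le]
    constructor <;> linarith
  · have := Real.one_le_cosh (2 * C)
    positivity

/-- The height on the closed half ray, normalized to take values in `[-π / 2, π / 2]`. -/
def arcHeight (n : ℕ) (lam : ℝ) (k : ℕ → ℕ) (x : OnePoint ℂ) : ℝ :=
  x.elim (Real.pi / 2)
    (fun z => if z = 0 then -(Real.pi / 2) else Real.arctan (height n lam k z))

lemma arcHeight_infty (k : ℕ → ℕ) : arcHeight n lam k OnePoint.infty = Real.pi / 2 := rfl

lemma arcHeight_zero (k : ℕ → ℕ) : arcHeight n lam k ((0 : ℂ) : OnePoint ℂ) = -(Real.pi / 2) :=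
  if_pos rfl

lemma arcHeight_coe (k : ℕ → ℕ) {z : ℂ} (hz : z ≠ 0) :
    arcHeight n lam k (z : OnePoint ℂ) = Real.arctan (height n lam k z) := if_neg hz

lemma arcHeight_coe_mem_Ioo (k : ℕ → ℕ) {z : ℂ} (hz : z ≠ 0) :
    arcHeight n lam k (z : OnePoint ℂ) ∈ Set.Ioo (-(Real.pi / 2)) (Real.pi / 2) := by
  rw [arcHeight_coe k hz]
  exact ⟨Real.neg_pi_div_two_lt_arctan _, Real.arctan_lt_pi_div_two _⟩

lemma arcHeight_mem_Icc (k : ℕ → ℕ) (x : OnePoint ℂ) :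
    arcHeight n lam k x ∈ Set.Icc (-(Real.pi / 2)) (Real.pi / 2) := by
  have := Real.pi_pos
  induction x using OnePoint.rec with
  | infty => rw [arcHeight_infty]; constructor <;> linarith
  | coe z =>
    by_cases hz : z = 0
    · rw [hz, arcHeight_zero]; constructor <;> linarith
    · exact Set.Ioo_subset_Icc_self (arcHeight_coe_mem_Ioo k hz)

lemma injOn_arcHeight (hn : 2 ≤ n) (hlam : 0 < lam) {k : ℕ → ℕ} (hk : IsAdmissible n k) :
    Set.InjOn (arcHeight n lam k) (closedHalfRay n lam k) := by
  have hpi := Real.pi_pos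
  rintro x (rfl | rfl | ⟨z, hz, rfl⟩) y (rfl | rfl | ⟨w, hw, rfl⟩) h
  · rfl
  · rw [arcHeight_infty, arcHeight_zero] at h; linarith
  · have := (arcHeight_coe_mem_Ioo (n := n) (lam := lam) k hw.1).2
    rw [← h, arcHeight_infty] at this; linarith
  · rw [arcHeight_infty, arcHeight_zero] at h; linarith
  · rfl
  · have := (arcHeight_coe_mem_Ioo (n := n) (lam := lam) k hw.1).1
    rw [← h, arcHeight_zero] at this; linarith
  · have := (arcHeight_coe_mem_Ioo (n := n) (lam := lam) k hz.1).2
    rw [h, arcHeight_infty] at this; linarith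
  · have := (arcHeight_coe_mem_Ioo (n := n) (lam := lam) k hz.1).1
    rw [h, arcHeight_zero] at this; linarith
  · rw [arcHeight_coe k hz.1, arcHeight_coe k hw.1] at h
    rw [injOn_height hn hlam hk hz hw (Real.arctan_injective h)]

/-- At the endpoints the height differs from the logarithmic modulus by a bounded amount, so it
tends to ±∞ and its arctangent to ±π/2. -/
lemma continuousOn_arcHeight (hn : 2 ≤ n) (hlam : 0 < lam) {k : ℕ → ℕ} (hk : IsAdmissible n k) :
    ContinuousOn (arcHeight n lam k) (closedHalfRay n lam k) := by
  obtain ⟨C, hC, hb⟩ := exists_height_bound hn hlam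
  have hpi := Real.pi_pos
  rintro x (rfl | rfl | ⟨z, hz, rfl⟩)
  · rw [ContinuousWithinAt, arcHeight_infty]
    refine tendsto_order.2 ⟨fun a ha => ?_, fun a ha => Eventually.of_forall fun y =>
      (arcHeight_mem_Icc k y).2.trans_lt ha⟩
    have h1 : ∀ᶠ h : ℝ in atTop, a < Real.arctan h :=
      (Real.tendsto_arctan_atTop.mono_right nhdsWithin_le_nhds).eventually_const_lt ha
    obtain ⟨M, hM⟩ := eventually_atTop.1 h1
    have hinf : ∀ᶠ y : OnePoint ℂ in 𝓝[closedHalfRay n lam k] OnePoint.infty,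
        ∀ z : ℂ, y = (z : OnePoint ℂ) →
        Real.exp (M + C + Real.log ‖critPt n (lam : ℂ) 0‖) < ‖z‖ :=
      tendsto_infty_iff.1 (tendsto_id.mono_left nhdsWithin_le_nhds) _
    filter_upwards [hinf, self_mem_nhdsWithin] with y hy hyX
    rcases hyX with rfl | rfl | ⟨w, hw, rfl⟩
    · rwa [arcHeight_infty]
    · have := hy 0 rfl
      rw [norm_zero] at this
      exact absurd (Real.exp_pos _) this.not_gt
    · rw [arcHeight_coe k hw.1]
      refine hM _ ?_
      have h2 := hy w rfl
      rw [← Real.lt_log_iff_exp_lt (norm_pos_iff.2 hw.1)] at h2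
      have h3 := (abs_le.1 (hb k hk w hw).2.2).1
      simp only [logMod] at h3
      linarith
  · rw [ContinuousWithinAt, arcHeight_zero]
    refine tendsto_order.2 ⟨fun a ha => Eventually.of_forall fun y =>
      ha.trans_le (arcHeight_mem_Icc k y).1, fun a ha => ?_⟩
    have h1 : ∀ᶠ h : ℝ in atBot, Real.arctan h < a :=
      (Real.tendsto_arctan_atBot.mono_right nhdsWithin_le_nhds).eventually_lt_const ha
    obtain ⟨M, hM⟩ := eventually_atBot.1 h1
    have hlim : Tendsto id (𝓝[closedHalfRay n lam k] ((0 : ℂ) : OnePoint ℂ))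
        (𝓝 ((0 : ℂ) : OnePoint ℂ)) := tendsto_id.mono_left nhdsWithin_le_nhds
    obtain ⟨u, hu, hyu⟩ := exists_lift_of_tendsto hlim
    have hu' : Tendsto (fun y => ‖u y‖) (𝓝[closedHalfRay n lam k] ((0 : ℂ) : OnePoint ℂ))
        (𝓝 0) := by simpa using hu.norm
    filter_upwards [hu'.eventually_lt_const
      (Real.exp_pos (M - C + Real.log ‖critPt n (lam : ℂ) 0‖)), hyu,
      self_mem_nhdsWithin] with y hy hyu hyX
    rw [id] at hyu
    rw [hyu] at hyX ⊢
    rcases coe_mem_closedHalfRay.1 hyX with h0 | hw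
    · rwa [h0, arcHeight_zero]
    · rw [arcHeight_coe k hw.1]
      refine hM _ ?_
      rw [← Real.log_lt_iff_lt_exp (norm_pos_iff.2 hw.1)] at hy
      have h3 := (abs_le.1 (hb k hk _ hw).2.2).2
      simp only [logMod] at h3
      linarith
  · have hlim : Tendsto id (𝓝[closedHalfRay n lam k] (z : OnePoint ℂ))
        (𝓝 (z : OnePoint ℂ)) := tendsto_id.mono_left nhdsWithin_le_nhds
    obtain ⟨u, hu, hyu⟩ := exists_lift_of_tendsto hlim
    have hev : ∀ᶠ y in 𝓝[closedHalfRay n lam k] (z : OnePoint ℂ), u y ∈ halfRay n lam k := by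
      filter_upwards [hyu, self_mem_nhdsWithin, hu.eventually_ne hz.1] with y h1 h2 h3
      rw [id] at h1
      rw [h1] at h2
      exact (coe_mem_closedHalfRay.1 h2).resolve_left h3
    rw [ContinuousWithinAt, arcHeight_coe k hz.1]
    have h1 : Tendsto u (𝓝[closedHalfRay n lam k] (z : OnePoint ℂ)) (𝓝[halfRay n lam k] z) :=
      tendsto_nhdsWithin_iff.2 ⟨hu, hev⟩
    refine Tendsto.congr' ?_ ((Real.continuous_arctan.tendsto _).comp
      ((continuousOn_height hn hlam hk z hz).tendsto.comp h1))
    filter_upwards [hyu, hev] with y h2 h3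
    rw [id] at h2
    change Real.arctan (height n lam k (u y)) = _
    rw [← arcHeight_coe k h3.1, ← h2]

lemma infty_mem_closedHalfRay (n : ℕ) (μ : ℂ) (k : ℕ → ℕ) :
    OnePoint.infty ∈ closedHalfRay n μ k := Or.inl rfl

lemma zero_mem_closedHalfRay (n : ℕ) (μ : ℂ) (k : ℕ → ℕ) :
    ((0 : ℂ) : OnePoint ℂ) ∈ closedHalfRay n μ k := Or.inr (Or.inl rfl)

/-- This is the intermediate value theorem on the connected closed half ray, whose endpoints 0 and ∞
have the extreme heights. -/
lemma arcHeight_image (hn : 2 ≤ n) (hlam : 0 < lam) {k : ℕ → ℕ} (hk : IsAdmissible n k) {θ : ℝ}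
    (hθ : θ ∈ Set.Icc (-(Real.pi / 2)) (Real.pi / 2)) :
    ∃ x ∈ closedHalfRay n lam k, arcHeight n lam k x = θ := by
  have h := (isPreconnected_closedHalfRay hn hlam hk).image _ (continuousOn_arcHeight hn hlam hk)
  exact h.Icc_subset ⟨_, zero_mem_closedHalfRay n lam k, arcHeight_zero k⟩
    ⟨_, infty_mem_closedHalfRay n lam k, arcHeight_infty k⟩ hθ

/-! ### Full rays are Jordan curves -/

/-- The map `z ↦ -z` on the Riemann sphere. -/
def sphereNeg : OnePoint ℂ ≃ₜ OnePoint ℂ := (Homeomorph.neg ℂ).onePointCongr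

lemma sphereNeg_coe (z : ℂ) : sphereNeg (z : OnePoint ℂ) = ((-z : ℂ) : OnePoint ℂ) := rfl

lemma sphereNeg_infty : sphereNeg OnePoint.infty = OnePoint.infty := rfl

lemma sphereNeg_sphereNeg (x : OnePoint ℂ) : sphereNeg (sphereNeg x) = x := by
  induction x using OnePoint.rec with
  | infty => rfl
  | coe z => rw [sphereNeg_coe, sphereNeg_coe, neg_neg]

lemma mem_fullRay_iff_closedHalfRay {μ : ℂ} {k : ℕ → ℕ} {x : OnePoint ℂ} :
    x ∈ fullRay n μ k ↔ x ∈ closedHalfRay n μ k ∨ sphereNeg x ∈ closedHalfRay n μ k := by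
  induction x using OnePoint.rec with
  | infty => exact iff_of_true (infty_mem_fullRay n μ k) (Or.inl (Or.inl rfl))
  | coe z =>
    rw [sphereNeg_coe, coe_mem_closedHalfRay, coe_mem_closedHalfRay, coe_mem_fullRay_iff,
      neg_eq_zero]
    tauto

lemma eq_zero_or_infty_of_mem_inter (hn : 2 ≤ n) (hlam : 0 < lam) {k : ℕ → ℕ}
    (hk : IsAdmissible n k) {x : OnePoint ℂ} (h1 : x ∈ closedHalfRay n lam k)
    (h2 : sphereNeg x ∈ closedHalfRay n lam k) :
    x = ((0 : ℂ) : OnePoint ℂ) ∨ x = OnePoint.infty := by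
  induction x using OnePoint.rec with
  | infty => exact Or.inr rfl
  | coe z =>
    rw [sphereNeg_coe, coe_mem_closedHalfRay, neg_eq_zero] at h2
    rw [coe_mem_closedHalfRay] at h1
    rcases h1 with h1 | h1
    · exact Or.inl (by rw [h1])
    rcases h2 with h2 | h2
    · exact Or.inl (by rw [h2])
    have a := im_pos_of_mem_halfRay hn hlam hk h1
    have b := im_pos_of_mem_halfRay hn hlam hk h2
    rw [Complex.neg_im] at b
    linarith

open Classical in
/-- The parametrization of a full ray by the circle, inverted. -/
def rayToCircle (n : ℕ) (lam : ℝ) (k : ℕ → ℕ) (x : OnePoint ℂ) : Circle :=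
  if x ∈ closedHalfRay n lam k then Circle.exp (arcHeight n lam k x)
  else Circle.exp (Real.pi - arcHeight n lam k (sphereNeg x))

/-- The two formulas overlap only at 0 and ∞, where the angles agree modulo 2π. -/
lemma rayToCircle_of_neg_mem (hn : 2 ≤ n) (hlam : 0 < lam) {k : ℕ → ℕ} (hk : IsAdmissible n k)
    {x : OnePoint ℂ} (h : sphereNeg x ∈ closedHalfRay n lam k) :
    rayToCircle n lam k x = Circle.exp (Real.pi - arcHeight n lam k (sphereNeg x)) := by
  rw [rayToCircle]
  split_ifs with h1
  · rcases eq_zero_or_infty_of_mem_inter hn hlam hk h1 h with rfl | rfl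
    · rw [sphereNeg_coe, neg_zero, arcHeight_zero]
      rw [show Real.pi - -(Real.pi / 2) = -(Real.pi / 2) + 2 * Real.pi by ring,
        Circle.exp_add, Circle.exp_two_pi, mul_one]
    · rw [sphereNeg_infty, arcHeight_infty]
      congr 1
      ring
  · rfl

lemma continuousOn_rayToCircle (hn : 2 ≤ n) (hlam : 0 < lam) {k : ℕ → ℕ} (hk : IsAdmissible n k) :
    ContinuousOn (rayToCircle n lam k) (fullRay n lam k) := by
  have hl0 : (lam : ℂ) ≠ 0 := by exact_mod_cast hlam.ne'
  have hX := isClosed_closedHalfRay hn hl0 k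
  have hX' : IsClosed (sphereNeg ⁻¹' closedHalfRay n lam k) :=
    hX.preimage sphereNeg.continuous
  have hunion : fullRay n lam k = closedHalfRay n lam k ∪ sphereNeg ⁻¹' closedHalfRay n lam k :=
    Set.ext fun x => mem_fullRay_iff_closedHalfRay
  rw [hunion]
  refine ContinuousOn.union_of_isClosed ?_ ?_ hX hX'
  · refine ((Circle.exp.continuous).comp_continuousOn (continuousOn_arcHeight hn hlam hk)).congr ?_
    intro x hx
    exact if_pos hx
  · have h1 : ContinuousOn (fun x => Circle.exp (Real.pi - arcHeight n lam k (sphereNeg x)))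
        (sphereNeg ⁻¹' closedHalfRay n lam k) :=
      Circle.exp.continuous.comp_continuousOn (continuousOn_const.sub
        ((continuousOn_arcHeight hn hlam hk).comp sphereNeg.continuous.continuousOn
          (fun x hx => hx)))
    exact h1.congr fun x hx => rayToCircle_of_neg_mem hn hlam hk hx

lemma circle_exp_re (θ : ℝ) : ((Circle.exp θ : Circle) : ℂ).re = Real.cos θ := by
  rw [Circle.coe_exp, Complex.exp_ofReal_mul_I_re]

lemma circle_exp_im (θ : ℝ) : ((Circle.exp θ : Circle) : ℂ).im = Real.sin θ := by
  rw [Circle.coe_exp, Complex.exp_ofReal_mul_I_im]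

/-- The sign of the real part tells the two arcs apart, and on each arc the imaginary part
determines the height because the sine is injective on [-π/2, π/2]. -/
lemma injOn_rayToCircle (hn : 2 ≤ n) (hlam : 0 < lam) {k : ℕ → ℕ} (hk : IsAdmissible n k) :
    Set.InjOn (rayToCircle n lam k) (fullRay n lam k) := by
  have hpi := Real.pi_pos
  have hre : ∀ x ∈ closedHalfRay n lam k, 0 ≤ (rayToCircle n lam k x : ℂ).re := by
    intro x hx
    rw [rayToCircle, if_pos hx, circle_exp_re]
    exact Real.cos_nonneg_of_mem_Icc (arcHeight_mem_Icc k x)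
  have hre' : ∀ x ∉ closedHalfRay n lam k, sphereNeg x ∈ closedHalfRay n lam k →
      (rayToCircle n lam k x : ℂ).re < 0 := by
    intro x hx hx'
    rw [rayToCircle, if_neg hx, circle_exp_re, Real.cos_pi_sub]
    induction x using OnePoint.rec with
    | infty => exact absurd (infty_mem_closedHalfRay n lam k) hx
    | coe z =>
      have hz : z ≠ 0 := by rintro rfl; exact hx (zero_mem_closedHalfRay n lam k)
      have := Real.cos_pos_of_mem_Ioo
        (arcHeight_coe_mem_Ioo (n := n) (lam := lam) k (neg_ne_zero.2 hz))
      rw [sphereNeg_coe]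
      linarith
  intro x hx y hy hxy
  rw [mem_fullRay_iff_closedHalfRay] at hx hy
  by_cases hx1 : x ∈ closedHalfRay n lam k <;> by_cases hy1 : y ∈ closedHalfRay n lam k
  · rw [rayToCircle, rayToCircle, if_pos hx1, if_pos hy1] at hxy
    have h1 := congrArg (fun c : Circle => (c : ℂ).im) hxy
    simp only [circle_exp_im] at h1
    exact injOn_arcHeight hn hlam hk hx1 hy1
      (Real.injOn_sin (arcHeight_mem_Icc k x) (arcHeight_mem_Icc k y) h1)
  · have a := hre x hx1
    have b := hre' y hy1 (hy.resolve_left hy1)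
    rw [hxy] at a
    linarith
  · have a := hre y hy1
    have b := hre' x hx1 (hx.resolve_left hx1)
    rw [hxy] at b
    linarith
  · rw [rayToCircle, rayToCircle, if_neg hx1, if_neg hy1] at hxy
    have h1 := congrArg (fun c : Circle => (c : ℂ).im) hxy
    simp only [circle_exp_im, Real.sin_pi_sub] at h1
    exact sphereNeg.injective (injOn_arcHeight hn hlam hk (hx.resolve_left hx1)
      (hy.resolve_left hy1) (Real.injOn_sin (arcHeight_mem_Icc k _) (arcHeight_mem_Icc k _) h1))

lemma surjOn_rayToCircle (hn : 2 ≤ n) (hlam : 0 < lam) {k : ℕ → ℕ} (hk : IsAdmissible n k)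
    (c : Circle) : ∃ x ∈ fullRay n lam k, rayToCircle n lam k x = c := by
  have hc : (c : ℂ).re ^ 2 + (c : ℂ).im ^ 2 = 1 := by
    rw [← norm_sq_eq, Circle.norm_coe, one_pow]
  have him1 : -1 ≤ (c : ℂ).im := by nlinarith [sq_nonneg (c : ℂ).re]
  have him2 : (c : ℂ).im ≤ 1 := by nlinarith [sq_nonneg (c : ℂ).re]
  obtain ⟨x, hx, hxθ⟩ := arcHeight_image hn hlam hk (Real.arcsin_mem_Icc (c : ℂ).im)
  have hcos : Real.cos (Real.arcsin (c : ℂ).im) = |(c : ℂ).re| := by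
    rw [Real.cos_arcsin, show 1 - (c : ℂ).im ^ 2 = (c : ℂ).re ^ 2 by linarith, Real.sqrt_sq_eq_abs]
  rcases le_or_gt 0 (c : ℂ).re with h | h
  · refine ⟨x, mem_fullRay_iff_closedHalfRay.2 (Or.inl hx), ?_⟩
    rw [rayToCircle, if_pos hx, hxθ]
    refine Circle.ext (Complex.ext ?_ ?_)
    · rw [circle_exp_re, hcos, abs_of_nonneg h]
    · rw [circle_exp_im, Real.sin_arcsin him1 him2]
  · have hx' : sphereNeg (sphereNeg x) ∈ closedHalfRay n lam k := by rwa [sphereNeg_sphereNeg]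
    refine ⟨sphereNeg x, mem_fullRay_iff_closedHalfRay.2 (Or.inr hx'), ?_⟩
    rw [rayToCircle_of_neg_mem hn hlam hk hx', sphereNeg_sphereNeg, hxθ]
    refine Circle.ext (Complex.ext ?_ ?_)
    · rw [circle_exp_re, Real.cos_pi_sub, hcos, abs_of_neg h, neg_neg]
    · rw [circle_exp_im, Real.sin_pi_sub, Real.sin_arcsin him1 him2]

lemma isJordanCurve_fullRay (hn : 2 ≤ n) (hlam : 0 < lam) {k : ℕ → ℕ} (hk : IsAdmissible n k) :
    IsJordanCurve (fullRay n lam k) := by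
  have hl0 : (lam : ℂ) ≠ 0 := by exact_mod_cast hlam.ne'
  have : CompactSpace (fullRay n lam k) :=
    isCompact_iff_compactSpace.1 (isClosed_fullRay hn hl0 k).isCompact
  let f : fullRay n lam k → Circle := fun x => rayToCircle n lam k x
  have hf : Continuous f := continuousOn_iff_continuous_domRestrict.1
    (continuousOn_rayToCircle hn hlam hk)
  have hb : Function.Bijective f := by
    constructor
    · intro x y h
      exact Subtype.ext (injOn_rayToCircle hn hlam hk x.2 y.2 h)
    · intro c
      obtain ⟨x, hx, h⟩ := surjOn_rayToCircle hn hlam hk c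
      exact ⟨⟨x, hx⟩, h⟩
  let e := Continuous.homeoOfEquivCompactToT2 (f := Equiv.ofBijective f hb) hf
  refine ⟨fun c => (e.symm c : OnePoint ℂ), continuous_subtype_val.comp e.symm.continuous,
    Subtype.val_injective.comp e.symm.injective, ?_⟩
  ext x
  constructor
  · rintro ⟨c, rfl⟩
    exact (e.symm c).2
  · intro hx
    exact ⟨e ⟨x, hx⟩, by simp⟩

end Real

/-! ### Escaping points -/

/-- Points of the sphere of modulus larger than `R`. -/
def outside (R : ℝ) : Set (OnePoint ℂ) := ((↑) '' Metric.closedBall (0 : ℂ) R)ᶜ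

lemma coe_mem_outside {R : ℝ} {z : ℂ} : (z : OnePoint ℂ) ∈ outside R ↔ R < ‖z‖ := by
  rw [outside, Set.mem_compl_iff, OnePoint.coe_injective.mem_set_image, mem_closedBall_zero_iff,
    not_le]

lemma infty_mem_outside (R : ℝ) : OnePoint.infty ∈ outside R := by
  rintro ⟨z, -, hz⟩
  exact OnePoint.coe_ne_infty z hz

lemma isOpen_outside (R : ℝ) : IsOpen (outside R) :=
  OnePoint.isOpen_compl_image_coe.2 ⟨Metric.isClosed_closedBall, isCompact_closedBall _ _⟩

lemma chordal_infty_lt_of_mem_outside {x : OnePoint ℂ} {ε : ℝ} (hε : 0 < ε)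
    (hx : x ∈ outside (2 / ε)) : chordal x OnePoint.infty < ε := by
  induction x using OnePoint.rec with
  | infty => rwa [chordal_infty_infty]
  | coe z => exact chordal_coe_infty_lt hε (coe_mem_outside.1 hx)

section Real

variable {n : ℕ} {lam : ℝ}

lemma two_mul_norm_le_planeMap (hn : 2 ≤ n) (hlam : 0 < lam) {z : ℂ} (hz : lam + 2 < ‖z‖) :
    2 * ‖z‖ ≤ ‖planeMap n lam z‖ := by
  have h1 : 1 ≤ ‖z‖ := by linarith
  have h2 : ‖z‖ ^ 2 ≤ ‖z‖ ^ n := pow_le_pow_right₀ h1 hn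
  have h3 : ‖(lam : ℂ) / z ^ n‖ ≤ lam := by
    rw [norm_div, norm_pow, Complex.norm_real, Real.norm_of_nonneg hlam.le]
    exact div_le_self hlam.le (one_le_pow₀ h1)
  have h4 := norm_sub_norm_le (z ^ n) (-((lam : ℂ) / z ^ n))
  rw [norm_neg, sub_neg_eq_add, norm_pow] at h4
  unfold planeMap
  nlinarith

lemma mcMap_mem_outside (hn : 2 ≤ n) (hlam : 0 < lam) {R : ℝ} (hR : lam + 2 ≤ R) {x : OnePoint ℂ}
    (hx : x ∈ outside R) : mcMap n lam x ∈ outside (2 * R) := by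
  induction x using OnePoint.rec with
  | infty => exact infty_mem_outside _
  | coe z =>
    rw [coe_mem_outside] at hx
    have hz : z ≠ 0 := by rintro rfl; rw [norm_zero] at hx; linarith
    rw [mcMap_coe hz, coe_mem_outside]
    have := two_mul_norm_le_planeMap hn hlam (hR.trans_lt hx)
    linarith

lemma mcMap_iterate_mem_outside (hn : 2 ≤ n) (hlam : 0 < lam) {x : OnePoint ℂ}
    (hx : x ∈ outside (lam + 2)) (m : ℕ) : (mcMap n lam)^[m] x ∈ outside (2 ^ m * (lam + 2)) := by
  induction m with
  | zero => simpa using hx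
  | succ m ih =>
    rw [Function.iterate_succ', Function.comp, pow_succ, mul_comm (2 ^ m : ℝ), mul_assoc]
    refine mcMap_mem_outside hn hlam ?_ ih
    exact le_mul_of_one_le_left (by linarith) (one_le_pow₀ one_le_two)

lemma outside_mono {R R' : ℝ} (h : R ≤ R') : outside R' ⊆ outside R :=
  Set.compl_subset_compl.2 (Set.image_mono (Metric.closedBall_subset_closedBall h))

/-- Beyond radius λ + 2 the modulus at least doubles at each step, so the iterates tend to ∞
uniformly on the open set of points that are outside at time m. -/
lemma mem_fatouSet_of_escaping (hn : 2 ≤ n) (hlam : 0 < lam) {x : OnePoint ℂ} {m : ℕ}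
    (hx : (mcMap n lam)^[m] x ∈ outside (lam + 2)) : x ∈ fatouSet (mcMap n lam) := by
  have hl0 : (lam : ℂ) ≠ 0 := by exact_mod_cast hlam.ne'
  refine ⟨(mcMap n lam)^[m] ⁻¹' outside (lam + 2),
    (isOpen_outside _).preimage ((continuous_mcMap (by omega) hl0).iterate m), hx, fun M => ?_⟩
  -- Either some exponent recurs, which gives a constant subsequence of maps, or the exponents tend
  -- to infinity.
  by_cases hc : ∃ c, ∃ᶠ j in atTop, M j = c
  · obtain ⟨c, hc⟩ := hc
    obtain ⟨a, ha, hac⟩ := extraction_of_frequently_atTop hc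
    refine ⟨a, ha, (mcMap n lam)^[c], fun K _ _ ε hε => Eventually.of_forall fun j z _ => ?_⟩
    rw [hac j, chordal_self]
    exact hε
  · push Not at hc
    refine ⟨id, strictMono_id, fun _ => OnePoint.infty, fun K _ hKU ε hε => ?_⟩
    obtain ⟨q, hq⟩ := pow_unbounded_of_one_lt (2 / ε) (one_lt_two (α := ℝ))
    have hM : ∀ᶠ j in atTop, ∀ c ∈ Finset.range (m + q), M j ≠ c :=
      (Finset.eventually_all _).2 fun c _ => hc c
    filter_upwards [hM] with j hj z hz
    have hge : m + q ≤ M j := by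
      by_contra hlt
      exact hj (M j) (Finset.mem_range.2 (not_le.1 hlt)) rfl
    have h1 := mcMap_iterate_mem_outside hn hlam (hKU hz) (M j - m)
    rw [← Function.iterate_add_apply, Nat.sub_add_cancel (by omega)] at h1
    refine chordal_infty_lt_of_mem_outside hε (outside_mono ?_ h1)
    have h2 : (2 : ℝ) ^ q ≤ 2 ^ (M j - m) := pow_le_pow_right₀ one_le_two (by omega)
    have h3 : (2 : ℝ) ^ (M j - m) ≤ 2 ^ (M j - m) * (lam + 2) :=
      le_mul_of_one_le_right (by positivity) (by linarith)
    linarith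

/-- A point with bounded orbit that is a limit of iterated preimages of infinity is not in the
Fatou set. -/
lemma notMem_fatouSet_of_tendsto (hn : 2 ≤ n) (hlam : 0 < lam) {w : ℂ}
    (hw : ∀ m, (mcMap n lam)^[m] (w : OnePoint ℂ) ∉ outside (lam + 2)) {p : ℕ → ℂ}
    (hp : Tendsto p atTop (𝓝 w)) (hpole : ∀ i, ∃ m, (mcMap n lam)^[m] (p i : OnePoint ℂ) = OnePoint.infty) :
    (w : OnePoint ℂ) ∉ fatouSet (mcMap n lam) := by
  have hl0 : (lam : ℂ) ≠ 0 := by exact_mod_cast hlam.ne'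
  rintro ⟨U, hU, hwU, hnorm⟩
  obtain ⟨a, ha, g, hg⟩ := hnorm id
  obtain ⟨i₀, hi₀⟩ := eventually_atTop.1
    ((tendsto_coe hp).eventually (hU.mem_nhds hwU))
  have hq : Tendsto (fun i => (p (i + i₀) : OnePoint ℂ)) atTop (𝓝 (w : OnePoint ℂ)) :=
    (tendsto_coe hp).comp (tendsto_add_atTop_nat i₀)
  set q : ℕ → OnePoint ℂ := fun i => (p (i + i₀) : OnePoint ℂ) with hqdef
  have hK := hq.isCompact_insert_range
  have hKU : insert (w : OnePoint ℂ) (Set.range q) ⊆ U := by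
    rintro y (rfl | ⟨i, rfl⟩)
    · exact hwU
    · exact hi₀ _ (by omega)
  -- An orbit that reaches ∞ stays there, so the limit map equals ∞ at every point of the sequence.
  have hginf : ∀ i, g (q i) = OnePoint.infty := by
    intro i
    obtain ⟨m, hm⟩ := hpole (i + i₀)
    refine eq_infty_of_chordal_lt fun ε hε => ?_
    obtain ⟨j, hj1, hj2⟩ := ((hg _ hK hKU ε hε).and (eventually_ge_atTop m)).exists
    have h1 := hj1 (q i) (Or.inr ⟨i, rfl⟩)
    have h2 : m ≤ a j := hj2.trans (ha.id_le j)
    have h3 : (mcMap n lam)^[id (a j)] (q i) = OnePoint.infty := by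
      rw [id, ← Nat.sub_add_cancel h2, Function.iterate_add_apply, hqdef]
      dsimp only
      rw [hm, mcMap_iterate_infty]
    rwa [h3] at h1
  have hs : 0 < Real.sqrt (1 + (lam + 2) ^ 2) := Real.sqrt_pos.2 (by positivity)
  -- This is half the chordal distance from ∞ to the circle of radius λ + 2. A fixed late iterate is
  -- this close to ∞ at all the q i, hence by continuity at w, whose orbit never leaves the disc.
  have hε : 0 < 1 / Real.sqrt (1 + (lam + 2) ^ 2) := by positivity
  obtain ⟨j, hj⟩ := (hg _ hK hKU _ hε).exists
  simp only [id] at hj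
  have hcont : Tendsto (fun i => (mcMap n lam)^[a j] (q i)) atTop
      (𝓝 ((mcMap n lam)^[a j] (w : OnePoint ℂ))) :=
    (((continuous_mcMap (by omega) hl0).iterate (a j)).tendsto _).comp hq
  have hwj := hw (a j)
  rw [outside, Set.mem_compl_iff, not_not] at hwj
  obtain ⟨v, hv, hvw⟩ := hwj
  rw [← hvw] at hcont
  obtain ⟨u, hu, hqu⟩ := exists_lift_of_tendsto hcont
  have hchord : Tendsto (fun i => 2 / Real.sqrt (1 + ‖u i‖ ^ 2)) atTop
      (𝓝 (2 / Real.sqrt (1 + ‖v‖ ^ 2))) := by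
    have hne : Real.sqrt (1 + ‖v‖ ^ 2) ≠ 0 := (Real.sqrt_pos.2 (by positivity)).ne'
    refine Tendsto.div tendsto_const_nhds ?_ hne
    exact (Real.continuous_sqrt.tendsto _).comp (tendsto_const_nhds.add (hu.norm.pow 2))
  have hle : 2 / Real.sqrt (1 + ‖v‖ ^ 2) ≤ 1 / Real.sqrt (1 + (lam + 2) ^ 2) := by
    refine le_of_tendsto hchord ?_
    filter_upwards [hqu] with i hi
    have := hj (q i) (Or.inr ⟨i, rfl⟩)
    rw [hi, hginf, chordal_coe_infty] at this
    exact this.le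
  have hvn : ‖v‖ ≤ lam + 2 := mem_closedBall_zero_iff.1 hv
  have hsv : 0 < Real.sqrt (1 + ‖v‖ ^ 2) := Real.sqrt_pos.2 (by positivity)
  have hmono : Real.sqrt (1 + ‖v‖ ^ 2) ≤ Real.sqrt (1 + (lam + 2) ^ 2) :=
    Real.sqrt_le_sqrt (by nlinarith [norm_nonneg v])
  rw [div_le_div_iff₀ hsv hs] at hle
  linarith

/-! ### Points of the ray with bounded orbit -/

/-- The points of the full ray whose orbit stays bounded. -/
def boundedRay (n : ℕ) (lam : ℝ) (k : ℕ → ℕ) : Set (OnePoint ℂ) :=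
  {x | x ∈ fullRay n lam k ∧
    ∀ m, (mcMap n lam)^[m] x ∈ (↑) '' Metric.closedBall (0 : ℂ) (lam + 2)}

/-- A point near 0 or ∞ has a large image. Points whose image stays in the disc therefore lie in a
fixed annulus, which is the source of `boundedConst`. -/
lemma norm_bounds_of_planeMap (hn : 2 ≤ n) (hlam : 0 < lam) {z : ℂ} (hz : z ≠ 0)
    (h : ‖planeMap n lam z‖ ≤ lam + 2) : min 1 (lam / (lam + 3)) ≤ ‖z‖ ∧ ‖z‖ ≤ lam + 2 := by
  constructor
  · rcases le_or_gt ‖z‖ 1 with h1 | h1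
    · have h2 := norm_planeMap_ge_of_le_one (n := n) (μ := lam) (by omega) hz h1
      rw [Complex.norm_real, Real.norm_of_nonneg hlam.le] at h2
      have h3 : lam / ‖z‖ ≤ lam + 3 := by linarith
      rw [div_le_iff₀ (norm_pos_iff.2 hz)] at h3
      refine (min_le_right _ _).trans ?_
      rw [div_le_iff₀ (by linarith)]
      linarith
    · exact (min_le_left _ _).trans h1.le
  · by_contra hc
    push Not at hc
    have := two_mul_norm_le_planeMap hn hlam hc
    linarith

lemma abs_log_norm_sub_le_of_planeMap (hn : 2 ≤ n) (hlam : 0 < lam) {z w : ℂ} (hz : z ≠ 0)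
    (hw : w ≠ 0) (h : ‖planeMap n lam z‖ ≤ lam + 2) (h' : ‖planeMap n lam w‖ ≤ lam + 2) :
    |Real.log ‖z‖ - Real.log ‖w‖| ≤
      Real.log (lam + 2) - Real.log (min 1 (lam / (lam + 3))) := by
  obtain ⟨a1, a2⟩ := norm_bounds_of_planeMap hn hlam hz h
  obtain ⟨b1, b2⟩ := norm_bounds_of_planeMap hn hlam hw h'
  have hm : 0 < min 1 (lam / (lam + 3)) := lt_min one_pos (by positivity)
  have c1 := Real.log_le_log hm a1
  have c2 := Real.log_le_log (norm_pos_iff.2 hz) a2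
  have c3 := Real.log_le_log hm b1
  have c4 := Real.log_le_log (norm_pos_iff.2 hw) b2
  rw [abs_le]
  constructor <;> linarith

lemma exists_planeMap_eq (hn : 2 ≤ n) (hlam : 0 < lam) {k : ℕ → ℕ} (hk : IsAdmissible n k)
    {v : ℂ} (hv : v ∈ halfRay n lam (shift k) ∨ v = 0 ∨ -v ∈ halfRay n lam (shift k)) :
    ∃ p ∈ halfRay n lam k, planeMap n lam p = v := by
  have hl := ofReal_mem_fundDomain hn hlam
  have hsub := halfRay_subset_approx hn hlam hk.shift 0
  have hd := branch_domain hn hl (m := 0) hk.shift.one_le hk.shift.succ_le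
    (hv.imp (fun h => hsub h) (Or.imp_right fun h => hsub h))
  obtain ⟨h1, h2⟩ := branch_spec (by omega : 1 ≤ n) hl.1 (k 0) hd
  refine ⟨_, mem_halfRay_iff.2 ⟨ne_zero_of_mem_openSector h1,
    openSector_subset_planeSector hn hl.1 _ h1, ?_⟩, h2⟩
  rwa [h2]

lemma exists_mem_boundedRay_eq {k : ℕ → ℕ} {x : OnePoint ℂ} (hx : x ∈ boundedRay n lam k) :
    ∃ z : ℂ, x = (z : OnePoint ℂ) ∧ z ≠ 0 ∧ ‖z‖ ≤ lam + 2 := by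
  obtain ⟨z, hz, hzx⟩ := hx.2 0
  refine ⟨z, hzx.symm, ?_, mem_closedBall_zero_iff.1 hz⟩
  rintro rfl
  obtain ⟨w, -, hw⟩ := hx.2 1
  change _ = mcMap n lam x at hw
  rw [← show ((0 : ℂ) : OnePoint ℂ) = x from hzx, mcMap_zero] at hw
  exact OnePoint.coe_ne_infty w hw

lemma coe_mem_boundedRay_shift {k : ℕ → ℕ} {z : ℂ} (hz : (z : OnePoint ℂ) ∈ boundedRay n lam k) :
    z ≠ 0 ∧ ‖planeMap n lam z‖ ≤ lam + 2 ∧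
      (planeMap n lam z : OnePoint ℂ) ∈ boundedRay n lam (shift k) := by
  obtain ⟨w, hw, hw0, -⟩ := exists_mem_boundedRay_eq hz
  have hz0 : z ≠ 0 := by rwa [OnePoint.coe_injective hw]
  have h1 : (planeMap n lam z : OnePoint ℂ) ∈ boundedRay n lam (shift k) := by
    rw [← mcMap_coe hz0]
    exact ⟨(mem_fullRay_iff.1 hz.1).2, fun m => hz.2 (m + 1)⟩
  obtain ⟨v, hv, -, hvn⟩ := exists_mem_boundedRay_eq h1
  refine ⟨hz0, ?_, h1⟩
  rwa [OnePoint.coe_injective hv]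

lemma mcMap_sphereNeg (μ : ℂ) (x : OnePoint ℂ) :
    mcMap n μ (sphereNeg x) = if Even n then mcMap n μ x else sphereNeg (mcMap n μ x) := by
  induction x using OnePoint.rec with
  | infty => simp only [sphereNeg_infty, mcMap_infty, ite_self]
  | coe z =>
    rw [sphereNeg_coe]
    by_cases hz : z = 0
    · simp only [hz, neg_zero, mcMap_zero, sphereNeg_infty, ite_self]
    · rw [mcMap_coe hz, mcMap_coe (neg_ne_zero.2 hz), planeMap_neg, sphereNeg_coe]
      split_ifs with h
      · rw [h.neg_one_pow, one_mul]
      · rw [(Nat.not_even_iff_odd.1 h).neg_one_pow, neg_one_mul]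

lemma mcMap_iterate_sphereNeg (μ : ℂ) (m : ℕ) :
    (∀ x, (mcMap n μ)^[m] (sphereNeg x) = (mcMap n μ)^[m] x) ∨
      ∀ x, (mcMap n μ)^[m] (sphereNeg x) = sphereNeg ((mcMap n μ)^[m] x) := by
  induction m with
  | zero => exact Or.inr fun x => rfl
  | succ m ih =>
    simp only [Function.iterate_succ, Function.comp, mcMap_sphereNeg]
    split_ifs with h
    · exact Or.inl fun x => rfl
    · rcases ih with ih | ih
      · exact Or.inl fun x => ih _
      · exact Or.inr fun x => ih _

lemma sphereNeg_mem_image_closedBall {R : ℝ} {x : OnePoint ℂ}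
    (hx : x ∈ (fun z : ℂ => (z : OnePoint ℂ)) '' Metric.closedBall (0 : ℂ) R) :
    sphereNeg x ∈ (fun z : ℂ => (z : OnePoint ℂ)) '' Metric.closedBall (0 : ℂ) R := by
  obtain ⟨z, hz, rfl⟩ := hx
  refine ⟨-z, ?_, rfl⟩
  rw [mem_closedBall_zero_iff] at hz ⊢
  rwa [norm_neg]

lemma sphereNeg_mem_boundedRay {k : ℕ → ℕ} {x : OnePoint ℂ} (hx : x ∈ boundedRay n lam k) :
    sphereNeg x ∈ boundedRay n lam k := by
  refine ⟨?_, fun m => ?_⟩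
  · have := hx.1
    rw [mem_fullRay_iff_closedHalfRay] at this ⊢
    rw [sphereNeg_sphereNeg]
    exact this.symm
  · rcases mcMap_iterate_sphereNeg (n := n) lam m with h | h <;> rw [h]
    · exact hx.2 m
    · exact sphereNeg_mem_image_closedBall (hx.2 m)

/-- The constant that bounds the hyperbolic distance of points with bounded orbit in a sector
away from the real axis. -/
def boundedConst (n : ℕ) (lam : ℝ) : ℝ :=
  2 * (Real.cosh (Real.log (lam + 2) - Real.log (min 1 (lam / (lam + 3)))) + 1) /
    ((2 / n) * (2 / n))

lemma boundedConst_nonneg (n : ℕ) (lam : ℝ) : 0 ≤ boundedConst n lam := by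
  have := Real.one_le_cosh (Real.log (lam + 2) - Real.log (min 1 (lam / (lam + 3))))
  unfold boundedConst
  positivity

lemma hypQ_le_boundedConst (hn : 2 ≤ n) (hlam : 0 < lam) {k : ℕ → ℕ} (hk : IsAdmissible n k)
    (hgood : k 0 + 2 ≤ n) {z w : ℂ} (hz : z ∈ halfRay n lam k) (hw : w ∈ halfRay n lam k)
    (h : ‖planeMap n lam z‖ ≤ lam + 2) (h' : ‖planeMap n lam w‖ ≤ lam + 2) :
    hypQ z w ≤ boundedConst n lam :=
  hypQ_le_of_log_norm hn hlam (hk.one_le 0) hgood (halfRay_subset_openSector hn hlam hk hz)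
    (halfRay_subset_openSector hn hlam hk hw)
    (abs_log_norm_sub_le_of_planeMap hn hlam hz.1 hw.1 h h')

lemma hypQ_pull_back (hn : 2 ≤ n) (hlam : 0 < lam) {k : ℕ → ℕ} (hk : IsAdmissible n k)
    {z w : ℂ} (hz : z ∈ halfRay n lam k) (hw : w ∈ halfRay n lam k)
    (h : 0 < (planeMap n lam z).im * (planeMap n lam w).im) :
    hypQ z w ≤ contractionFactor n (k 0) * hypQ (planeMap n lam z) (planeMap n lam w) :=
  hypQ_le_hypQ_planeMap hn hlam (hk.one_le 0) (hk.succ_le 0)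
    (halfRay_subset_openSector hn hlam hk hz) (halfRay_subset_openSector hn hlam hk hw) h

/-! ### Iterated preimages of infinity accumulate at points with bounded orbit. -/

lemma iterate_pole_neg {p : ℂ}
    (hp : ∃ m, (mcMap n lam)^[m] (p : OnePoint ℂ) = OnePoint.infty) :
    ∃ m, (mcMap n lam)^[m] ((-p : ℂ) : OnePoint ℂ) = OnePoint.infty := by
  obtain ⟨m, hm⟩ := hp
  refine ⟨m, ?_⟩
  rw [← sphereNeg_coe]
  rcases mcMap_iterate_sphereNeg (n := n) lam m with h | h <;> rw [h, hm]
  exact sphereNeg_infty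

/-- Iterated preimages of infinity approximate a bounded orbit backwards by one more step. -/
lemma exists_pole_pull_back (hn : 2 ≤ n) (hlam : 0 < lam) {k : ℕ → ℕ} (hk : IsAdmissible n k)
    {b : ℝ} (ih : ∀ z ∈ halfRay n lam (shift k), (z : OnePoint ℂ) ∈ boundedRay n lam (shift k) →
      ∃ p ∈ halfRay n lam (shift k),
        (∃ m, (mcMap n lam)^[m] (p : OnePoint ℂ) = OnePoint.infty) ∧ hypQ z p ≤ b)
    {z : ℂ} (hz : z ∈ halfRay n lam k) (hzb : (z : OnePoint ℂ) ∈ boundedRay n lam k) :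
    ∃ p ∈ halfRay n lam k, (∃ m, (mcMap n lam)^[m] (p : OnePoint ℂ) = OnePoint.infty) ∧
      hypQ z p ≤ contractionFactor n (k 0) * b := by
  obtain ⟨hz0, -, hb⟩ := coe_mem_boundedRay_shift hzb
  have hne : planeMap n lam z ≠ 0 := (coe_mem_boundedRay_shift hb).1
  have hcf := (contractionFactor_pos n (k 0)).le
  have him : ∀ v ∈ halfRay n lam (shift k), 0 < v.im := fun v hv =>
    im_pos_of_mem_halfRay hn hlam hk.shift hv
  rcases (mem_halfRay_iff.1 hz).2.2 with h | h | h
  · obtain ⟨p₁, hp₁, ⟨m, hm⟩, hQ⟩ := ih _ h hb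
    obtain ⟨p, hp, hpF⟩ := exists_planeMap_eq hn hlam hk (Or.inl hp₁)
    refine ⟨p, hp, ⟨m + 1, ?_⟩, ?_⟩
    · rw [Function.iterate_succ, Function.comp, mcMap_coe hp.1, hpF, hm]
    · refine (hypQ_pull_back hn hlam hk hz hp ?_).trans (mul_le_mul_of_nonneg_left ?_ hcf)
      · rw [hpF]; exact mul_pos (him _ h) (him _ hp₁)
      · rwa [hpF]
  · exact absurd h hne
  · have hb' : ((-planeMap n lam z : ℂ) : OnePoint ℂ) ∈ boundedRay n lam (shift k) :=
      sphereNeg_mem_boundedRay hb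
    obtain ⟨p₁, hp₁, hm, hQ⟩ := ih _ h hb'
    obtain ⟨p, hp, hpF⟩ := exists_planeMap_eq (v := -p₁) hn hlam hk
      (Or.inr (Or.inr (by rwa [neg_neg])))
    obtain ⟨m, hm⟩ := iterate_pole_neg hm
    refine ⟨p, hp, ⟨m + 1, ?_⟩, ?_⟩
    · rw [Function.iterate_succ, Function.comp, mcMap_coe hp.1, hpF, hm]
    · refine (hypQ_pull_back hn hlam hk hz hp ?_).trans (mul_le_mul_of_nonneg_left ?_ hcf)
      · have a := him _ h
        have b := him _ hp₁
        rw [Complex.neg_im] at a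
        rw [hpF, Complex.neg_im]
        nlinarith
      · rw [← hypQ_neg, hpF, neg_neg]
        exact hQ

/-- An approximation available at times of uniform contraction is pulled back to all earlier times
without loss. -/
lemma exists_pole_of_good (hn : 2 ≤ n) (hlam : 0 < lam) {b : ℝ} (hb : 0 ≤ b)
    (hgood : ∀ k, IsAdmissible n k → k 0 + 2 ≤ n → ∀ z ∈ halfRay n lam k,
      (z : OnePoint ℂ) ∈ boundedRay n lam k → ∃ p ∈ halfRay n lam k,
        (∃ m, (mcMap n lam)^[m] (p : OnePoint ℂ) = OnePoint.infty) ∧ hypQ z p ≤ b)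
    {k : ℕ → ℕ} (hk : IsAdmissible n k) {z : ℂ} (hz : z ∈ halfRay n lam k)
    (hzb : (z : OnePoint ℂ) ∈ boundedRay n lam k) :
    ∃ p ∈ halfRay n lam k,
      (∃ m, (mcMap n lam)^[m] (p : OnePoint ℂ) = OnePoint.infty) ∧ hypQ z p ≤ b := by
  obtain ⟨i, -, hi⟩ := hk.frequently 0
  induction i generalizing k z with
  | zero => exact hgood k hk hi z hz hzb
  | succ i ih =>
    obtain ⟨p, hp, hm, hQ⟩ := exists_pole_pull_back hn hlam hk (b := b)
      (fun w hw hwb => ih hk.shift hw hwb hi) hz hzb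
    exact ⟨p, hp, hm, hQ.trans (mul_le_of_le_one_left hb (contractionFactor_le_one n _))⟩

/-- The induction starts from a preimage of 0 in the same sector, at bounded distance when that
sector avoids the real axis. Each pull-back through such a sector multiplies the bound by 5/8. -/
lemma exists_pole_near (hn : 2 ≤ n) (hlam : 0 < lam) (N : ℕ) {k : ℕ → ℕ} (hk : IsAdmissible n k)
    {z : ℂ} (hz : z ∈ halfRay n lam k) (hzb : (z : OnePoint ℂ) ∈ boundedRay n lam k) :
    ∃ p ∈ halfRay n lam k, (∃ m, (mcMap n lam)^[m] (p : OnePoint ℂ) = OnePoint.infty) ∧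
      hypQ z p ≤ (5 / 8) ^ N * boundedConst n lam := by
  have hB := boundedConst_nonneg n lam
  induction N generalizing k z with
  | zero =>
    refine exists_pole_of_good hn hlam (by positivity) ?_ hk hz hzb
    intro k hk hgood z hz hzb
    obtain ⟨p, hp, hpF⟩ := exists_planeMap_eq hn hlam hk (v := 0) (Or.inr (Or.inl rfl))
    refine ⟨p, hp, ⟨2, ?_⟩, ?_⟩
    · change mcMap n lam (mcMap n lam (p : OnePoint ℂ)) = _
      rw [mcMap_coe hp.1, hpF, mcMap_zero]
    · rw [pow_zero, one_mul]
      refine hypQ_le_boundedConst hn hlam hk hgood hz hp (coe_mem_boundedRay_shift hzb).2.1 ?_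
      rw [hpF, norm_zero]
      linarith
  | succ N ih =>
    refine exists_pole_of_good hn hlam (by positivity) ?_ hk hz hzb
    intro k hk hgood z hz hzb
    obtain ⟨p, hp, hm, hQ⟩ := exists_pole_pull_back hn hlam hk
      (fun w hw hwb => ih hk.shift hw hwb) hz hzb
    refine ⟨p, hp, hm, hQ.trans (le_of_eq ?_)⟩
    rw [contractionFactor, if_pos hgood, pow_succ]
    ring

lemma norm_sub_le_of_hypQ_le {z w : ℂ} (hz : 0 < z.im) (hw : 0 < w.im) {q : ℝ} (hq : 0 ≤ q)
    (h : hypQ z w ≤ q ^ 2) : ‖z - w‖ ≤ z.im * (q ^ 2 + q) := by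
  rw [hypQ, div_le_iff₀ (mul_pos hz hw)] at h
  -- Eliminating Im w turns the hypothesis into a quadratic inequality for |z - w| alone, which
  -- fails beyond Im z * (q² + q).
  have h1 : w.im ≤ z.im + ‖z - w‖ := by
    have := Complex.abs_im_le_norm (z - w)
    rw [Complex.sub_im] at this
    have := (abs_le.1 this).1
    linarith
  set δ := ‖z - w‖
  have hδ : 0 ≤ δ := norm_nonneg _
  have h2 : δ ^ 2 ≤ q ^ 2 * (z.im * (z.im + δ)) :=
    h.trans (mul_le_mul_of_nonneg_left (mul_le_mul_of_nonneg_left h1 hz.le) (by positivity))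
  by_contra hc
  push Not at hc
  have h3 : z.im * q < δ - q ^ 2 * z.im := by nlinarith
  have h4 : 0 ≤ z.im * q := by positivity
  have h5 : z.im * q < δ := by
    have : 0 ≤ q ^ 2 * z.im := by positivity
    linarith
  have h6 : (z.im * q) * (z.im * q) < δ * (δ - q ^ 2 * z.im) :=
    mul_lt_mul'' h5 h3 h4 h4
  nlinarith

lemma boundedRay_subset_juliaSet (hn : 2 ≤ n) (hlam : 0 < lam) {k : ℕ → ℕ} (hk : IsAdmissible n k) :
    boundedRay n lam k ⊆ juliaSet (mcMap n lam) := by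
  have hB := boundedConst_nonneg n lam
  have key : ∀ z ∈ halfRay n lam k, (z : OnePoint ℂ) ∈ boundedRay n lam k →
      ∃ p : ℕ → ℂ, Tendsto p atTop (𝓝 z) ∧
        ∀ i, ∃ m, (mcMap n lam)^[m] (p i : OnePoint ℂ) = OnePoint.infty := by
    intro z hz hzb
    choose p hp hm hQ using fun N => exists_pole_near hn hlam N hk hz hzb
    refine ⟨p, ?_, hm⟩
    have hq0 : Tendsto (fun N : ℕ => (5 / 8 : ℝ) ^ N * boundedConst n lam) atTop (𝓝 0) := by
      simpa using (tendsto_pow_atTop_nhds_zero_of_lt_one (r := (5 / 8 : ℝ)) (by norm_num)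
        (by norm_num)).mul_const (boundedConst n lam)
    have hs : Tendsto (fun N : ℕ => Real.sqrt ((5 / 8 : ℝ) ^ N * boundedConst n lam))
        atTop (𝓝 0) := by
      have := (Real.continuous_sqrt.tendsto _).comp hq0
      rwa [Real.sqrt_zero] at this
    have hlim : Tendsto (fun N : ℕ => z.im *
        (Real.sqrt ((5 / 8 : ℝ) ^ N * boundedConst n lam) ^ 2 +
          Real.sqrt ((5 / 8 : ℝ) ^ N * boundedConst n lam))) atTop (𝓝 0) := by
      have := ((hs.pow 2).add hs).const_mul z.im
      simpa using this
    rw [tendsto_iff_norm_sub_tendsto_zero]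
    refine squeeze_zero (fun _ => norm_nonneg _) (fun N => ?_) hlim
    rw [norm_sub_rev]
    refine norm_sub_le_of_hypQ_le (im_pos_of_mem_halfRay hn hlam hk hz)
      (im_pos_of_mem_halfRay hn hlam hk (hp N)) (Real.sqrt_nonneg _) ?_
    rw [Real.sq_sqrt (by positivity)]
    exact hQ N
  intro x hx
  have hout : ∀ m, (mcMap n lam)^[m] x ∉ outside (lam + 2) := fun m h => h (hx.2 m)
  obtain ⟨z, rfl, hz0, -⟩ := exists_mem_boundedRay_eq hx
  rcases coe_mem_fullRay_iff.1 hx.1 with h | h | h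
  · obtain ⟨p, hp, hm⟩ := key z h hx
    exact notMem_fatouSet_of_tendsto hn hlam hout hp hm
  · exact absurd h hz0
  · obtain ⟨p, hp, hm⟩ := key (-z) h (sphereNeg_mem_boundedRay hx)
    have hp' : Tendsto (fun i => -p i) atTop (𝓝 z) := by simpa using hp.neg
    exact notMem_fatouSet_of_tendsto hn hlam hout hp' fun i => iterate_pole_neg (hm i)

lemma fullRay_inter_juliaSet (hn : 2 ≤ n) (hlam : 0 < lam) {k : ℕ → ℕ} (hk : IsAdmissible n k) :
    fullRay n lam k ∩ juliaSet (mcMap n lam) = boundedRay n lam k := by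
  refine Set.Subset.antisymm ?_ fun x hx => ⟨hx.1, boundedRay_subset_juliaSet hn hlam hk hx⟩
  rintro x ⟨h1, h2⟩
  refine ⟨h1, fun m => ?_⟩
  by_contra hc
  exact h2 (mem_fatouSet_of_escaping hn hlam hc)

/-! ### The bounded part of the ray is a Cantor set -/

/-- The finite part of a point of the sphere. -/
def toPlane (x : OnePoint ℂ) : ℂ := x.elim 0 id

lemma toPlane_coe (z : ℂ) : toPlane (z : OnePoint ℂ) = z := rfl

lemma continuousAt_toPlane (z : ℂ) : ContinuousAt toPlane (z : OnePoint ℂ) :=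
  OnePoint.continuousAt_coe.2 continuousAt_id

lemma iterate_mem_boundedRay {k : ℕ → ℕ} {x : OnePoint ℂ} (hx : x ∈ boundedRay n lam k) (i : ℕ) :
    (mcMap n lam)^[i] x ∈ boundedRay n lam (shift^[i] k) := by
  refine ⟨iterate_mem_fullRay hx.1 i, fun m => ?_⟩
  rw [← Function.iterate_add_apply]
  exact hx.2 _

lemma toPlane_sphereNeg (x : OnePoint ℂ) : toPlane (sphereNeg x) = -toPlane x := by
  induction x using OnePoint.rec with
  | infty => rw [sphereNeg_infty]; simp [toPlane]
  | coe z => rfl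

lemma im_toPlane_ne_zero (hn : 2 ≤ n) (hlam : 0 < lam) {k : ℕ → ℕ} (hk : IsAdmissible n k)
    {x : OnePoint ℂ} (hx : x ∈ boundedRay n lam k) : (toPlane x).im ≠ 0 := by
  obtain ⟨z, rfl, hz0, -⟩ := exists_mem_boundedRay_eq hx
  rw [toPlane_coe]
  rcases coe_mem_fullRay_iff.1 hx.1 with h | h | h
  · exact (im_pos_of_mem_halfRay hn hlam hk h).ne'
  · exact absurd h hz0
  · have := im_pos_of_mem_halfRay hn hlam hk h
    rw [Complex.neg_im] at this
    linarith

lemma mem_halfRay_of_im_pos (hn : 2 ≤ n) (hlam : 0 < lam) {k : ℕ → ℕ} (hk : IsAdmissible n k)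
    {z : ℂ} (hz : (z : OnePoint ℂ) ∈ fullRay n lam k) (him : 0 < z.im) : z ∈ halfRay n lam k := by
  rcases coe_mem_fullRay_iff.1 hz with h | h | h
  · exact h
  · rw [h] at him; simp at him
  · have := im_pos_of_mem_halfRay hn hlam hk h
    rw [Complex.neg_im] at this
    linarith

/-- Two points of the bounded ray whose orbits visit the same half planes are equal. -/
lemma eq_of_same_signs_aux (hn : 2 ≤ n) (hlam : 0 < lam) {k : ℕ → ℕ} (hk : IsAdmissible n k)
    {z w : ℂ} (hz : z ∈ halfRay n lam k) (hw : w ∈ halfRay n lam k)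
    (hzb : (z : OnePoint ℂ) ∈ boundedRay n lam k) (hwb : (w : OnePoint ℂ) ∈ boundedRay n lam k)
    (h : ∀ i, 0 < (toPlane ((mcMap n lam)^[i] (z : OnePoint ℂ))).im ↔
      0 < (toPlane ((mcMap n lam)^[i] (w : OnePoint ℂ))).im) : z = w := by
  refine eq_of_hypQ_nonpos (im_pos_of_mem_halfRay hn hlam hk hz)
    (im_pos_of_mem_halfRay hn hlam hk hw) ?_
  refine hypQ_nonpos_of_expanding (n := n) (B := boundedConst n lam)
    (P := fun k z w => IsAdmissible n k ∧ z ∈ halfRay n lam k ∧ w ∈ halfRay n lam k ∧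
      (z : OnePoint ℂ) ∈ boundedRay n lam k ∧ (w : OnePoint ℂ) ∈ boundedRay n lam k ∧
      ∀ i, 0 < (toPlane ((mcMap n lam)^[i] (z : OnePoint ℂ))).im ↔
        0 < (toPlane ((mcMap n lam)^[i] (w : OnePoint ℂ))).im)
    (fun _ _ _ h => h.1) ?_ ?_ (boundedConst_nonneg n lam) ⟨hk, hz, hw, hzb, hwb, h⟩
  · rintro k z w ⟨hk, hz, hw, hzb, hwb, h⟩
    obtain ⟨-, -, hzb'⟩ := coe_mem_boundedRay_shift hzb
    obtain ⟨-, -, hwb'⟩ := coe_mem_boundedRay_shift hwb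
    have h' : ∀ i, 0 < (toPlane ((mcMap n lam)^[i] (planeMap n lam z : OnePoint ℂ))).im ↔
        0 < (toPlane ((mcMap n lam)^[i] (planeMap n lam w : OnePoint ℂ))).im := by
      intro i
      have := h (i + 1)
      rwa [Function.iterate_succ, Function.comp, Function.comp, mcMap_coe hz.1,
        mcMap_coe hw.1] at this
    have h0 := h' 0
    simp only [Function.iterate_zero, id, toPlane_coe] at h0
    have nz := im_toPlane_ne_zero hn hlam hk.shift hzb'
    have nw := im_toPlane_ne_zero hn hlam hk.shift hwb'
    rw [toPlane_coe] at nz nw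
    rcases lt_or_gt_of_ne nz with hneg | hpos
    · have hneg' : (planeMap n lam w).im < 0 :=
        lt_of_le_of_ne (not_lt.1 (mt h0.2 hneg.not_gt)) nw
      have zb : ((-planeMap n lam z : ℂ) : OnePoint ℂ) ∈ boundedRay n lam (shift k) :=
        sphereNeg_mem_boundedRay hzb'
      have wb : ((-planeMap n lam w : ℂ) : OnePoint ℂ) ∈ boundedRay n lam (shift k) :=
        sphereNeg_mem_boundedRay hwb'
      refine ⟨-planeMap n lam z, -planeMap n lam w, ⟨hk.shift, ?_, ?_, zb, wb, fun i => ?_⟩, ?_⟩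
      · exact mem_halfRay_of_im_pos hn hlam hk.shift zb.1 (by rw [Complex.neg_im]; linarith)
      · exact mem_halfRay_of_im_pos hn hlam hk.shift wb.1 (by rw [Complex.neg_im]; linarith)
      · rw [← sphereNeg_coe, ← sphereNeg_coe]
        rcases mcMap_iterate_sphereNeg (n := n) lam i with e | e <;> rw [e, e]
        · exact h' i
        · have a := im_toPlane_ne_zero hn hlam (hk.shift.iterate_shift i)
            (iterate_mem_boundedRay hzb' i)
          have b := im_toPlane_ne_zero hn hlam (hk.shift.iterate_shift i)
            (iterate_mem_boundedRay hwb' i)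
          have c := h' i
          rw [toPlane_sphereNeg, toPlane_sphereNeg, Complex.neg_im, Complex.neg_im, neg_pos,
            neg_pos]
          constructor
          · intro hlt
            exact lt_of_le_of_ne (not_lt.1 (mt c.2 hlt.not_gt)) b
          · intro hlt
            exact lt_of_le_of_ne (not_lt.1 (mt c.1 hlt.not_gt)) a
      · rw [hypQ_neg]
        exact hypQ_pull_back hn hlam hk hz hw (mul_pos_of_neg_of_neg hneg hneg')
    · have hpos' := h0.1 hpos
      exact ⟨_, _, ⟨hk.shift, mem_halfRay_of_im_pos hn hlam hk.shift hzb'.1 hpos,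
        mem_halfRay_of_im_pos hn hlam hk.shift hwb'.1 hpos', hzb', hwb', h'⟩,
        hypQ_pull_back hn hlam hk hz hw (mul_pos hpos hpos')⟩
  · rintro k z w ⟨hk, hz, hw, hzb, hwb, -⟩ hgood
    exact hypQ_le_boundedConst hn hlam hk hgood hz hw (coe_mem_boundedRay_shift hzb).2.1
      (coe_mem_boundedRay_shift hwb).2.1

/-- Both points start in the same half plane; if it is the lower one, negating both reverses signs
consistently along the two orbits and reduces to the half ray. -/
lemma eq_of_same_signs (hn : 2 ≤ n) (hlam : 0 < lam) {k : ℕ → ℕ} (hk : IsAdmissible n k)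
    {x y : OnePoint ℂ} (hx : x ∈ boundedRay n lam k) (hy : y ∈ boundedRay n lam k)
    (h : ∀ i, 0 < (toPlane ((mcMap n lam)^[i] x)).im ↔
      0 < (toPlane ((mcMap n lam)^[i] y)).im) : x = y := by
  have nx := fun i => im_toPlane_ne_zero hn hlam (hk.iterate_shift i) (iterate_mem_boundedRay hx i)
  have ny := fun i => im_toPlane_ne_zero hn hlam (hk.iterate_shift i) (iterate_mem_boundedRay hy i)
  have hx' := sphereNeg_mem_boundedRay hx
  have hy' := sphereNeg_mem_boundedRay hy
  obtain ⟨z, rfl, -, -⟩ := exists_mem_boundedRay_eq hx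
  obtain ⟨w, rfl, -, -⟩ := exists_mem_boundedRay_eq hy
  have h0 := h 0
  have nx0 := nx 0
  have ny0 := ny 0
  simp only [Function.iterate_zero, id, toPlane_coe] at h0 nx0 ny0
  rcases lt_or_gt_of_ne nx0 with hneg | hpos
  · have hneg' : w.im < 0 := lt_of_le_of_ne (not_lt.1 (mt h0.2 hneg.not_gt)) ny0
    have e := eq_of_same_signs_aux hn hlam hk (z := -z) (w := -w)
      (mem_halfRay_of_im_pos hn hlam hk hx'.1 (by rw [Complex.neg_im]; linarith))
      (mem_halfRay_of_im_pos hn hlam hk hy'.1 (by rw [Complex.neg_im]; linarith)) hx' hy'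
      (fun i => by
        rw [← sphereNeg_coe, ← sphereNeg_coe]
        rcases mcMap_iterate_sphereNeg (n := n) lam i with e | e <;> rw [e, e]
        · exact h i
        · have c := h i
          rw [toPlane_sphereNeg, toPlane_sphereNeg, Complex.neg_im, Complex.neg_im, neg_pos,
            neg_pos]
          constructor
          · intro hlt
            exact lt_of_le_of_ne (not_lt.1 (mt c.2 hlt.not_gt)) (ny i)
          · intro hlt
            exact lt_of_le_of_ne (not_lt.1 (mt c.1 hlt.not_gt)) (nx i))
    rw [neg_injective e]
  · rw [eq_of_same_signs_aux hn hlam hk (mem_halfRay_of_im_pos hn hlam hk hx.1 hpos)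
      (mem_halfRay_of_im_pos hn hlam hk hy.1 (h0.1 hpos)) hx hy h]

/-- Preimages in a prescribed half plane. -/
lemma exists_planeMap_eq_sign (hn : 2 ≤ n) (hlam : 0 < lam) {k : ℕ → ℕ} (hk : IsAdmissible n k)
    (b : Bool) {v : ℂ}
    (hv : v ∈ halfRay n lam (shift k) ∨ v = 0 ∨ -v ∈ halfRay n lam (shift k)) :
    ∃ z : ℂ, z ≠ 0 ∧ (bif b then z else -z) ∈ halfRay n lam k ∧ planeMap n lam z = v := by
  cases b with
  | true =>
    obtain ⟨p, hp, h⟩ := exists_planeMap_eq hn hlam hk hv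
    exact ⟨p, hp.1, hp, h⟩
  | false =>
    have hv' : (-1) ^ n * v ∈ halfRay n lam (shift k) ∨ (-1) ^ n * v = 0 ∨
        -((-1) ^ n * v) ∈ halfRay n lam (shift k) := by
      rcases neg_one_pow_eq_or ℂ n with e | e <;> rw [e]
      · rwa [one_mul]
      · rw [neg_one_mul, neg_neg, neg_eq_zero]
        tauto
    obtain ⟨p, hp, h⟩ := exists_planeMap_eq hn hlam hk hv'
    refine ⟨-p, neg_ne_zero.2 hp.1, by rwa [cond_false, neg_neg], ?_⟩
    rw [planeMap_neg, h, ← mul_assoc, ← mul_pow]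
    simp

/-- The points following prescribed half planes for the times up to `N`. -/
def addressSet (n : ℕ) (lam : ℝ) (k : ℕ → ℕ) (b : ℕ → Bool) (N : ℕ) : Set (OnePoint ℂ) :=
  {x | x ∈ fullRay n lam k ∧ ∀ i ≤ N,
    (mcMap n lam)^[i] x ∈ (↑) '' Metric.closedBall (0 : ℂ) (lam + 2) ∧
    (bif b i then (mcMap n lam)^[i] x else sphereNeg ((mcMap n lam)^[i] x)) ∈
      closedHalfRay n lam (shift^[i] k)}

lemma isClosed_addressSet (hn : 2 ≤ n) (hlam : 0 < lam) (k : ℕ → ℕ) (b : ℕ → Bool) (N : ℕ) :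
    IsClosed (addressSet n lam k b N) := by
  have hl0 : (lam : ℂ) ≠ 0 := by exact_mod_cast hlam.ne'
  have hf := fun i => (continuous_mcMap (n := n) (by omega) hl0).iterate i
  have hball : IsClosed ((fun z : ℂ => (z : OnePoint ℂ)) '' Metric.closedBall (0 : ℂ) (lam + 2)) :=
    isOpen_compl_iff.1 (isOpen_outside (lam + 2))
  have : addressSet n lam k b N = fullRay n lam k ∩ ⋂ i, ⋂ (_ : i ≤ N),
      ((mcMap n lam)^[i] ⁻¹' ((fun z : ℂ => (z : OnePoint ℂ)) '' Metric.closedBall (0 : ℂ) (lam + 2)) ∩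
        (fun x => bif b i then (mcMap n lam)^[i] x else sphereNeg ((mcMap n lam)^[i] x)) ⁻¹'
          closedHalfRay n lam (shift^[i] k)) := by
    ext x
    simp only [addressSet, Set.mem_ofPred_eq, Set.mem_inter_iff, Set.mem_iInter, Set.mem_preimage]
  rw [this]
  refine (isClosed_fullRay hn hl0 k).inter (isClosed_iInter fun i => isClosed_iInter fun _ => ?_)
  refine (hball.preimage (hf i)).inter ((isClosed_closedHalfRay hn hl0 _).preimage ?_)
  cases b i with
  | true => exact hf i
  | false => exact sphereNeg.continuous.comp (hf i)

lemma coe_mem_signed_ray {k : ℕ → ℕ} {b : Bool} {z : ℂ}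
    (h : (bif b then z else -z) ∈ halfRay n lam k) :
    (bif b then (z : OnePoint ℂ) else sphereNeg (z : OnePoint ℂ)) ∈ closedHalfRay n lam k ∧
      (z : OnePoint ℂ) ∈ fullRay n lam k := by
  cases b with
  | true => exact ⟨coe_mem_closedHalfRay.2 (Or.inr h), coe_mem_fullRay_iff.2 (Or.inl h)⟩
  | false =>
    exact ⟨coe_mem_closedHalfRay.2 (Or.inr h), coe_mem_fullRay_iff.2 (Or.inr (Or.inr h))⟩

/-- A preimage of 0 in the prescribed half plane serves at the last time. It is then pulled back
through the prescribed half planes, and the preimages stay in the disc because their images do. -/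
lemma addressSet_nonempty (hn : 2 ≤ n) (hlam : 0 < lam) (N : ℕ) {k : ℕ → ℕ}
    (hk : IsAdmissible n k) (b : ℕ → Bool) :
    ∃ z : ℂ, ‖z‖ ≤ lam + 2 ∧ (z : OnePoint ℂ) ∈ addressSet n lam k b N := by
  induction N generalizing k b with
  | zero =>
    obtain ⟨z, hz0, hz, hzF⟩ := exists_planeMap_eq_sign hn hlam hk (b 0) (v := 0)
      (Or.inr (Or.inl rfl))
    have hzn := (norm_bounds_of_planeMap hn hlam hz0 (by rw [hzF, norm_zero]; linarith)).2
    obtain ⟨h2, h3⟩ := coe_mem_signed_ray hz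
    have h1 : (z : OnePoint ℂ) ∈ ((↑) : ℂ → OnePoint ℂ) '' Metric.closedBall (0 : ℂ) (lam + 2) :=
      ⟨z, mem_closedBall_zero_iff.2 hzn, rfl⟩
    refine ⟨z, hzn, h3, fun i hi => ?_⟩
    obtain rfl : i = 0 := by omega
    exact ⟨h1, h2⟩
  | succ N ih =>
    obtain ⟨v, hvn, hv, hvi⟩ := ih hk.shift (fun i => b (i + 1))
    obtain ⟨z, hz0, hz, hzF⟩ := exists_planeMap_eq_sign hn hlam hk (b 0)
      (coe_mem_fullRay_iff.1 hv)
    have hzn := (norm_bounds_of_planeMap hn hlam hz0 (by rw [hzF]; exact hvn)).2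
    obtain ⟨h2, h3⟩ := coe_mem_signed_ray hz
    have h1 : (z : OnePoint ℂ) ∈ ((↑) : ℂ → OnePoint ℂ) '' Metric.closedBall (0 : ℂ) (lam + 2) :=
      ⟨z, mem_closedBall_zero_iff.2 hzn, rfl⟩
    refine ⟨z, hzn, h3, fun i hi => ?_⟩
    cases i with
    | zero => exact ⟨h1, h2⟩
    | succ i =>
      rw [Function.iterate_succ, Function.iterate_succ, Function.comp, Function.comp,
        mcMap_coe hz0, hzF]
      exact hvi i (by omega)

/-- The sets of points with a prescribed finite address are nested, compact and nonempty. A point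
common to all of them has bounded orbit, hence never hits 0, so the closed sign conditions become
strict. -/
lemma exists_mem_boundedRay_of_signs (hn : 2 ≤ n) (hlam : 0 < lam) {k : ℕ → ℕ}
    (hk : IsAdmissible n k) (b : ℕ → Bool) :
    ∃ x ∈ boundedRay n lam k, ∀ i, 0 < (toPlane ((mcMap n lam)^[i] x)).im ↔ b i = true := by
  have hcl := isClosed_addressSet (n := n) hn hlam k b
  obtain ⟨x, hx⟩ := IsCompact.nonempty_iInter_of_sequence_nonempty_isCompact_isClosed
    (addressSet n lam k b) (fun N x hx => ⟨hx.1, fun i hi => hx.2 i (by omega)⟩)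
    (fun N => by
      obtain ⟨z, -, hz⟩ := addressSet_nonempty hn hlam N hk b
      exact ⟨_, hz⟩) (hcl 0).isCompact hcl
  rw [Set.mem_iInter] at hx
  have hxb : x ∈ boundedRay n lam k := ⟨(hx 0).1, fun m => ((hx m).2 m le_rfl).1⟩
  refine ⟨x, hxb, fun i => ?_⟩
  have h1 := ((hx i).2 i le_rfl).2
  have h2 := iterate_mem_boundedRay hxb i
  have hki := hk.iterate_shift i
  obtain ⟨z, hz, hz0, -⟩ := exists_mem_boundedRay_eq h2
  rw [hz, toPlane_coe]
  rw [hz] at h1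
  cases hb : b i with
  | true =>
    rw [hb, cond_true, coe_mem_closedHalfRay] at h1
    exact iff_of_true (im_pos_of_mem_halfRay hn hlam hki (h1.resolve_left hz0)) rfl
  | false =>
    rw [hb, cond_false, sphereNeg_coe, coe_mem_closedHalfRay] at h1
    have := im_pos_of_mem_halfRay hn hlam hki (h1.resolve_left (neg_ne_zero.2 hz0))
    rw [Complex.neg_im] at this
    exact iff_of_false (by linarith) (by simp)

lemma isClosed_boundedRay (hn : 2 ≤ n) (hlam : 0 < lam) (k : ℕ → ℕ) :
    IsClosed (boundedRay n lam k) := by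
  have hl0 : (lam : ℂ) ≠ 0 := by exact_mod_cast hlam.ne'
  have : boundedRay n lam k = fullRay n lam k ∩ ⋂ m, (mcMap n lam)^[m] ⁻¹'
      ((fun z : ℂ => (z : OnePoint ℂ)) '' Metric.closedBall (0 : ℂ) (lam + 2)) := by
    ext x
    simp only [boundedRay, Set.mem_ofPred_eq, Set.mem_inter_iff, Set.mem_iInter, Set.mem_preimage]
  rw [this]
  exact (isClosed_fullRay hn hl0 k).inter (isClosed_iInter fun m =>
    (isOpen_compl_iff.1 (isOpen_outside (lam + 2))).preimage
      ((continuous_mcMap (by omega) hl0).iterate m))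

open Classical in
/-- The half planes visited by the orbit. -/
def signs (n : ℕ) (lam : ℝ) (x : OnePoint ℂ) : ℕ → Bool :=
  fun i => decide (0 < (toPlane ((mcMap n lam)^[i] x)).im)

/-- Along a bounded orbit the imaginary part never vanishes, so each sign is locally constant. -/
lemma continuous_signs (hn : 2 ≤ n) (hlam : 0 < lam) {k : ℕ → ℕ} (hk : IsAdmissible n k) :
    Continuous fun x : boundedRay n lam k => signs n lam x := by
  have hl0 : (lam : ℂ) ≠ 0 := by exact_mod_cast hlam.ne'
  refine continuous_pi fun i => continuous_iff_continuousAt.2 fun x => ?_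
  have hc : ContinuousAt
      (fun y : boundedRay n lam k => (toPlane ((mcMap n lam)^[i] (y : OnePoint ℂ))).im) x := by
    have h1 := iterate_mem_boundedRay x.2 i
    obtain ⟨z, hz, -, -⟩ := exists_mem_boundedRay_eq h1
    have h2 : ContinuousAt toPlane ((mcMap n lam)^[i] (x : OnePoint ℂ)) := by
      rw [hz]; exact continuousAt_toPlane z
    exact Complex.continuous_im.continuousAt.comp (ContinuousAt.comp
      (f := fun y : boundedRay n lam k => (mcMap n lam)^[i] (y : OnePoint ℂ)) h2
      ((((continuous_mcMap (by omega) hl0).iterate i).comp continuous_subtype_val).continuousAt))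
  have hne := im_toPlane_ne_zero hn hlam (hk.iterate_shift i) (iterate_mem_boundedRay x.2 i)
  refine ContinuousAt.congr (f := fun _ => signs n lam x i) continuousAt_const ?_
  rcases lt_or_gt_of_ne hne with h | h
  · filter_upwards [hc.eventually_lt_const h] with y hy
    simp only [signs, h.not_gt, hy.not_gt, decide_false]
  · filter_upwards [hc.eventually_const_lt h] with y hy
    simp only [signs, h, hy, decide_true]

lemma isCantorSet_boundedRay (hn : 2 ≤ n) (hlam : 0 < lam) {k : ℕ → ℕ} (hk : IsAdmissible n k) :
    IsCantorSet (boundedRay n lam k) := by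
  have : CompactSpace (boundedRay n lam k) :=
    isCompact_iff_compactSpace.1 (isClosed_boundedRay hn hlam k).isCompact
  let f : boundedRay n lam k → (ℕ → Bool) := fun x => signs n lam x
  have hf : Continuous f := continuous_signs hn hlam hk
  have hb : Function.Bijective f := by
    constructor
    · intro x y h
      refine Subtype.ext (eq_of_same_signs hn hlam hk x.2 y.2 fun i => ?_)
      have := congrFun h i
      simpa only [f, signs, decide_eq_decide] using this
    · intro b
      obtain ⟨x, hx, h⟩ := exists_mem_boundedRay_of_signs hn hlam hk b
      refine ⟨⟨x, hx⟩, funext fun i => ?_⟩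
      rw [Bool.eq_iff_iff, ← h i]
      simp only [f, signs, decide_eq_true_eq]
  exact ⟨(Continuous.homeoOfEquivCompactToT2 (f := Equiv.ofBijective f hb) hf).trans
    cantorSetHomeomorphNatToBool.symm⟩

end Real

/-! ### Hausdorff convergence -/

lemma exists_nhds_chordal_lt (w : OnePoint ℂ) {ε : ℝ} (hε : 0 < ε) :
    ∃ N ∈ 𝓝 w, ∀ x ∈ N, ∀ y ∈ N, chordal x y < ε := by
  have h : Tendsto (fun p : OnePoint ℂ × OnePoint ℂ => chordal p.1 p.2) (𝓝 w ×ˢ 𝓝 w) (𝓝 0) :=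
    chordal_tendsto_zero tendsto_fst tendsto_snd
  obtain ⟨N, hN, hNs⟩ := mem_prod_same_iff.1 (h.eventually_lt_const hε)
  exact ⟨N, hN, fun x hx y hy => hNs (Set.mk_mem_prod hx hy)⟩

lemma exists_tendsto_ultrafilter {ι X : Type*} [TopologicalSpace X] [CompactSpace X]
    (U : Ultrafilter ι) (x : ι → X) : ∃ x₀, Tendsto x U (𝓝 x₀) := by
  obtain ⟨x₀, -, h⟩ := isCompact_univ.ultrafilter_le_nhds (U.map x) (by simp)
  exact ⟨x₀, h⟩

section Limits

variable {ι : Type*} {l : Filter ι} {n : ℕ} {μ : ι → ℂ} {lam : ℝ} {k : ℕ → ℕ}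

/-- The half rays of nearby parameters come close to every point of the limiting half ray, because
they connect `0` to `∞`. -/
lemma eventually_closedHalfRay_inter_nonempty (hn : 2 ≤ n) (hlam : 0 < lam) (hk : IsAdmissible n k)
    (hfund : ∀ j, μ j ∈ fundDomain n) (hμ : Tendsto μ l (𝓝 (lam : ℂ))) {w : OnePoint ℂ}
    (hw : w ∈ closedHalfRay n lam k) {N : Set (OnePoint ℂ)} (hN : N ∈ 𝓝 w) :
    ∀ᶠ j in l, (closedHalfRay n (μ j) k ∩ N).Nonempty := by
  have hl0 : (lam : ℂ) ≠ 0 := by exact_mod_cast hlam.ne'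
  -- Along an ultrafilter every choice of points on the rays converges, by compactness of the
  -- sphere, and no subsequences are needed.
  refine mem_iff_ultrafilter.2 fun U hU => ?_
  by_contra hc
  have hc' : ∀ᶠ j in U, ∀ x ∈ closedHalfRay n (μ j) k, x ∉ N := by
    filter_upwards [Ultrafilter.compl_mem_iff_notMem.2 hc] with j hj x hx hxN
    exact hj ⟨x, hx, hxN⟩
  obtain ⟨j₀, hj₀⟩ := hc'.exists
  have h0 := hj₀ _ (zero_mem_closedHalfRay n (μ j₀) k)
  have hi := hj₀ _ (infty_mem_closedHalfRay n (μ j₀) k)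
  set a := arcHeight n lam k
  have haw0 : -(Real.pi / 2) < a w := by
    refine lt_of_le_of_ne (arcHeight_mem_Icc k w).1 fun h => h0 ?_
    rw [← arcHeight_zero (n := n) (lam := lam) k] at h
    rw [injOn_arcHeight hn hlam hk (zero_mem_closedHalfRay n lam k) hw h]
    exact mem_of_mem_nhds hN
  have hawi : a w < Real.pi / 2 := by
    refine lt_of_le_of_ne (arcHeight_mem_Icc k w).2 fun h => hi ?_
    rw [← arcHeight_infty (n := n) (lam := lam) k] at h
    rw [← injOn_arcHeight hn hlam hk hw (infty_mem_closedHalfRay n lam k) h]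
    exact mem_of_mem_nhds hN
  have hclosed := isClosed_closedHalfRay hn hl0 k
  have hcont := continuousOn_arcHeight hn hlam hk
  -- Outside N, the limit arc splits at w into disjoint closed pieces: a lower one containing 0 and
  -- an upper one containing ∞.
  have hP : IsClosed (closedHalfRay n lam k ∩ a ⁻¹' Set.Iic (a w) ∩ (interior N)ᶜ) :=
    (hcont.preimage_isClosed_of_isClosed hclosed isClosed_Iic).inter
      isOpen_interior.isClosed_compl
  have hQ : IsClosed (closedHalfRay n lam k ∩ a ⁻¹' Set.Ici (a w) ∩ (interior N)ᶜ) :=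
    (hcont.preimage_isClosed_of_isClosed hclosed isClosed_Ici).inter
      isOpen_interior.isClosed_compl
  obtain ⟨V₁, V₂, hV₁, hV₂, hPV, hQV, hdisj⟩ := normal_separation hP hQ (by
    rw [Set.disjoint_left]
    rintro x ⟨⟨hx, hx1⟩, hx2⟩ ⟨⟨-, hx3⟩, -⟩
    apply hx2
    rw [injOn_arcHeight hn hlam hk hx hw (le_antisymm hx1 hx3)]
    exact mem_interior_iff_mem_nhds.2 hN)
  have h0V : ((0 : ℂ) : OnePoint ℂ) ∈ V₁ :=
    hPV ⟨⟨zero_mem_closedHalfRay n lam k, (arcHeight_zero k).trans_le haw0.le⟩,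
      fun h => h0 (interior_subset h)⟩
  have hiV : OnePoint.infty ∈ V₂ :=
    hQV ⟨⟨infty_mem_closedHalfRay n lam k, hawi.le.trans_eq (arcHeight_infty k).symm⟩,
      fun h => hi (interior_subset h)⟩
  -- The connected core joins 0 in V₁ to ∞ in V₂, so it has a point outside both sets. A limit of
  -- such points lies on the limit arc, outside both pieces and outside the interior of N, which is
  -- impossible.
  have hy : ∀ j, ∃ y ∈ closedHalfRay n (μ j) k, y ∉ V₁ ∪ V₂ := by
    intro j
    by_contra! hcov
    have hcore := rayCore_subset_closedHalfRay hn (hfund j).1 k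
    obtain ⟨y, -, hy⟩ := isPreconnected_rayCore hn (hfund j) hk.one_le hk.succ_le V₁ V₂ hV₁ hV₂
      (fun x hx => hcov x (hcore hx))
      ⟨_, zero_mem_rayCore hn (hfund j) hk.one_le hk.succ_le, h0V⟩
      ⟨_, infty_mem_rayCore hn (hfund j) hk.one_le hk.succ_le, hiV⟩
    exact Set.disjoint_left.1 hdisj hy.1 hy.2
  choose y hy hyV using hy
  obtain ⟨y₀, hy₀⟩ := exists_tendsto_ultrafilter U y
  have hmem : y₀ ∈ closedHalfRay n lam k :=
    closedHalfRay_of_tendsto hn hl0 (hμ.mono_left hU)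
      (critPt_tendsto (Complex.ofReal_mem_slitPlane.2 hlam) (hμ.mono_left hU)) hy₀
      (Eventually.of_forall hy)
  have hV : y₀ ∉ V₁ ∪ V₂ := (hV₁.union hV₂).isClosed_compl.mem_of_tendsto hy₀
    (Eventually.of_forall hyV)
  have hNy : y₀ ∉ interior N := isOpen_interior.isClosed_compl.mem_of_tendsto hy₀
    (hc'.mono fun j hj h => hj _ (hy j) (interior_subset h))
  rcases le_total (a y₀) (a w) with h | h
  · exact hV (Or.inl (hPV ⟨⟨hmem, h⟩, hNy⟩))
  · exact hV (Or.inr (hQV ⟨⟨hmem, h⟩, hNy⟩))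

lemma eventually_fullRay_inter_nonempty (hn : 2 ≤ n) (hlam : 0 < lam) (hk : IsAdmissible n k)
    (hfund : ∀ j, μ j ∈ fundDomain n) (hμ : Tendsto μ l (𝓝 (lam : ℂ))) {w : OnePoint ℂ}
    (hw : w ∈ fullRay n lam k) {N : Set (OnePoint ℂ)} (hN : N ∈ 𝓝 w) :
    ∀ᶠ j in l, (fullRay n (μ j) k ∩ N).Nonempty := by
  rcases mem_fullRay_iff_closedHalfRay.1 hw with h | h
  · filter_upwards [eventually_closedHalfRay_inter_nonempty hn hlam hk hfund hμ h hN]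
      with j ⟨x, hx, hxN⟩
    exact ⟨x, mem_fullRay_iff_closedHalfRay.2 (Or.inl hx), hxN⟩
  · have hN' : sphereNeg ⁻¹' N ∈ 𝓝 (sphereNeg w) :=
      sphereNeg.continuous.continuousAt.preimage_mem_nhds (by rwa [sphereNeg_sphereNeg])
    filter_upwards [eventually_closedHalfRay_inter_nonempty hn hlam hk hfund hμ h hN']
      with j ⟨x, hx, hxN⟩
    exact ⟨sphereNeg x, mem_fullRay_iff_closedHalfRay.2 (Or.inr (by rwa [sphereNeg_sphereNeg])), hxN⟩

end Limits

/-- One inclusion is the joint closedness of the rays. The other uses that nearby rays meet each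
neighbourhood of a limit point of the chosen w j. Ultrafilters and compactness make both uniform
over the ray. -/
lemma hausdorffTendsto_fullRay {n : ℕ} {μ : ℕ → ℂ} {lam : ℝ} {k : ℕ → ℕ} (hn : 2 ≤ n)
    (hlam : 0 < lam) (hk : IsAdmissible n k) (hfund : ∀ j, μ j ∈ fundDomain n)
    (hμ : Tendsto μ atTop (𝓝 (lam : ℂ))) :
    HausdorffTendsto (fun j => fullRay n (μ j) k) (fullRay n lam k) := by
  have hl0 : (lam : ℂ) ≠ 0 := by exact_mod_cast hlam.ne'
  intro ε hε
  refine Eventually.and ?_ ?_ <;> refine mem_iff_ultrafilter.2 fun U hU => ?_ <;> by_contra hc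
  · have hc' : ∀ᶠ j in U, ∃ z, z ∈ fullRay n (μ j) k ∧ ∀ w ∈ fullRay n lam k, ε ≤ chordal z w := by
      filter_upwards [Ultrafilter.compl_mem_iff_notMem.2 hc] with j hj
      simpa using hj
    obtain ⟨z, hz⟩ := hc'.choice
    obtain ⟨z₀, hz₀⟩ := exists_tendsto_ultrafilter U z
    have hmem : z₀ ∈ fullRay n lam k :=
      fullRay_of_tendsto hn hl0 (hμ.mono_left hU)
        (critPt_tendsto (Complex.ofReal_mem_slitPlane.2 hlam) (hμ.mono_left hU)) hz₀
        (hz.mono fun j hj => hj.1)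
    have hlt := (chordal_tendsto_zero hz₀ (tendsto_const_nhds (x := z₀))).eventually_lt_const hε
    obtain ⟨j, h1, h2⟩ := (hlt.and hz).exists
    exact (h2.2 _ hmem).not_gt h1
  · have hc' : ∀ᶠ j in U, ∃ w, w ∈ fullRay n lam k ∧ ∀ z ∈ fullRay n (μ j) k, ε ≤ chordal z w := by
      filter_upwards [Ultrafilter.compl_mem_iff_notMem.2 hc] with j hj
      simpa using hj
    obtain ⟨w, hw⟩ := hc'.choice
    obtain ⟨w₀, hw₀⟩ := exists_tendsto_ultrafilter U w
    have hmem : w₀ ∈ fullRay n lam k :=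
      (isClosed_fullRay hn hl0 k).mem_of_tendsto hw₀ (hw.mono fun j hj => hj.1)
    obtain ⟨N, hN, hchord⟩ := exists_nhds_chordal_lt w₀ hε
    obtain ⟨j, ⟨⟨z, hz, hzN⟩, h2⟩, h3⟩ :=
      (((eventually_fullRay_inter_nonempty hn hlam hk hfund (hμ.mono_left hU) hmem hN).and hw).and
        (hw₀ hN)).exists
    exact (h2.2 z hz).not_gt (hchord z hzN _ h3)

end McMullen

end

/-- Cut rays with real parameters. -/
theorem theorem3 (n : ℕ) (hn : 3 ≤ n) (t : ℝ) (ht : t ∈ McMullen.ThetaPer n)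
    (s : ℕ → ℤ) (hs : McMullen.IsItinerary n t s) (lam : ℝ) (hlam : 0 < lam) :
    McMullen.IsJordanCurve (McMullen.modifiedCutRay n lam s) ∧
    McMullen.IsCantorSet
      (McMullen.modifiedCutRay n lam s ∩ McMullen.juliaSet (McMullen.mcMap n lam)) ∧
    ∀ μ : ℕ → ℂ, (∀ j, μ j ∈ McMullen.fundDomain n) → Tendsto μ atTop (𝓝 (lam : ℂ)) →
      McMullen.HausdorffTendsto (fun j => McMullen.cutRay n (μ j) s)
        (McMullen.modifiedCutRay n lam s) := by
  have hn2 : 2 ≤ n := by omega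
  have hk := McMullen.isAdmissible_of_isItinerary hn2 ht hs
  have hs0 : ∀ i, s i ≠ 0 := fun i h => by
    have := (hs i).1.1
    rw [h] at this
    norm_num at this
  rw [McMullen.modifiedCutRay_eq_fullRay hn2 hlam hs0 hk]
  refine ⟨McMullen.isJordanCurve_fullRay hn2 hlam hk, ?_, fun μ hfund hμ => ?_⟩
  · rw [McMullen.fullRay_inter_juliaSet hn2 hlam hk]
    exact McMullen.isCantorSet_boundedRay hn2 hlam hk
  · simp only [McMullen.cutRay_eq_fullRay hn2 (hfund _) hs0 hk]
    exact McMullen.hausdorffTendsto_fullRay hn2 hlam hk hfund hμ
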